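/- Let $I\subseteq\mathbb{R}$ be an interval, bounded or not, and let $\mathfrak{F}=\bigoplus_{N\ge 0}L^2_{\mathrm{sym}}(I^N)$ be the bosonic Fock space over $L^2(I)$, with vacuum $\Omega$ and annihilation field $(\psi(x)f)_N(y_1,\dots,y_N)=\sqrt{N+1}\,f_{N+1}(x,y_1,\dots,y_N)$. Let $\mathcal{D}\subseteq\mathfrak{F}$ be the dense subspace of all $f$ with $\sum_N c^N\|f_N\|^2<\infty$ for every $c>0$. Let $D\ge 0$, let $B\in M_D(\mathbb{C})$, and let $Q,L,R,T$ be $M_D(\mathbb{C})$-valued functions on $I$ with entries in $L^1(I)$, $L^2(I)$, $L^2(I)$, $L^\infty(I)$ respectively; call such $(B,Q,L,R,T)$ admissible tensors. Put $\mathfrak{L}_x=Q(x)\otimes\mathrm{Id}+L(x)\otimes l_x+R(x)\otimes r_x+T(x)\otimes\mathrm{Ad}_x$, where $l_x[X]=\psi^\dagger(x)X$, $r_x[X]=X\psi(x)$ and $\mathrm{Ad}_x[X]=\psi^\dagger(x)X\psi(x)$. A linear operator $O:\mathcal{D}\to\mathcal{D}$ is the continuous matrix product operator (cMPO) with tensors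 $(B,Q,L,R,T)$, of bond dimension $D$, written $$O=\mathrm{Tr}_D\Big(B\,\mathcal{P}e^{\int_I\mathfrak{L}_x\,dx}\Big)\big(|\Omega\rangle\langle\Omega|\big),$$ if it is given by the Dyson series of this path-ordered exponential, that is, if for all $g\in\mathfrak{F}$ and $f\in\mathcal{D}$ $$\langle g,Of\rangle=\sum_{n\ge 0}\ \int_{x_1<\dots<x_n,\ x_i\in I}\mathrm{Tr}_D\Big(B\,\langle g|\,\mathfrak{L}_{x_1}\cdots\mathfrak{L}_{x_n}\big[\mathbb{1}_D\otimes|\Omega\rangle\langle\Omega|\big]\,|f\rangle\Big)\,dx_1\cdots dx_n ,$$ where every integrand is integrable, the series converges unconditionally, and matrix elements are read as $\langle g|\psi^\dagger(x)X|f\rangle=\langle\psi(x)g|X|f\rangle$. Then: 1. For all admissible tensors $(B,Q,L,R,T)$ there is exactly one operator $O:\mathcal{D}\to\mathcal{D}$ that is the cMPO with these tensors. 2. If $O_1$ and $O_2$ are the cMPOs with admissible tensors $(B_i,Q_i,L_i,R_i,T_i)$ of bond dimension $D_i$ ($i=1,2$), then the product $O_1O_2:\mathcal{D}\to\mathcal{D}$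 is again a cMPO, of bond dimension at most $D_1D_2$. The tensors $$B=B_1\otimes B_2,\qquad T=T_1\otimes T_2,\qquad Q=Q_1\otimes\mathbb{1}+\mathbb{1}\otimes Q_2+R_1\otimes L_2,$$ $$L=L_1\otimes\mathbb{1}+T_1\otimes L_2,\qquad R=\mathbb{1}\otimes R_2+R_1\otimes T_2$$ are admissible, and $O_1O_2$ is the cMPO with these tensors. -/

import Mathlib

open MeasureTheory
open scoped ENNReal ComplexConjugate Kronecker InnerProductSpace

noncomputable section

namespace CMPO

/-! ### The bosonic Fock space over `L²(I)` -/

/-- The measure `dx₁ ⋯ dx_N` on `I^N`. -/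
abbrev configMeasure (I : Set ℝ) (N : ℕ) : Measure (Fin N → ℝ) :=
  Measure.pi fun _ => (volume : Measure ℝ).restrict I

/-- Relabelling the particles preserves `dx₁ ⋯ dx_N`. -/
theorem measurePreserving_perm (I : Set ℝ) {N : ℕ} (σ : Equiv.Perm (Fin N)) :
    MeasurePreserving (fun x : Fin N → ℝ => x ∘ σ) (configMeasure I N) (configMeasure I N) := by
  have h := measurePreserving_piCongrLeft
    (fun _ : Fin N => (volume : Measure ℝ).restrict I) σ.symm
  have e : (fun x : Fin N → ℝ => x ∘ σ) =
      MeasurableEquiv.piCongrLeft (fun _ : Fin N => ℝ) σ.symm := by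
    funext x i
    have := Equiv.piCongrLeft_apply_apply (fun _ : Fin N => ℝ) σ.symm x (σ i)
    simpa [MeasurableEquiv.coe_piCongrLeft] using this.symm
  rw [e]
  exact h

/-- The `N`-particle space: the elements of `L²(I^N)` that are symmetric under permutation of
the particles. -/
def sector (I : Set ℝ) (N : ℕ) : Submodule ℂ (Lp ℂ 2 (configMeasure I N)) :=
  ⨅ σ : Equiv.Perm (Fin N),
    LinearMap.eqLocus (Lp.compMeasurePreservingₗ ℂ _ (measurePreserving_perm I σ)) LinearMap.id

/-- The Fock space: the Hilbert sum of the symmetric `N`-particle spaces. -/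
abbrev Fock (I : Set ℝ) : Type := lp (fun N : ℕ => sector I N) 2

/-- The vectors `f` of the Fock space with `∑ c^N ‖f_N‖² < ∞` for every `c`. They form a dense
subspace, which contains all vectors of finite particle number and all coherent states. -/
def expDomain (I : Set ℝ) : Submodule ℂ (Fock I) where
  carrier := {f | ∀ c : ℝ, Summable fun N : ℕ => c ^ N * ‖f N‖ ^ 2}
  zero_mem' := by
    intro c
    simp
  add_mem' := by
    intro f g hf hg c
    have h := ((hf |c|).add (hg |c|)).mul_left 2
    refine Summable.of_norm_bounded h fun N => ?_
    have h1 : ‖(f + g) N‖ ≤ ‖f N‖ + ‖g N‖ := by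
      rw [lp.coeFn_add, Pi.add_apply]
      exact norm_add_le _ _
    have h2 : ‖(f + g) N‖ ^ 2 ≤ 2 * (‖f N‖ ^ 2 + ‖g N‖ ^ 2) := by
      nlinarith [norm_nonneg ((f + g) N), norm_nonneg (f N), norm_nonneg (g N),
        sq_nonneg (‖f N‖ - ‖g N‖)]
    have h3 : 0 ≤ |c| ^ N := pow_nonneg (abs_nonneg c) N
    rw [norm_mul, norm_pow, norm_pow, norm_norm, Real.norm_eq_abs]
    nlinarith [mul_le_mul_of_nonneg_left h2 h3]
  smul_mem' := by
    intro a f hf c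
    have h := (hf c).mul_left (‖a‖ ^ 2)
    refine h.congr fun N => ?_
    rw [lp.coeFn_smul, Pi.smul_apply, norm_smul]
    ring

/-- `expDomain I` is dense in the Fock space. -/
theorem dense_expDomain (I : Set ℝ) : Dense (expDomain I : Set (Fock I)) := by
  intro f
  have h := lp.hasSum_single (E := fun N : ℕ => sector I N) (p := 2) (by simp) f
  refine mem_closure_of_tendsto h (Filter.Eventually.of_forall fun s => ?_)
  refine Submodule.sum_mem _ fun N _ c => ?_
  refine summable_of_ne_finset_zero (s := {N}) fun M hM => ?_
  have hMN : M ≠ N := by simpa using hM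
  have : (lp.single 2 N (f N) : Fock I) M = 0 := by
    simp [lp.single_apply, hMN]
  rw [this]
  simp

/-! ### Field operators and supermaps

Operators are described by their matrix elements `⟨g|X|f⟩`. -/

/-- Sequences of `N`-particle wave functions. -/
abbrev WaveFn : Type := (N : ℕ) → (Fin N → ℝ) → ℂ

/-- The wave functions of a Fock space vector. -/
def wave {I : Set ℝ} (f : Fock I) : WaveFn := fun N => ((f N : Lp ℂ 2 (configMeasure I N)) : _ → ℂ)

/-- The annihilation field: `(ψ(x) φ)_N (y₁, …, y_N) = √(N+1) φ_{N+1} (x, y₁, …, y_N)`. -/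
def annih (x : ℝ) (φ : WaveFn) : WaveFn :=
  fun N y => (Real.sqrt (N + 1) : ℂ) * φ (N + 1) (Fin.cons x y)

/-- Matrix elements `(g, f) ↦ ⟨g|X|f⟩`; with `V = Matrix ι ι ℂ`, these are the matrix elements
of an element `X` of `M_D(ℂ) ⊗ operators`. -/
abbrev Form (V : Type) : Type := WaveFn → WaveFn → V

/-- `l_x[X] = ψ†(x) X`, that is `⟨g|l_x[X]|f⟩ = ⟨ψ(x) g|X|f⟩`. -/
def lMap {V : Type} (x : ℝ) (X : Form V) : Form V := fun g f => X (annih x g) f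

/-- `r_x[X] = X ψ(x)`. -/
def rMap {V : Type} (x : ℝ) (X : Form V) : Form V := fun g f => X g (annih x f)

/-- `Ad_x[X] = ψ†(x) X ψ(x)`. -/
def adMap {V : Type} (x : ℝ) (X : Form V) : Form V := fun g f => X (annih x g) (annih x f)

/-- `1_D ⊗ |Ω⟩⟨Ω|`. -/
def vacuumProj (ι : Type) [Fintype ι] [DecidableEq ι] : Form (Matrix ι ι ℂ) :=
  fun g f => (conj (g 0 Fin.elim0) * f 0 Fin.elim0) • (1 : Matrix ι ι ℂ)

/-! ### Continuous matrix product operators -/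

/-- A boundary matrix and four matrix-valued functions. The bond dimension is the cardinality
of `ι`. -/
structure Tensors (ι : Type) where
  B : Matrix ι ι ℂ
  Q : ℝ → Matrix ι ι ℂ
  L : ℝ → Matrix ι ι ℂ
  R : ℝ → Matrix ι ι ℂ
  T : ℝ → Matrix ι ι ℂ

/-- The entries of `Q`, `L`, `R`, `T` lie in `L¹(I)`, `L²(I)`, `L²(I)`, `L^∞(I)`. -/
structure Tensors.Admissible {ι : Type} (I : Set ℝ) (A : Tensors ι) : Prop where
  Q_mem : ∀ i j, MemLp (fun x => A.Q x i j) 1 (volume.restrict I)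
  L_mem : ∀ i j, MemLp (fun x => A.L x i j) 2 (volume.restrict I)
  R_mem : ∀ i j, MemLp (fun x => A.R x i j) 2 (volume.restrict I)
  T_mem : ∀ i j, MemLp (fun x => A.T x i j) ∞ (volume.restrict I)

section

variable {ι κ : Type} [Fintype ι] [DecidableEq ι] [Fintype κ] [DecidableEq κ]

/-- `𝔏_x = Q(x) ⊗ Id + L(x) ⊗ l_x + R(x) ⊗ r_x + T(x) ⊗ Ad_x`. -/
def generator (A : Tensors ι) (x : ℝ) (X : Form (Matrix ι ι ℂ)) : Form (Matrix ι ι ℂ) :=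
  fun g f => A.Q x * X g f + A.L x * lMap x X g f + A.R x * rMap x X g f + A.T x * adMap x X g f

/-- `Tr_D (B 𝔏_{x₁} ⋯ 𝔏_{x_n} [1_D ⊗ |Ω⟩⟨Ω|])`. -/
def dysonIntegrand (A : Tensors ι) {n : ℕ} (x : Fin n → ℝ) : Form ℂ :=
  fun g f => (A.B * (List.ofFn x).foldr (generator A) (vacuumProj ι) g f).trace

/-- `O = Tr_D (B 𝒫 exp ∫_I 𝔏_x dx) (|Ω⟩⟨Ω|)` as an operator on `expDomain I`: the path-ordered
exponential is its Dyson series, with the integrals over `x₁ < ⋯ < x_n` in `I`, and the series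
converges weakly against every vector of the Fock space. -/
def IsCMPOWith (I : Set ℝ) (A : Tensors ι) (O : expDomain I →ₗ[ℂ] expDomain I) : Prop :=
  A.Admissible I ∧ ∀ (g : Fock I) (f : expDomain I),
    (∀ n : ℕ, IntegrableOn (fun x : Fin n → ℝ => dysonIntegrand A x (wave g) (wave (f : Fock I)))
      {x | StrictMono x} (configMeasure I n)) ∧
    HasSum (fun n : ℕ => ∫ x : Fin n → ℝ in {x | StrictMono x},
      dysonIntegrand A x (wave g) (wave (f : Fock I)) ∂(configMeasure I n))
      ⟪g, (O f : Fock I)⟫_ℂ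

/-- `O` is a cMPO on `I` with bond dimension `D`. -/
def IsCMPO (I : Set ℝ) (D : ℕ) (O : expDomain I →ₗ[ℂ] expDomain I) : Prop :=
  ∃ A : Tensors (Fin D), IsCMPOWith I A O

/-- The tensors of the product. -/
def Tensors.prod (A₁ : Tensors ι) (A₂ : Tensors κ) : Tensors (ι × κ) where
  B := A₁.B ⊗ₖ A₂.B
  Q x := A₁.Q x ⊗ₖ 1 + 1 ⊗ₖ A₂.Q x + A₁.R x ⊗ₖ A₂.L x
  L x := A₁.L x ⊗ₖ 1 + A₁.T x ⊗ₖ A₂.L x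
  R x := 1 ⊗ₖ A₂.R x + A₁.R x ⊗ₖ A₂.T x
  T x := A₁.T x ⊗ₖ A₂.T x

end

end CMPO

end

open MeasureTheory
open scoped ENNReal ComplexConjugate Kronecker InnerProductSpace

set_option linter.unusedSectionVars false

noncomputable section

/-! Expand every generator in the Dyson series into its four terms. Each point of a finite
configuration in I then carries one of four kinds, recorded as two bits: whether the point creates a
particle (L, T) and whether it annihilates one (R, T). Integrating over the simplices x₁ < ⋯ < x_n
is the same as integrating symmetric functions against `poisson` = ∑ μ^n/n!, because coincident
points form a null set and the n! orderings have equal measure. A Fock vector f becomes a function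
`hat f` of configurations, √(n!) f_n on n points, and the Fock space inner product becomes the L²
pairing for `poisson`. The Dyson series is thus one integral over labelled configurations, ⟨g, O f⟩
= ∫ κ(ω) conj(ĝ(creating points)) f̂(annihilating points) dω, where κ(ω) is the trace of B times the
ordered product of the coefficients.

What makes such integrals computable is that `poisson` is an exponential: the measure of a disjoint
union of label sets is the product of the measures (`map_poisson_labelled`). Points can therefore be
separated by kind, and labels can be summed after the points are chosen
(`integral_poisson_colorSum`).

Existence and convergence: κ is bounded by a constant times a product over the points. In
`expMoments_absApply`, Cauchy–Schwarz over the non-creating points uses ∫|Q| and ∫|R|², separating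
the points again by annihilation uses ∫|Q| and ∫|L|², and T enters only through its supremum, which
changes the base of the exponential weight. Hence the kernel maps the exponential domain into itself
and the integral converges absolutely against every g in the Fock space. Matrix elements determine
the operator, which gives uniqueness.

Product: inserting the vector O₂f into the form of O₁ identifies the points annihilated by O₁ with
those created by O₂. A joint configuration has points of O₁ alone (Q₁, L₁), points of O₂ alone (Q₂,
R₂), and common points (R₁ or T₁ with L₂ or T₂). Fubini turns ⟨g, O₁O₂f⟩ into one integral over
these eight pair kinds (`kernelForm_comp`). Conversely, expanding the generator of the product
tensors yields exactly these eight terms, and coefficients on different tensor legs multiply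
independently (`foldr_generator_prod`). Both sides are therefore the same integral.

Since integrals only see tensors up to null sets, all of this is done for measurable representatives
with T bounded everywhere (`Tensors.Admissible.exists_regular`). -/

namespace CMPO

/-! ### Measurable structure on lists and multisets -/

section ListMeasurable

variable {X Y Z W : Type*} [MeasurableSpace X] [MeasurableSpace Y] [MeasurableSpace Z]
  [MeasurableSpace W]

/-- Lists carry the disjoint union of the product `σ`-algebras on tuples. -/
instance instMeasurableSpaceList : MeasurableSpace (List X) :=
  ⨅ n : ℕ, MeasurableSpace.map (fun x : Fin n → X => List.ofFn x) inferInstance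

/-- Multisets carry the quotient `σ`-algebra: its elements are the permutation-invariant
measurable sets of lists. -/
instance instMeasurableSpaceMultiset : MeasurableSpace (Multiset X) :=
  MeasurableSpace.map (fun l : List X => (l : Multiset X)) inferInstance

theorem measurableSet_list {S : Set (List X)} :
    MeasurableSet S ↔ ∀ n : ℕ, MeasurableSet {x : Fin n → X | List.ofFn x ∈ S} := by
  change MeasurableSet[⨅ n : ℕ, MeasurableSpace.map (fun x : Fin n → X => List.ofFn x) _] S ↔ _
  rw [MeasurableSpace.measurableSet_iInf]
  rfl

theorem measurable_list_iff {f : List X → Z} :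
    Measurable f ↔ ∀ n : ℕ, Measurable fun x : Fin n → X => f (List.ofFn x) := by
  constructor
  · intro h n S hS
    exact measurableSet_list.1 (h hS) n
  · intro h S hS
    exact measurableSet_list.2 fun n => h n hS

theorem measurable_ofFn (n : ℕ) : Measurable fun x : Fin n → X => List.ofFn x :=
  measurable_list_iff.1 measurable_id n

theorem measurable_coe_multiset : Measurable fun l : List X => (l : Multiset X) :=
  fun _ hS => hS

theorem measurable_multiset_iff {f : Multiset X → Z} :
    Measurable f ↔ Measurable fun l : List X => f l :=
  Iff.rfl

/-- Tuples of length n form one component of the disjoint union, so the image of a measurable set is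
that set in length n and empty in every other length. -/
theorem measurableEmbedding_ofFn (n : ℕ) :
    MeasurableEmbedding fun x : Fin n → X => List.ofFn x where
  injective := List.ofFn_injective
  measurable := measurable_ofFn n
  measurableSet_image' := by
    intro S hS
    refine measurableSet_list.2 fun m => ?_
    by_cases h : m = n
    · subst h
      convert hS using 1
      ext x
      simp [List.ofFn_injective.eq_iff]
    · convert MeasurableSet.empty using 1
      ext x
      simp only [Set.mem_ofPred_eq, Set.mem_image, Set.mem_empty_iff_false, iff_false, not_exists,
        not_and]
      intro y _ hy
      have := congrArg List.length hy
      simp at this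
      exact h this.symm

/-- A product with Y distributes over the disjoint union of the tuple spaces: there are countably
many components, and each is measurably embedded. -/
theorem measurable_prod_list_iff {f : Y × List X → Z} :
    Measurable f ↔ ∀ n : ℕ, Measurable fun p : Y × (Fin n → X) => f (p.1, List.ofFn p.2) := by
  constructor
  · intro h n
    exact h.comp (measurable_fst.prodMk ((measurable_ofFn n).comp measurable_snd))
  · intro h S hS
    have e : f ⁻¹' S = ⋃ n : ℕ, Prod.map id (fun x : Fin n → X => List.ofFn x) ''
        {p | f (p.1, List.ofFn p.2) ∈ S} := by
      ext ⟨y, l⟩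
      simp only [Set.mem_preimage, Set.mem_iUnion, Set.mem_image, Set.mem_ofPred_eq, Prod.exists,
        Prod.map_apply, id_eq, Prod.mk.injEq]
      constructor
      · intro hl
        exact ⟨l.length, y, l.get, by simpa using hl, rfl, by simp⟩
      · rintro ⟨n, y', x, hx, rfl, rfl⟩
        exact hx
    rw [e]
    exact MeasurableSet.iUnion fun n =>
      (MeasurableEmbedding.id.prodMap (measurableEmbedding_ofFn n)).measurableSet_image'
        (h n hS)

theorem measurable_list_cons : Measurable fun p : X × List X => p.1 :: p.2 := by
  refine measurable_prod_list_iff.2 fun n => ?_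
  have : (fun p : X × (Fin n → X) => p.1 :: List.ofFn p.2) =
      fun p => List.ofFn (Fin.cons p.1 p.2 : Fin (n + 1) → X) := by
    funext p
    simp [List.ofFn_succ]
  rw [this]
  refine (measurable_ofFn (n + 1)).comp (measurable_pi_iff.2 fun i => ?_)
  refine Fin.cases ?_ (fun j => ?_) i
  · simpa using measurable_fst
  · simp only [Fin.cons_succ]; fun_prop

theorem measurable_cons {f : Y → X} {g : Y → List X} (hf : Measurable f)
    (hg : Measurable g) : Measurable fun y => f y :: g y :=
  measurable_list_cons.comp (hf.prodMk hg)

/-- Measurability of a function of a parameter and a list, by recursion on the list. -/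
theorem measurable_prod_list_of_step {f : Y × List X → Z} (h0 : Measurable fun y => f (y, []))
    (s : Y × X × List X × Z → Z) (hs : Measurable s)
    (h1 : ∀ y x l, f (y, x :: l) = s (y, x, l, f (y, l))) : Measurable f := by
  refine measurable_prod_list_iff.2 fun n => ?_
  induction n with
  | zero => simp only [List.ofFn_zero]; exact h0.comp measurable_fst
  | succ n ih =>
    have ht : Measurable fun p : Y × (Fin (n + 1) → X) =>
        (p.1, fun i : Fin n => p.2 i.succ) := by fun_prop
    have e : (fun p : Y × (Fin (n + 1) → X) => f (p.1, List.ofFn p.2)) =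
        fun p => s (p.1, p.2 0, List.ofFn (fun i : Fin n => p.2 i.succ),
          f (p.1, List.ofFn fun i : Fin n => p.2 i.succ)) := by
      funext p
      rw [List.ofFn_succ, h1]
    rw [e]
    refine hs.comp (measurable_fst.prodMk (Measurable.prodMk ?_ (Measurable.prodMk ?_ ?_)))
    · fun_prop
    · exact (measurable_ofFn n).comp (measurable_snd.comp ht)
    · exact ih.comp ht

theorem measurable_list_of_step {f : List X → Z} (s : X × List X × Z → Z) (hs : Measurable s)
    (h1 : ∀ x l, f (x :: l) = s (x, l, f l)) : Measurable f := by
  have := measurable_prod_list_of_step (Y := Unit) (f := fun p => f p.2)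
    (measurable_const (a := f []))
    (fun p => s p.2) (hs.comp measurable_snd) (fun _ x l => h1 x l)
  exact this.comp (measurable_const.prodMk measurable_id : Measurable fun l : List X => ((), l))

theorem measurable_list_map {f : X → Y} (hf : Measurable f) : Measurable (List.map f) :=
  measurable_list_of_step (fun p => f p.1 :: p.2.2)
    (measurable_cons (hf.comp measurable_fst) (measurable_snd.comp measurable_snd)) fun _ _ => rfl

theorem measurable_list_filter {p : X → Prop} [DecidablePred p] (hp : MeasurableSet {x | p x}) :
    Measurable fun l : List X => l.filter (fun x => decide (p x)) := by
  refine measurable_list_of_step (fun q => if p q.1 then q.1 :: q.2.2 else q.2.2) ?_ ?_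
  · exact Measurable.ite (measurable_fst hp)
      (measurable_cons measurable_fst (measurable_snd.comp measurable_snd))
      (measurable_snd.comp measurable_snd)
  · intro x l
    by_cases h : p x <;> simp [h]

theorem measurable_list_length : Measurable (List.length : List X → ℕ) :=
  measurable_list_of_step (fun q => q.2.2 + 1) (by fun_prop) fun _ _ => rfl

theorem measurable_list_append : Measurable fun p : List X × List X => p.1 ++ p.2 := by
  have h : Measurable fun p : List X × List X => p.2 ++ p.1 :=
    measurable_prod_list_of_step (f := fun p : List X × List X => p.2 ++ p.1) measurable_id
      (fun q => q.2.1 :: q.2.2.2)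
      (measurable_cons (by fun_prop) (by fun_prop)) fun _ _ _ => rfl
  exact h.comp measurable_swap

theorem measurable_multiset_add :
    Measurable fun p : List X × List X => (p.1 : Multiset X) + (p.2 : Multiset X) := by
  simp only [Multiset.coe_add]
  exact measurable_coe_multiset.comp measurable_list_append

theorem measurable_multiset_map {f : X → Y} (hf : Measurable f) :
    Measurable (Multiset.map f) :=
  measurable_multiset_iff.2 (measurable_coe_multiset.comp (measurable_list_map hf))

theorem measurable_multiset_filter {p : X → Prop} [DecidablePred p]
    (hp : MeasurableSet {x | p x}) : Measurable (Multiset.filter p) :=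
  measurable_multiset_iff.2 (measurable_coe_multiset.comp (measurable_list_filter hp))

theorem measurable_multiset_card : Measurable (Multiset.card : Multiset X → ℕ) :=
  measurable_multiset_iff.2 measurable_list_length

theorem measurable_multiset_prod_map {M : Type*} [CommMonoid M] [MeasurableSpace M]
    [MeasurableMul₂ M] {f : X → M} (hf : Measurable f) :
    Measurable fun m : Multiset X => (m.map f).prod := by
  refine measurable_multiset_iff.2 (measurable_list_of_step (fun q => f q.1 * q.2.2) ?_ ?_)
  · exact (hf.comp measurable_fst).mul (measurable_snd.comp measurable_snd)
  · intro x l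
    simp

theorem measurable_orderedInsert {r : X → X → Prop} [DecidableRel r]
    (hr : MeasurableSet {p : X × X | r p.1 p.2}) :
    Measurable fun p : X × List X => List.orderedInsert r p.1 p.2 := by
  refine measurable_prod_list_of_step (measurable_cons measurable_id measurable_const)
    (fun q => if r q.1 q.2.1 then q.1 :: q.2.1 :: q.2.2.1 else q.2.1 :: q.2.2.2) ?_ ?_
  · refine Measurable.ite ?_ ?_ ?_
    · exact (measurable_fst.prodMk (measurable_fst.comp measurable_snd) :
        Measurable fun q : X × X × List X × List X => (q.1, q.2.1)) hr
    · exact measurable_cons (by fun_prop) (measurable_cons (by fun_prop) (by fun_prop))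
    · exact measurable_cons (by fun_prop) (by fun_prop)
  · intro y x l
    simp [List.orderedInsert]

/-- Sorting is a measurable section of the quotient from lists to multisets, so a function of
ordered lists yields a measurable symmetric function. Insertion sort replaces merge sort because it
recurses one element at a time. -/
theorem measurable_multiset_sort {r : X → X → Prop} [DecidableRel r] [IsTrans X r]
    [Std.Antisymm r] [Std.Total r] (hr : MeasurableSet {p : X × X | r p.1 p.2}) :
    Measurable fun m : Multiset X => m.sort r := by
  refine measurable_multiset_iff.2 ?_
  simp only [Multiset.coe_sort, List.mergeSort_eq_insertionSort]
  exact measurable_list_of_step (fun q => List.orderedInsert r q.1 q.2.2)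
    ((measurable_orderedInsert hr).comp (measurable_fst.prodMk (measurable_snd.comp measurable_snd)))
    fun _ _ => rfl

end ListMeasurable

/-! ### The exponential of a measure, on finite configurations -/

section Poisson

variable {X Y : Type*} [MeasurableSpace X] [MeasurableSpace Y]

/-- The product measure `μ^n`, on lists of length `n`. -/
def tupleMeasure (μ : Measure X) : ℕ → Measure (List X)
  | 0 => Measure.dirac []
  | n + 1 => (μ.prod (tupleMeasure μ n)).map fun p => p.1 :: p.2

/-- The measure `∑ μ^n / n!` on lists. -/
def poisson (μ : Measure X) : Measure (List X) :=
  Measure.sum fun n : ℕ => ((n.factorial : ℝ≥0∞)⁻¹) • tupleMeasure μ n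

instance instSFiniteTupleMeasure (μ : Measure X) [SFinite μ] (n : ℕ) : SFinite (tupleMeasure μ n) := by
  induction n <;> unfold tupleMeasure <;> infer_instance

instance instSFinitePoisson (μ : Measure X) [SFinite μ] : SFinite (poisson μ) := by
  unfold poisson
  infer_instance

theorem lintegral_tupleMeasure_zero (μ : Measure X) {F : List X → ℝ≥0∞} (hF : Measurable F) :
    ∫⁻ l, F l ∂tupleMeasure μ 0 = F [] :=
  lintegral_dirac' _ hF

theorem lintegral_tupleMeasure_succ (μ : Measure X) [SFinite μ] (n : ℕ) {F : List X → ℝ≥0∞}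
    (hF : Measurable F) :
    ∫⁻ l, F l ∂tupleMeasure μ (n + 1) = ∫⁻ x, ∫⁻ l, F (x :: l) ∂tupleMeasure μ n ∂μ := by
  rw [tupleMeasure, lintegral_map hF measurable_list_cons]
  exact lintegral_prod _ (hF.fun_comp measurable_list_cons).aemeasurable

theorem lintegral_poisson (μ : Measure X) (F : List X → ℝ≥0∞) :
    ∫⁻ l, F l ∂poisson μ = ∑' n : ℕ, (n.factorial : ℝ≥0∞)⁻¹ * ∫⁻ l, F l ∂tupleMeasure μ n := by
  simp [poisson, lintegral_sum_measure]

/-- The binomial theorem for product measures. The first point comes from μ or from ν, and Pascal's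
rule recombines the two cases. Symmetry of F is needed to move that point past the others. -/
theorem lintegral_tupleMeasure_add (μ ν : Measure X) [SFinite μ] [SFinite ν] (n : ℕ)
    {F : Multiset X → ℝ≥0∞} (hF : Measurable F) :
    ∫⁻ l, F l ∂tupleMeasure (μ + ν) n = ∑ ij ∈ Finset.HasAntidiagonal.antidiagonal n, (n.choose ij.1 : ℝ≥0∞) *
      ∫⁻ α, ∫⁻ β, F ((α : Multiset X) + (β : Multiset X)) ∂tupleMeasure ν ij.2
        ∂tupleMeasure μ ij.1 := by
  induction n generalizing F with
  | zero =>
    have h1 : Measurable fun p : List X × List X => F (p.1 + p.2) :=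
      hF.fun_comp measurable_multiset_add
    simp only [Finset.HasAntidiagonal.antidiagonal_zero, Finset.sum_singleton, Nat.choose_self, Nat.cast_one,
      one_mul]
    rw [lintegral_tupleMeasure_zero _ (hF.fun_comp measurable_coe_multiset),
      lintegral_tupleMeasure_zero _ h1.lintegral_prod_right',
      lintegral_tupleMeasure_zero _ (h1.fun_comp measurable_prodMk_left)]
    simp
  | succ n ih =>
    have h2 : Measurable fun p : X × List X × List X =>
        F (p.1 ::ₘ ((p.2.1 : Multiset X) + (p.2.2 : Multiset X))) := by
      have : Measurable fun p : X × List X × List X => p.1 :: (p.2.1 ++ p.2.2) :=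
        measurable_cons measurable_fst (measurable_list_append.fun_comp measurable_snd)
      exact hF.fun_comp (measurable_coe_multiset.comp this)
    have h3 : Measurable fun p : X × List X => F (p.1 ::ₘ (p.2 : Multiset X)) := by
      exact hF.fun_comp (measurable_coe_multiset.fun_comp measurable_list_cons)
    have h4 : ∀ x, Measurable fun m : Multiset X => F (x ::ₘ m) := fun x =>
      measurable_multiset_iff.2 (h3.fun_comp measurable_prodMk_left)
    have h5 : Measurable fun p : List X × List X => F (p.1 + p.2) :=
      hF.fun_comp measurable_multiset_add
    have h6 : ∀ i j, Measurable fun x => ∫⁻ α, ∫⁻ β, F (x ::ₘ ((α : Multiset X) + (β : Multiset X)))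
        ∂tupleMeasure ν j ∂tupleMeasure μ i := by
      intro i j
      have a : Measurable fun p : X × List X => ∫⁻ β, F (p.1 ::ₘ ((p.2 : Multiset X) +
          (β : Multiset X))) ∂tupleMeasure ν j :=
        (h2.comp (MeasurableEquiv.prodAssoc.measurable)).lintegral_prod_right'
      exact a.lintegral_prod_right'
    rw [lintegral_tupleMeasure_succ _ _ (hF.fun_comp measurable_coe_multiset)]
    simp only [← Multiset.cons_coe]
    simp only [ih (h4 _), lintegral_add_measure]
    simp_rw [lintegral_finsetSum _ fun i _ => (h6 _ _).const_mul _,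
      lintegral_const_mul _ (h6 _ _)]
    rw [Finset.sum_antidiagonal_choose_succ_mul (fun i j =>
      ∫⁻ α, ∫⁻ β, F ((α : Multiset X) + (β : Multiset X)) ∂tupleMeasure ν j ∂tupleMeasure μ i) n,
      add_comm]
    congr 1
    · refine Finset.sum_congr rfl fun ij _ => ?_
      congr 1
      have b : Measurable fun p : X × List X => ∫⁻ β, F (p.1 ::ₘ ((p.2 : Multiset X) +
          (β : Multiset X))) ∂tupleMeasure ν ij.2 :=
        (h2.comp (MeasurableEquiv.prodAssoc.measurable)).lintegral_prod_right'
      rw [lintegral_lintegral_swap b.aemeasurable]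
      refine lintegral_congr fun α => ?_
      rw [lintegral_tupleMeasure_succ _ _ (h5.fun_comp measurable_prodMk_left)]
      simp only [← Multiset.cons_coe, Multiset.add_cons]
    · refine Finset.sum_congr rfl fun ij hij => ?_
      rw [lintegral_tupleMeasure_succ _ _ h5.lintegral_prod_right']
      simp only [← Multiset.cons_coe, Multiset.cons_add]
      rw [Nat.choose_symm_of_eq_add (Finset.HasAntidiagonal.mem_antidiagonal.1 hij).symm]

theorem choose_mul_inv_factorial {n i j : ℕ} (h : i + j = n) :
    (n.factorial : ℝ≥0∞)⁻¹ * n.choose i = (i.factorial : ℝ≥0∞)⁻¹ * (j.factorial : ℝ≥0∞)⁻¹ := by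
  have h1 : (n.choose i : ℝ≥0∞) * i.factorial * j.factorial = n.factorial := by
    subst h
    rw [Nat.choose_symm_add]
    exact_mod_cast Nat.add_choose_mul_factorial_mul_factorial i j
  have z : ∀ k : ℕ, (k.factorial : ℝ≥0∞) ≠ 0 := fun k => by
    exact_mod_cast Nat.factorial_ne_zero k
  have t : ∀ k : ℕ, (k.factorial : ℝ≥0∞) ≠ ∞ := fun k => ENNReal.natCast_ne_top _
  calc (n.factorial : ℝ≥0∞)⁻¹ * n.choose i
      = (n.factorial : ℝ≥0∞)⁻¹ * n.choose i * (i.factorial * (i.factorial : ℝ≥0∞)⁻¹) *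
        (j.factorial * (j.factorial : ℝ≥0∞)⁻¹) := by
        rw [ENNReal.mul_inv_cancel (z i) (t i), ENNReal.mul_inv_cancel (z j) (t j)]; simp
    _ = (n.factorial : ℝ≥0∞)⁻¹ * (n.choose i * i.factorial * j.factorial) *
        ((i.factorial : ℝ≥0∞)⁻¹ * (j.factorial : ℝ≥0∞)⁻¹) := by ring
    _ = _ := by rw [h1, ENNReal.inv_mul_cancel (z n) (t n), one_mul]

/-- exp(μ + ν) = exp(μ) exp(ν): by the binomial theorem the factor 1/n! splits into 1/i! and 1/j!,
and the sums over antidiagonals become a sum over all pairs. -/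
theorem lintegral_poisson_add (μ ν : Measure X) [SFinite μ] [SFinite ν]
    {F : Multiset X → ℝ≥0∞} (hF : Measurable F) :
    ∫⁻ l, F l ∂poisson (μ + ν) =
      ∫⁻ α, ∫⁻ β, F ((α : Multiset X) + (β : Multiset X)) ∂poisson ν ∂poisson μ := by
  have h5 : Measurable fun p : List X × List X => F (p.1 + p.2) :=
    hF.fun_comp measurable_multiset_add
  have h6 : ∀ j, Measurable fun α : List X => ∫⁻ β, F ((α : Multiset X) + (β : Multiset X))
      ∂tupleMeasure ν j := fun j => h5.lintegral_prod_right'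
  simp only [lintegral_poisson, lintegral_tupleMeasure_add μ ν _ hF]
  simp_rw [lintegral_tsum fun j => ((h6 j).const_mul _).aemeasurable, lintegral_const_mul _ (h6 _),
    ← ENNReal.tsum_mul_left]
  rw [← ENNReal.tsum_prod, ← Finset.HasAntidiagonal.sigmaAntidiagonalEquivProd.tsum_eq, ENNReal.tsum_sigma']
  refine tsum_congr fun n => ?_
  rw [tsum_fintype, Finset.mul_sum, ← Finset.sum_coe_sort]
  refine Finset.sum_congr rfl fun ij _ => ?_
  rw [← mul_assoc, ← mul_assoc,
    choose_mul_inv_factorial (Finset.HasAntidiagonal.mem_antidiagonal.1 ij.2)]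
  rfl

theorem tupleMeasure_map (μ : Measure X) [SFinite μ] {f : X → Y} (hf : Measurable f) (n : ℕ) :
    tupleMeasure (μ.map f) n = (tupleMeasure μ n).map (List.map f) := by
  induction n with
  | zero => simp [tupleMeasure, Measure.map_dirac' (measurable_list_map hf)]
  | succ n ih =>
    rw [tupleMeasure, ih, Measure.map_prod_map _ _ hf (measurable_list_map hf), tupleMeasure,
      Measure.map_map measurable_list_cons (hf.prodMap (measurable_list_map hf)),
      Measure.map_map (measurable_list_map hf) measurable_list_cons]
    rfl

theorem poisson_map (μ : Measure X) [SFinite μ] {f : X → Y} (hf : Measurable f) :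
    poisson (μ.map f) = (poisson μ).map (List.map f) := by
  simp only [poisson, tupleMeasure_map μ hf, Measure.map_sum (measurable_list_map hf).aemeasurable,
    Measure.map_smul]

/-- The integral of a multiplicative function. -/
theorem lintegral_tupleMeasure_prod (μ : Measure X) [SFinite μ] (n : ℕ) {q : X → ℝ≥0∞} (hq : Measurable q) :
    ∫⁻ l, (l.map q).prod ∂tupleMeasure μ n = (∫⁻ x, q x ∂μ) ^ n := by
  have h : Measurable fun l : List X => (l.map q).prod := by
    simpa using measurable_multiset_iff.1 (measurable_multiset_prod_map hq)
  induction n with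
  | zero => rw [lintegral_tupleMeasure_zero _ h]; simp
  | succ n ih =>
    rw [lintegral_tupleMeasure_succ _ _ h]
    simp_rw [List.map_cons, List.prod_cons, lintegral_const_mul _ h, ih]
    rw [lintegral_mul_const _ hq, pow_succ']

theorem tsum_pow_div_factorial_lt_top {a : ℝ≥0∞} (ha : a ≠ ∞) :
    ∑' n : ℕ, (n.factorial : ℝ≥0∞)⁻¹ * a ^ n < ∞ := by
  lift a to NNReal using ha
  have h : Summable fun n : ℕ => (n.factorial : NNReal)⁻¹ * a ^ n := by
    rw [← NNReal.summable_coe]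
    refine (Real.summable_pow_div_factorial a).congr fun n => ?_
    push_cast
    rw [div_eq_inv_mul]
  have e : ∀ n : ℕ, (n.factorial : ℝ≥0∞)⁻¹ * (a : ℝ≥0∞) ^ n =
      (((n.factorial : NNReal)⁻¹ * a ^ n : NNReal) : ℝ≥0∞) := fun n => by
    rw [ENNReal.coe_mul, ENNReal.coe_inv (by exact_mod_cast Nat.factorial_ne_zero n)]
    simp
  simp_rw [e]
  exact (ENNReal.tsum_coe_ne_top_iff_summable.2 h).lt_top

/-- On n points the integral is (∫ q)^n / n!, so the total is the exponential of ∫ q. -/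
theorem lintegral_poisson_prod_lt_top (μ : Measure X) [SFinite μ] {q : X → ℝ≥0∞} (hq : Measurable q)
    (h : ∫⁻ x, q x ∂μ ≠ ∞) :
    ∫⁻ l : List X, ((l : Multiset X).map q).prod ∂poisson μ < ∞ := by
  simp only [Multiset.map_coe, Multiset.prod_coe, lintegral_poisson,
    lintegral_tupleMeasure_prod μ _ hq]
  exact tsum_pow_div_factorial_lt_top h

end Poisson

/-! ### Superposition: independent configurations for disjoint sets of labels -/

section Superposition

variable {X : Type*} [MeasurableSpace X]

/-- The points of `X` with a label in `C`. -/
abbrev labelled (μ : Measure X) (C : Type*) [MeasurableSpace C] : Measure (X × C) :=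
  μ.prod Measure.count

/-- Change of the labels. -/
abbrev relabel {A B : Type*} (i : B → A) : X × B → X × A := Prod.map id i

theorem measurable_relabel {A B : Type*} [Finite B] [MeasurableSpace A] [MeasurableSpace B]
    [MeasurableSingletonClass B] (i : B → A) : Measurable (relabel (X := X) i) :=
  measurable_id.prodMap (measurable_of_finite i)

variable {A B C : Type*} [Fintype A] [Fintype B] [Fintype C] [MeasurableSpace A]
  [MeasurableSpace B] [MeasurableSpace C] [MeasurableSingletonClass A]
  [MeasurableSingletonClass B] [MeasurableSingletonClass C]

theorem lintegral_labelled (μ : Measure X) [SFinite μ] {F : X × C → ℝ≥0∞} (hF : Measurable F) :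
    ∫⁻ p, F p ∂labelled μ C = ∫⁻ x, ∑ c, F (x, c) ∂μ := by
  rw [lintegral_prod _ hF.aemeasurable]
  simp [lintegral_count, tsum_fintype]

theorem labelled_eq_add (μ : Measure X) [SFinite μ] (e : B ⊕ C ≃ A) :
    labelled μ A = (labelled μ B).map (relabel fun b => e (Sum.inl b)) +
      (labelled μ C).map (relabel fun c => e (Sum.inr c)) := by
  refine Measure.ext_of_lintegral _ fun F hF => ?_
  have hB := measurable_relabel (X := X) fun b : B => e (Sum.inl b)
  have hC := measurable_relabel (X := X) fun c : C => e (Sum.inr c)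
  rw [lintegral_add_measure, lintegral_map hF hB, lintegral_map hF hC, lintegral_labelled μ hF,
    lintegral_labelled μ (F := fun p => F (relabel _ p)) (hF.fun_comp hB),
    lintegral_labelled μ (F := fun p => F (relabel _ p)) (hF.fun_comp hC),
    ← lintegral_add_left
      (Finset.measurable_fun_sum _ fun b _ => (hF.fun_comp hB).fun_comp measurable_prodMk_right)]
  refine lintegral_congr fun x => ?_
  rw [← e.sum_comp, Fintype.sum_sum_type]
  rfl

/-- The union of two labelled configurations. -/
def labelledUnion (e : B ⊕ C ≃ A) (β : Multiset (X × B)) (γ : Multiset (X × C)) :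
    Multiset (X × A) :=
  β.map (relabel fun b => e (Sum.inl b)) + γ.map (relabel fun c => e (Sum.inr c))

theorem measurable_labelledUnion (e : B ⊕ C ≃ A) :
    Measurable fun p : List (X × B) × List (X × C) =>
      labelledUnion e (p.1 : Multiset (X × B)) (p.2 : Multiset (X × C)) := by
  have h := (measurable_list_map (measurable_relabel (X := X) fun b : B => e (Sum.inl b))).prodMap
    (measurable_list_map (measurable_relabel (X := X) fun c : C => e (Sum.inr c)))
  exact measurable_multiset_add.comp h

/-- The labelled measure is a sum over the two label sets, and the exponential turns the sum into a
product. The identity holds only after passing to multisets, since a list also records how the two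
families interleave. -/
theorem map_poisson_labelled (μ : Measure X) [SFinite μ] (e : B ⊕ C ≃ A) :
    (poisson (labelled μ A)).map (fun l : List (X × A) => (l : Multiset (X × A))) =
      ((poisson (labelled μ B)).prod (poisson (labelled μ C))).map
        fun p => labelledUnion e p.1 p.2 := by
  refine Measure.ext_of_lintegral _ fun F hF => ?_
  have hB := measurable_relabel (X := X) fun b : B => e (Sum.inl b)
  have hC := measurable_relabel (X := X) fun c : C => e (Sum.inr c)
  have h5 : Measurable fun p : List (X × A) × List (X × A) => F (p.1 + p.2) :=
    hF.fun_comp measurable_multiset_add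
  rw [lintegral_map hF measurable_coe_multiset, lintegral_map hF (measurable_labelledUnion e),
    lintegral_prod _ (hF.fun_comp (measurable_labelledUnion e)).aemeasurable,
    labelled_eq_add μ e, lintegral_poisson_add _ _ hF, poisson_map _ hB, poisson_map _ hC,
    lintegral_map h5.lintegral_prod_right' (measurable_list_map hB)]
  refine lintegral_congr fun α => ?_
  rw [lintegral_map (h5.fun_comp measurable_prodMk_left) (measurable_list_map hC)]
  rfl

theorem lintegral_poisson_labelled (μ : Measure X) [SFinite μ] (e : B ⊕ C ≃ A)
    {F : Multiset (X × A) → ℝ≥0∞} (hF : Measurable F) :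
    ∫⁻ l, F l ∂poisson (labelled μ A) = ∫⁻ β, ∫⁻ γ, F (labelledUnion e β γ)
      ∂poisson (labelled μ C) ∂poisson (labelled μ B) := by
  rw [← lintegral_map hF measurable_coe_multiset, map_poisson_labelled μ e,
    lintegral_map hF (measurable_labelledUnion e),
    lintegral_prod _ (hF.fun_comp (measurable_labelledUnion e)).aemeasurable]

theorem integrable_poisson_labelled_iff (μ : Measure X) [SFinite μ] (e : B ⊕ C ≃ A)
    {F : Multiset (X × A) → ℂ} (hF : Measurable F) :
    Integrable (fun l : List (X × A) => F l) (poisson (labelled μ A)) ↔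
      Integrable (fun p => F (labelledUnion e p.1 p.2))
        ((poisson (labelled μ B)).prod (poisson (labelled μ C))) := by
  have h1 := integrable_map_measure (μ := poisson (labelled μ A)) (g := F)
    hF.aestronglyMeasurable measurable_coe_multiset.aemeasurable
  have h2 := integrable_map_measure
    (μ := (poisson (labelled μ B)).prod (poisson (labelled μ C))) (g := F)
    hF.aestronglyMeasurable (measurable_labelledUnion e).aemeasurable
  rw [map_poisson_labelled μ e] at h1
  exact h1.symm.trans h2

theorem integral_poisson_labelled (μ : Measure X) [SFinite μ] (e : B ⊕ C ≃ A)
    {F : Multiset (X × A) → ℂ} (hF : Measurable F) :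
    ∫ l : List (X × A), F l ∂poisson (labelled μ A) = ∫ p, F (labelledUnion e p.1 p.2)
      ∂(poisson (labelled μ B)).prod (poisson (labelled μ C)) := by
  rw [← integral_map (φ := fun l : List (X × A) => (l : Multiset (X × A)))
      measurable_coe_multiset.aemeasurable hF.aestronglyMeasurable,
    map_poisson_labelled μ e, integral_map (measurable_labelledUnion e).aemeasurable
      hF.aestronglyMeasurable]

end Superposition

/-! ### Sums over the labellings of a configuration -/

section ColorSum

variable {X Y C : Type*} [Fintype C] {M N : Type*} [AddCommMonoid M] [AddCommMonoid N]

/-- The sum of `F` over all ways to attach labels in `C` to the points of a list. -/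
def colorSum (F : List (X × C) → M) : List X → M
  | [] => F []
  | x :: l => ∑ c, colorSum (fun t => F ((x, c) :: t)) l

theorem colorSum_congr {F G : List (X × C) → M} {l : List X}
    (h : ∀ t : List (X × C), t.map Prod.fst = l → F t = G t) : colorSum F l = colorSum G l := by
  induction l generalizing F G with
  | nil => exact h [] rfl
  | cons x l ih =>
    exact Finset.sum_congr rfl fun c _ => ih fun t ht => h _ (by simp [ht])

theorem map_colorSum (φ : M →+ N) (F : List (X × C) → M) (l : List X) :
    φ (colorSum F l) = colorSum (fun t => φ (F t)) l := by
  induction l generalizing F with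
  | nil => rfl
  | cons x l ih => simp only [colorSum, map_sum, ih]

theorem colorSum_map (f : X → Y) (F : List (Y × C) → M) (l : List X) :
    colorSum F (l.map f) = colorSum (fun t => F (t.map (Prod.map f id))) l := by
  induction l generalizing F with
  | nil => rfl
  | cons x l ih =>
    simp only [List.map_cons, colorSum, ih]
    rfl

/-- A transposition of neighbouring points exchanges the two sums over their labels; a function of
multisets does not notice the exchange inside its argument. -/
theorem colorSum_perm (F : Multiset (X × C) → M) {l l' : List X} (h : l.Perm l') :
    colorSum (fun t : List (X × C) => F t) l = colorSum (fun t : List (X × C) => F t) l' := by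
  induction h generalizing F with
  | nil => rfl
  | cons x h ih =>
    exact Finset.sum_congr rfl fun c _ => ih fun m => F ((x, c) ::ₘ m)
  | swap x y l =>
    simp only [colorSum]
    rw [Finset.sum_comm]
    refine Finset.sum_congr rfl fun c _ => Finset.sum_congr rfl fun d _ => ?_
    congr 1
    funext t
    simp only [← Multiset.cons_coe]
    rw [Multiset.cons_swap]
  | trans _ _ ih₁ ih₂ => rw [ih₁, ih₂]

/-- The sum over labellings, for multisets. -/
def multisetColorSum (F : Multiset (X × C) → M) (m : Multiset X) : M :=
  Quotient.liftOn m (fun l => colorSum (fun t : List (X × C) => F t) l) fun _ _ h => colorSum_perm F h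

@[simp]
theorem multisetColorSum_coe (F : Multiset (X × C) → M) (l : List X) :
    multisetColorSum F (l : Multiset X) = colorSum (fun t : List (X × C) => F t) l := rfl

theorem colorSum_const_mul {R : Type*} [NonUnitalNonAssocSemiring R] (a : R)
    (F : List (X × C) → R) (l : List X) :
    colorSum (fun t => a * F t) l = a * colorSum F l :=
  (map_colorSum (AddMonoidHom.mulLeft a) F l).symm

theorem colorSum_mono {F G : List (X × C) → ℝ≥0∞} (h : ∀ t, F t ≤ G t) (l : List X) :
    colorSum F l ≤ colorSum G l := by
  induction l generalizing F G with
  | nil => exact h []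
  | cons x l ih => exact Finset.sum_le_sum fun c _ => ih fun t => h _

theorem colorSum_one (l : List X) :
    colorSum (fun _ : List (X × C) => (1 : ℝ≥0∞)) l = (Fintype.card C : ℝ≥0∞) ^ l.length := by
  induction l with
  | nil => simp [colorSum]
  | cons x l ih =>
    simp only [colorSum]
    rw [ih]
    simp [pow_succ']

theorem norm_colorSum_le (F : List (X × C) → ℂ)
    (l : List X) : ‖colorSum F l‖ₑ ≤ colorSum (fun t => ‖F t‖ₑ) l := by
  induction l generalizing F with
  | nil => exact le_rfl
  | cons x l ih => 
    simp only [colorSum]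
    exact (enorm_sum_le _ _).trans (Finset.sum_le_sum fun c _ => ih fun t => F ((x, c) :: t))

end ColorSum

/-! ### Random labels: measurability and disintegration -/

section ColorKernel

universe u

variable {X Y : Type u} {C : Type*} [Fintype C] [MeasurableSpace X] [MeasurableSpace Y]
  [MeasurableSpace C] [MeasurableSingletonClass C]

theorem measurable_colorSum_prod {M : Type*} [AddCommMonoid M] [MeasurableSpace M]
    [MeasurableAdd₂ M] {F : Y × List (X × C) → M} (hF : Measurable F) :
    Measurable fun p : Y × List X => colorSum (fun t => F (p.1, t)) p.2 := by
  refine measurable_prod_list_iff.2 fun n => ?_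
  induction n generalizing Y with
  | zero =>
    simp only [List.ofFn_zero, colorSum]
    exact hF.comp (measurable_fst.prodMk measurable_const)
  | succ n ih =>
    simp only [List.ofFn_succ, colorSum]
    refine Finset.measurable_fun_sum _ fun c _ => ?_
    have h : Measurable fun p : (Y × X) × List (X × C) => F (p.1.1, (p.1.2, c) :: p.2) :=
      hF.fun_comp (Measurable.prodMk (by fun_prop) (measurable_cons (by fun_prop) (by fun_prop)))
    exact (ih h).fun_comp (f := fun p : Y × (Fin (n + 1) → X) => ((p.1, p.2 0), fun i : Fin n => p.2 i.succ)) (by fun_prop)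

theorem measurable_colorSum {M : Type*} [AddCommMonoid M] [MeasurableSpace M]
    [MeasurableAdd₂ M] {F : List (X × C) → M} (hF : Measurable F) :
    Measurable fun l : List X => colorSum F l :=
  (measurable_colorSum_prod (Y := PUnit) (F := fun p => F p.2) (hF.comp measurable_snd)).comp
    (measurable_const.prodMk measurable_id : Measurable fun l : List X => (PUnit.unit, l))

theorem measurable_multisetColorSum {M : Type*} [AddCommMonoid M] [MeasurableSpace M]
    [MeasurableAdd₂ M] {F : Multiset (X × C) → M} (hF : Measurable F) :
    Measurable (multisetColorSum F) :=
  measurable_colorSum (measurable_multiset_iff.1 hF)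

/-- The map `m` carries the points labelled so far, which the induction on the list has to keep; the
case of interest is the identity. -/
theorem lintegral_colorSum_dirac {F : List (X × C) → ℝ≥0∞} (hF : Measurable F)
    (m : List (X × C) → List (X × C)) (l : List X) :
    ∫⁻ t, F t ∂(colorSum (fun t => Measure.dirac (m t)) l : Measure (List (X × C))) =
      colorSum (fun t => F (m t)) l := by
  induction l generalizing m with
  | nil => exact lintegral_dirac' _ hF
  | cons x l ih =>
    simp only [colorSum]
    rw [lintegral_finsetSum_measure]
    exact Finset.sum_congr rfl fun c _ => ih _

/-- The labellings of a list, as a kernel. -/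
def colorKernel (X : Type u) (C : Type*) [Fintype C] [MeasurableSpace X] [MeasurableSpace C]
    [MeasurableSingletonClass C] : ProbabilityTheory.Kernel (List X) (List (X × C)) where
  toFun l := colorSum (fun t => Measure.dirac t) l
  measurable' := by
    refine Measure.measurable_of_measurable_coe _ fun S hS => ?_
    have h : Measurable (S.indicator fun _ : List (X × C) => (1 : ℝ≥0∞)) :=
      measurable_const.indicator hS
    have e : ∀ l : List X, (colorSum (fun t => Measure.dirac t) l : Measure (List (X × C))) S =
        colorSum (S.indicator fun _ => (1 : ℝ≥0∞)) l := fun l => by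
      have := lintegral_colorSum_dirac h id l
      simp only [id_eq, lintegral_indicator hS, lintegral_one,
        Measure.restrict_apply_univ] at this
      exact this
    simp_rw [e]
    exact measurable_colorSum h

theorem lintegral_colorKernel {F : List (X × C) → ℝ≥0∞} (hF : Measurable F) (l : List X) :
    ∫⁻ t, F t ∂colorKernel X C l = colorSum F l :=
  lintegral_colorSum_dirac hF id l

theorem integral_colorSum_dirac {F : List (X × C) → ℂ} (hF : Measurable F)
    (m : List (X × C) → List (X × C)) (l : List X) :
    Integrable F (colorSum (fun t => Measure.dirac (m t)) l : Measure (List (X × C))) ∧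
    ∫ t, F t ∂(colorSum (fun t => Measure.dirac (m t)) l : Measure (List (X × C))) =
      colorSum (fun t => F (m t)) l := by
  induction l generalizing m with
  | nil =>
    refine ⟨⟨hF.aestronglyMeasurable, ?_⟩, integral_dirac' _ _ hF.stronglyMeasurable⟩
    simp only [colorSum, hasFiniteIntegral_iff_enorm]
    rw [lintegral_dirac' _ hF.enorm]
    exact enorm_lt_top
  | cons x l ih =>
    simp only [colorSum]
    have h : ∀ c ∈ Finset.univ, Integrable F (colorSum
        (fun t => Measure.dirac (m ((x, c) :: t))) l : Measure (List (X × C))) :=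
      fun c _ => (ih fun t => m ((x, c) :: t)).1
    refine ⟨integrable_finsetSum_measure.2 h, ?_⟩
    rw [integral_finsetSum_measure h]
    exact Finset.sum_congr rfl fun c _ => (ih _).2

theorem integral_colorKernel {F : List (X × C) → ℂ} (hF : Measurable F) (l : List X) :
    ∫ t, F t ∂colorKernel X C l = colorSum F l :=
  (integral_colorSum_dirac hF id l).2

theorem lintegral_tupleMeasure_colorSum (μ : Measure X) [SFinite μ] (n : ℕ)
    {F : List (X × C) → ℝ≥0∞} (hF : Measurable F) :
    ∫⁻ t, F t ∂tupleMeasure (labelled μ C) n = ∫⁻ l, colorSum F l ∂tupleMeasure μ n := by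
  induction n generalizing F with
  | zero =>
    rw [lintegral_tupleMeasure_zero _ hF, lintegral_tupleMeasure_zero _ (measurable_colorSum hF)]
    rfl
  | succ n ih =>
    have h1 : Measurable fun p : (X × C) × List (X × C) => F (p.1 :: p.2) :=
      hF.fun_comp measurable_list_cons
    have h2 : ∀ c : C, Measurable fun p : X × List (X × C) => F ((p.1, c) :: p.2) := fun c =>
      hF.fun_comp (measurable_cons (by fun_prop) (by fun_prop))
    rw [lintegral_tupleMeasure_succ _ _ hF, lintegral_tupleMeasure_succ _ _ (measurable_colorSum hF),
      lintegral_labelled μ h1.lintegral_prod_right']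
    refine lintegral_congr fun x => ?_
    have h3 : ∀ c : C, Measurable fun t : List (X × C) => F ((x, c) :: t) := fun c =>
      h1.fun_comp measurable_prodMk_left
    simp only [colorSum]
    rw [lintegral_finsetSum _ fun c _ => measurable_colorSum (h3 c)]
    exact Finset.sum_congr rfl fun c _ => ih (h3 c)

theorem lintegral_poisson_colorSum (μ : Measure X) [SFinite μ]
    {F : List (X × C) → ℝ≥0∞} (hF : Measurable F) :
    ∫⁻ t, F t ∂poisson (labelled μ C) = ∫⁻ l, colorSum F l ∂poisson μ := by
  simp only [lintegral_poisson, lintegral_tupleMeasure_colorSum μ _ hF]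

/-- Choosing labelled points amounts to choosing the points first and the labels afterwards. In this
form the Bochner integral of a complex function disintegrates by `Kernel.integral_comp`. -/
theorem poisson_labelled_eq_bind (μ : Measure X) [SFinite μ] :
    poisson (labelled μ C) = (poisson μ).bind (colorKernel X C) := by
  refine Measure.ext_of_lintegral _ fun F hF => ?_
  rw [Measure.lintegral_bind (colorKernel X C).measurable.aemeasurable hF.aemeasurable,
    lintegral_poisson_colorSum μ hF]
  simp only [lintegral_colorKernel hF]

theorem integrable_poisson_colorSum (μ : Measure X) [SFinite μ] {F : List (X × C) → ℂ}
    (hF : Measurable F) (hi : Integrable F (poisson (labelled μ C))) :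
    Integrable (fun l => colorSum F l) (poisson μ) := by
  refine ⟨(measurable_colorSum hF).aestronglyMeasurable, ?_⟩
  rw [hasFiniteIntegral_iff_enorm]
  refine (lintegral_mono fun l => norm_colorSum_le F l).trans_lt ?_
  rw [← lintegral_poisson_colorSum μ hF.enorm]
  exact hasFiniteIntegral_iff_enorm.1 hi.2

theorem integral_poisson_colorSum (μ : Measure X) [SFinite μ] {F : List (X × C) → ℂ}
    (hF : Measurable F) (hi : Integrable F (poisson (labelled μ C))) :
    ∫ t, F t ∂poisson (labelled μ C) = ∫ l, colorSum F l ∂poisson μ := by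
  have h := ProbabilityTheory.Kernel.integral_comp (η := colorKernel X C)
    (κ := ProbabilityTheory.Kernel.const Unit (poisson μ)) (a := ()) (f := F)
  rw [ProbabilityTheory.Kernel.comp_apply, ProbabilityTheory.Kernel.const_apply,
    ← poisson_labelled_eq_bind] at h
  rw [h hi]
  simp only [integral_colorKernel hF]

end ColorKernel

/-! ### Ordered configurations of real numbers -/

section Simplex

theorem tupleMeasure_eq_map_pi {X : Type*} [MeasurableSpace X] (μ : Measure X) [SigmaFinite μ]
    (n : ℕ) :
    tupleMeasure μ n = (Measure.pi fun _ : Fin n => μ).map fun x => List.ofFn x := by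
  induction n with
  | zero =>
    rw [Measure.pi_of_empty (fun _ : Fin 0 => μ), Measure.map_dirac' (measurable_ofFn 0)]
    simp [tupleMeasure]
  | succ n ih =>
    have h := (measurePreserving_piFinSuccAbove (fun _ : Fin (n + 1) => μ) 0).symm
    refine Measure.ext_of_lintegral _ fun F hF => ?_
    have hG : Measurable fun p : X × (Fin n → X) => F (p.1 :: List.ofFn p.2) :=
      hF.fun_comp (measurable_cons measurable_fst ((measurable_ofFn n).comp measurable_snd))
    rw [lintegral_tupleMeasure_succ _ _ hF, ih, lintegral_map hF (measurable_ofFn _), ← h.map_eq,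
      lintegral_map (hF.fun_comp (measurable_ofFn _)) h.measurable]
    have hx : ∀ x, Measurable fun l : List X => F (x :: l) := fun x =>
      hF.fun_comp (measurable_cons measurable_const measurable_id)
    simp_rw [lintegral_map (hx _) (measurable_ofFn n)]
    rw [← lintegral_prod _ hG.aemeasurable]
    refine lintegral_congr fun p => ?_
    simp [MeasurableEquiv.piFinSuccAbove_symm_apply, List.ofFn_succ, Fin.insertNthEquiv]

theorem measurableSet_nodup : MeasurableSet {l : List ℝ | l.Nodup} := by
  refine measurableSet_list.2 fun n => ?_
  have : {x : Fin n → ℝ | List.ofFn x ∈ {l : List ℝ | l.Nodup}} =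
      ⋂ i : Fin n, ⋂ j : Fin n, {x | x i = x j → i = j} := by
    ext x
    simp [List.nodup_ofFn, Function.Injective]
  rw [this]
  refine MeasurableSet.iInter fun i => MeasurableSet.iInter fun j => ?_
  by_cases h : i = j
  · simp [h]
  · have : {x : Fin n → ℝ | x i = x j → i = j} = {x | x i = x j}ᶜ := by
      ext x
      simp [h]
    rw [this]
    exact (measurableSet_eq_fun (measurable_pi_apply i) (measurable_pi_apply j)).compl

/-- With the remaining points fixed, the new point must avoid a finite set, which is null. This is
why the order of integration is exchanged before the estimate. -/
theorem ae_nodup_tupleMeasure (μ : Measure ℝ) [SFinite μ] [NullSingletonClass μ] (n : ℕ) :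
    ∀ᵐ l ∂tupleMeasure μ n, l.Nodup := by
  induction n with
  | zero =>
    rw [tupleMeasure, ae_dirac_iff measurableSet_nodup]
    exact List.nodup_nil
  | succ n ih =>
    rw [tupleMeasure, ae_map_iff measurable_list_cons.aemeasurable measurableSet_nodup]
    have hm : MeasurableSet {p : ℝ × List ℝ | (p.1 :: p.2).Nodup} :=
      measurable_list_cons measurableSet_nodup
    rw [Measure.ae_prod_iff_ae_ae hm, Measure.ae_ae_comm hm]
    filter_upwards [ih] with l hl
    have h0 : μ {x | x ∈ l} = 0 := (List.finite_toSet l).measure_zero μ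
    have h1 : ∀ᵐ x ∂μ, x ∉ l := by
      rw [ae_iff]
      simpa using h0
    filter_upwards [h1] with x hx
    exact List.nodup_cons.2 ⟨hx, hl⟩

/-- One-particle configurations in `I`. -/
abbrev baseMeasure (I : Set ℝ) : Measure ℝ := (volume : Measure ℝ).restrict I

/-- The measure `dx₁ ⋯ dx_n` on ordered configurations. -/
def orderedMeasure (I : Set ℝ) : Measure (List ℝ) :=
  Measure.sum fun n : ℕ =>
    ((configMeasure I n).restrict {x | StrictMono x}).map fun x => List.ofFn x

theorem measurableSet_strictMono (n : ℕ) : MeasurableSet {x : Fin n → ℝ | StrictMono x} := by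
  have : {x : Fin n → ℝ | StrictMono x} = ⋂ i : Fin n, ⋂ j : Fin n, {x | i < j → x i < x j} := by
    ext x
    simp [StrictMono]
  rw [this]
  refine MeasurableSet.iInter fun i => MeasurableSet.iInter fun j => ?_
  by_cases h : i < j
  · simpa [h] using measurableSet_lt (measurable_pi_apply i) (measurable_pi_apply j)
  · simp [h]

theorem strictMono_comp_unique {n : ℕ} {x : Fin n → ℝ} {σ τ : Equiv.Perm (Fin n)}
    (hσ : StrictMono (x ∘ σ)) (hτ : StrictMono (x ∘ τ)) : σ = τ := by
  have hx : Function.Injective x := by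
    have := hσ.injective.comp σ.symm.injective
    simpa [Function.comp_assoc] using this
  have h := Tuple.unique_monotone hσ.monotone hτ.monotone
  ext i
  exact congrArg Fin.val (hx (congrFun h i))

/-- Up to the null set of coinciding coordinates, the space of tuples is the disjoint union of n!
chambers, one for each sorting permutation. Relabelling preserves the measure and the symmetric
integrand, so all chambers contribute equally. -/
theorem lintegral_configMeasure_eq (I : Set ℝ) (n : ℕ) {F : Multiset ℝ → ℝ≥0∞}
    (hF : Measurable F) :
    ∫⁻ x : Fin n → ℝ, F (List.ofFn x) ∂configMeasure I n =
      n.factorial * ∫⁻ x in {x : Fin n → ℝ | StrictMono x}, F (List.ofFn x)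
        ∂configMeasure I n := by
  have hG : Measurable fun x : Fin n → ℝ => F (List.ofFn x) := 
    hF.fun_comp (measurable_coe_multiset.fun_comp (measurable_ofFn n))
  have hm : ∀ σ : Equiv.Perm (Fin n), Measurable fun x : Fin n → ℝ => x ∘ σ := fun σ =>
    (measurePreserving_perm I σ).measurable
  have h1 : (⋃ σ : Equiv.Perm (Fin n), {x : Fin n → ℝ | StrictMono (x ∘ σ)}) =ᵐ[configMeasure I n]
      Set.univ := by
    rw [Filter.eventuallyEq_univ]
    have hn := ae_nodup_tupleMeasure (baseMeasure I) n
    rw [tupleMeasure_eq_map_pi, ae_map_iff (measurable_ofFn n).aemeasurable measurableSet_nodup]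
      at hn
    filter_upwards [hn] with x hx
    rw [List.nodup_ofFn] at hx
    exact Set.mem_iUnion.2 ⟨Tuple.sort x,
      (Tuple.monotone_sort x).strictMono_of_injective (hx.comp (Tuple.sort x).injective)⟩
  rw [← setLIntegral_univ, ← setLIntegral_congr h1, lintegral_iUnion]
  · rw [tsum_fintype]
    have : ∀ σ : Equiv.Perm (Fin n),
        ∫⁻ x in {x : Fin n → ℝ | StrictMono (x ∘ σ)}, F (List.ofFn x) ∂configMeasure I n =
        ∫⁻ x in {x : Fin n → ℝ | StrictMono x}, F (List.ofFn x) ∂configMeasure I n := fun σ => by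
      rw [← (measurePreserving_perm I σ).setLIntegral_comp_preimage (measurableSet_strictMono n) hG]
      refine lintegral_congr fun x => ?_
      rw [Multiset.coe_eq_coe.2 (Equiv.Perm.ofFn_comp_perm σ x)]
    simp [this, Fintype.card_perm]
  · exact fun σ => hm σ (measurableSet_strictMono n)
  · intro σ τ hστ
    refine Set.disjoint_left.2 fun x hx hx' => hστ (strictMono_comp_unique hx hx')

/-- The n! chambers cancel the factor 1/n!. Thus `poisson` and the simplex measure of the Dyson
series agree on symmetric functions. -/
theorem map_poisson_eq_map_orderedMeasure (I : Set ℝ) :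
    (poisson (baseMeasure I)).map (fun l : List ℝ => (l : Multiset ℝ)) =
      (orderedMeasure I).map fun l : List ℝ => (l : Multiset ℝ) := by
  refine Measure.ext_of_lintegral _ fun F hF => ?_
  have hF' : Measurable fun l : List ℝ => F l := hF.fun_comp measurable_coe_multiset
  rw [lintegral_map hF measurable_coe_multiset, lintegral_map hF measurable_coe_multiset,
    lintegral_poisson, orderedMeasure, lintegral_sum_measure]
  refine tsum_congr fun n => ?_
  rw [tupleMeasure_eq_map_pi, lintegral_map hF' (measurable_ofFn n),
    lintegral_map hF' (measurable_ofFn n), lintegral_configMeasure_eq I n hF, ← mul_assoc,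
    ENNReal.inv_mul_cancel (by exact_mod_cast Nat.factorial_ne_zero n)
      (ENNReal.natCast_ne_top _), one_mul]

theorem integrable_poisson_iff_orderedMeasure (I : Set ℝ) {F : Multiset ℝ → ℂ}
    (hF : Measurable F) :
    Integrable (fun l : List ℝ => F l) (poisson (baseMeasure I)) ↔
      Integrable (fun l : List ℝ => F l) (orderedMeasure I) := by
  have h1 := integrable_map_measure (μ := poisson (baseMeasure I)) (g := F)
    hF.aestronglyMeasurable measurable_coe_multiset.aemeasurable
  have h2 := integrable_map_measure (μ := orderedMeasure I) (g := F)
    hF.aestronglyMeasurable measurable_coe_multiset.aemeasurable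
  rw [map_poisson_eq_map_orderedMeasure I] at h1
  exact h1.symm.trans h2

theorem integral_poisson_eq_orderedMeasure (I : Set ℝ) {F : Multiset ℝ → ℂ}
    (hF : Measurable F) :
    ∫ l : List ℝ, F l ∂poisson (baseMeasure I) = ∫ l : List ℝ, F l ∂orderedMeasure I := by
  rw [← integral_map (φ := fun l : List ℝ => (l : Multiset ℝ))
      measurable_coe_multiset.aemeasurable hF.aestronglyMeasurable,
    map_poisson_eq_map_orderedMeasure I, integral_map measurable_coe_multiset.aemeasurable
      hF.aestronglyMeasurable]

/-- The integral of a symmetric function as a series of integrals over simplices. -/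
theorem hasSum_integral_simplex (I : Set ℝ) {F : Multiset ℝ → ℂ} (hF : Measurable F)
    (hi : Integrable (fun l : List ℝ => F l) (poisson (baseMeasure I))) :
    (∀ n : ℕ, IntegrableOn (fun x : Fin n → ℝ => F (List.ofFn x)) {x | StrictMono x}
      (configMeasure I n)) ∧
    HasSum (fun n : ℕ => ∫ x : Fin n → ℝ in {x | StrictMono x}, F (List.ofFn x)
      ∂configMeasure I n) (∫ l : List ℝ, F l ∂poisson (baseMeasure I)) := by
  have hF' : Measurable fun l : List ℝ => F l := hF.fun_comp measurable_coe_multiset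
  have h1 := (integrable_poisson_iff_orderedMeasure I hF).1 hi
  have h2 := hasSum_integral_measure h1
  refine ⟨fun n => ?_, ?_⟩
  · have h3 := h1.mono_measure (Measure.le_sum (fun n : ℕ =>
      ((configMeasure I n).restrict {x | StrictMono x}).map fun x => List.ofFn x) n)
    exact (integrable_map_measure hF'.aestronglyMeasurable (measurable_ofFn n).aemeasurable).1 h3
  · rw [integral_poisson_eq_orderedMeasure I hF]
    refine h2.congr_fun fun n => ?_
    rw [integral_map (measurable_ofFn n).aemeasurable hF'.aestronglyMeasurable]

end Simplex

/-! ### Fock space vectors as functions of configurations -/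

section Hat

variable {I : Set ℝ}

/-- `√(n!) φ_n (y₁, …, y_n)`, as a function of the list `y`. -/
def listWave (φ : WaveFn) (l : List ℝ) : ℂ :=
  (Real.sqrt (l.length.factorial) : ℂ) * φ l.length l.get

theorem listWave_ofFn (φ : WaveFn) {n : ℕ} (x : Fin n → ℝ) :
    listWave φ (List.ofFn x) = (Real.sqrt (n.factorial) : ℂ) * φ n x := by
  have h : ∀ (l : List ℝ) (m : ℕ) (hm : l.length = m),
      listWave φ l = (Real.sqrt (m.factorial) : ℂ) * φ m fun i => l.get (i.cast hm.symm) := by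
    rintro l m rfl
    rfl
  rw [h _ n (List.length_ofFn)]
  congr 2
  funext i
  simp

theorem measurable_listWave {φ : WaveFn} (hφ : ∀ n, Measurable (φ n)) :
    Measurable (listWave φ) := by
  refine measurable_list_iff.2 fun n => ?_
  simp only [listWave_ofFn]
  exact (hφ n).const_mul _

theorem measurable_wave (f : Fock I) (n : ℕ) : Measurable (wave f n) :=
  (Lp.stronglyMeasurable _).measurable

/-- A Fock space vector as a function of finite configurations: the `n`-particle wave function
at the ordered points, times `√(n!)`. -/
def hat (f : Fock I) (m : Multiset ℝ) : ℂ := listWave (wave f) (m.sort (· ≤ ·))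

theorem measurable_hat (f : Fock I) : Measurable (hat f) :=
  (measurable_listWave (measurable_wave f)).comp
    (measurable_multiset_sort (measurableSet_le measurable_fst measurable_snd))

theorem hat_of_pairwise (f : Fock I) {l : List ℝ} (hl : l.Pairwise (· < ·)) :
    hat f l = listWave (wave f) l := by
  unfold hat
  congr 1
  exact (Multiset.coe_eq_coe.1 (Multiset.sort_eq (l : Multiset ℝ) (· ≤ ·))).eq_of_pairwise'
    (r := (· ≤ ·)) (Multiset.pairwise_sort _ _) (hl.imp le_of_lt)

theorem ae_wave_perm (f : Fock I) (n : ℕ) (σ : Equiv.Perm (Fin n)) :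
    ∀ᵐ x ∂configMeasure I n, wave f n (x ∘ σ) = wave f n x := by
  have h := (f n).2
  simp only [sector, Submodule.mem_iInf, LinearMap.mem_eqLocus, LinearMap.id_coe, id_eq] at h
  have h2 := Lp.coeFn_compMeasurePreserving (f n : Lp ℂ 2 (configMeasure I n))
    (measurePreserving_perm I σ)
  have h3 : Lp.compMeasurePreserving _ (measurePreserving_perm I σ)
    (f n : Lp ℂ 2 (configMeasure I n)) = f n := h σ
  rw [h3] at h2
  filter_upwards [h2] with x hx
  exact hx.symm

/-- The chosen representative of f_n is symmetric only almost everywhere, while `hat` is symmetric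
everywhere because it sorts. There are finitely many permutations, so one null set suffices for all
of them. -/
theorem ae_hat_ofFn (f : Fock I) (n : ℕ) : ∀ᵐ x : Fin n → ℝ ∂configMeasure I n,
    hat f (List.ofFn x) = (Real.sqrt (n.factorial) : ℂ) * wave f n x := by
  filter_upwards [ae_all_iff.2 (ae_wave_perm f n)] with x hx
  have h : ((List.ofFn x : List ℝ) : Multiset ℝ).sort (· ≤ ·) = List.ofFn (x ∘ Tuple.sort x) := by
    have hp : (((List.ofFn x : List ℝ) : Multiset ℝ).sort (· ≤ ·)).Perm
        (List.ofFn (x ∘ Tuple.sort x)) :=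
      (Multiset.coe_eq_coe.1 (Multiset.sort_eq (List.ofFn x : Multiset ℝ) (· ≤ ·))).trans
        (Equiv.Perm.ofFn_comp_perm _ x).symm
    refine hp.eq_of_pairwise' (r := (· ≤ ·)) (Multiset.pairwise_sort _ _) ?_
    exact List.pairwise_ofFn.2 fun i j hij => Tuple.monotone_sort x hij.le
  rw [hat, h, listWave_ofFn, hx]

theorem enorm_sq_eq_lintegral {α : Type*} [MeasurableSpace α] {μ : Measure α} (g : Lp ℂ 2 μ) :
    ‖g‖ₑ ^ 2 = ∫⁻ x, ‖g x‖ₑ ^ 2 ∂μ := by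
  have h := eLpNorm_nnreal_pow_eq_lintegral (f := g) (μ := μ) (p := 2) (by simp)
  rw [Lp.enorm_def]
  simpa using h

theorem enorm_sqrt_factorial_sq (n : ℕ) :
    ‖(Real.sqrt (n.factorial) : ℂ)‖ₑ ^ 2 = (n.factorial : ℝ≥0∞) := by
  rw [← enorm_pow, ← Complex.ofReal_pow, Real.sq_sqrt (by positivity)]
  simp [enorm_eq_nnnorm]

theorem ae_poisson_iff {p : List ℝ → Prop} (hp : MeasurableSet {l | p l}) :
    (∀ᵐ l ∂poisson (baseMeasure I), p l) ↔
      ∀ n, ∀ᵐ x : Fin n → ℝ ∂configMeasure I n, p (List.ofFn x) := by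
  rw [poisson, Measure.ae_sum_iff]
  refine forall_congr' fun n => ?_
  rw [Measure.ae_ennreal_smul_measure_iff (by simp), tupleMeasure_eq_map_pi,
    ae_map_iff (measurable_ofFn n).aemeasurable hp]

theorem lintegral_poisson_pi (F : List ℝ → ℝ≥0∞) (hF : Measurable F) :
    ∫⁻ l, F l ∂poisson (baseMeasure I) = ∑' n : ℕ, (n.factorial : ℝ≥0∞)⁻¹ *
      ∫⁻ x : Fin n → ℝ, F (List.ofFn x) ∂configMeasure I n := by
  rw [lintegral_poisson]
  refine tsum_congr fun n => ?_
  rw [tupleMeasure_eq_map_pi, lintegral_map hF (measurable_ofFn n)]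

theorem inv_factorial_mul_factorial (n : ℕ) :
    (n.factorial : ℝ≥0∞)⁻¹ * (n.factorial : ℝ≥0∞) = 1 :=
  ENNReal.inv_mul_cancel (by exact_mod_cast Nat.factorial_ne_zero n) (ENNReal.natCast_ne_top _)

/-- The square of √(n!) cancels the weight 1/n!. At c = 1 this is the Fock space norm, and for
general c the defining condition of `expDomain`. -/
theorem lintegral_hat (f : Fock I) (c : ℝ≥0∞) :
    ∫⁻ l : List ℝ, c ^ (l : Multiset ℝ).card * ‖hat f l‖ₑ ^ 2 ∂poisson (baseMeasure I) =
      ∑' n : ℕ, c ^ n * ‖f n‖ₑ ^ 2 := by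
  have hm : Measurable fun m : Multiset ℝ => c ^ m.card * ‖hat f m‖ₑ ^ 2 :=
    ((measurable_of_countable fun n : ℕ => c ^ n).comp measurable_multiset_card).mul
      ((measurable_hat f).enorm.pow_const 2)
  rw [lintegral_poisson_pi _ hm]
  refine tsum_congr fun n => ?_
  have h1 : ∫⁻ x : Fin n → ℝ, c ^ ((List.ofFn x : List ℝ) : Multiset ℝ).card *
      ‖hat f (List.ofFn x)‖ₑ ^ 2 ∂configMeasure I n =
      ∫⁻ x, c ^ n * (n.factorial * ‖wave f n x‖ₑ ^ 2) ∂configMeasure I n := by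
    refine lintegral_congr_ae ?_
    filter_upwards [ae_hat_ofFn f n] with x hx
    rw [hx, enorm_mul, mul_pow, enorm_sqrt_factorial_sq]
    simp
  rw [h1, lintegral_const_mul _ (((measurable_wave f n).enorm.pow_const 2).const_mul _),
    lintegral_const_mul _ ((measurable_wave f n).enorm.pow_const 2)]
  have h2 : ‖f n‖ₑ ^ 2 = ∫⁻ x, ‖wave f n x‖ₑ ^ 2 ∂configMeasure I n := by
    exact enorm_sq_eq_lintegral (f n : Lp ℂ 2 (configMeasure I n))
  rw [h2, mul_left_comm, ← mul_assoc (_)⁻¹, inv_factorial_mul_factorial, one_mul]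

theorem summable_iff_tsum_lt_top (c : NNReal) (a : ℕ → ℝ) (ha : ∀ n, 0 ≤ a n) :
    (Summable fun n => (c : ℝ) ^ n * a n ^ 2) ↔
      ∑' n, (c : ℝ≥0∞) ^ n * (ENNReal.ofReal (a n)) ^ 2 < ∞ := by
  lift a to ℕ → NNReal using ha
  have : ∀ n, (c : ℝ≥0∞) ^ n * (ENNReal.ofReal (a n)) ^ 2 =
      ((c ^ n * a n ^ 2 : NNReal) : ℝ≥0∞) := fun n => by
    rw [ENNReal.ofReal_coe_nnreal]; push_cast; rfl
  simp_rw [this, lt_top_iff_ne_top, ENNReal.tsum_coe_ne_top_iff_summable]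
  rw [← NNReal.summable_coe]
  push_cast
  rfl

theorem lintegral_hat_lt_top (f : expDomain I) (c : NNReal) :
    ∫⁻ l : List ℝ, (c : ℝ≥0∞) ^ (l : Multiset ℝ).card * ‖hat (f : Fock I) l‖ₑ ^ 2
      ∂poisson (baseMeasure I) < ∞ := by
  rw [lintegral_hat]
  have := (summable_iff_tsum_lt_top c (fun n => ‖(f : Fock I) n‖) fun n => norm_nonneg _).1
    (f.2 c)
  simpa only [ofReal_norm] using this

theorem lintegral_hat_sq_lt_top (f : Fock I) :
    ∫⁻ l : List ℝ, ‖hat f l‖ₑ ^ 2 ∂poisson (baseMeasure I) < ∞ := by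
  have h := lintegral_hat f 1
  simp only [one_pow, one_mul] at h
  rw [h]
  have hs : Summable fun n => ‖f n‖ ^ 2 := by
    have := (lp.memℓp f).summable (by norm_num)
    simpa using this
  have := (summable_iff_tsum_lt_top 1 (fun n => ‖f n‖) fun n => norm_nonneg _).1
    (by simpa using hs)
  simpa only [ofReal_norm, ENNReal.coe_one, one_pow, one_mul] using this

theorem memLp_two_of_sq {α : Type*} [MeasurableSpace α] {μ : Measure α} {k : α → ℂ}
    (hk : Measurable k) (hk2 : ∫⁻ x, ‖k x‖ₑ ^ 2 ∂μ < ∞) : MemLp k 2 μ := by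
  refine ⟨hk.aestronglyMeasurable, ?_⟩
  have h := eLpNorm_nnreal_pow_eq_lintegral (f := k) (μ := μ) (p := 2) (by simp)
  by_contra hc
  rw [not_lt, top_le_iff] at hc
  simp only [ENNReal.coe_ofNat, NNReal.coe_ofNat] at h
  rw [hc] at h
  simp only [ENNReal.rpow_ofNat] at h
  rw [← h] at hk2
  simp at hk2

theorem integrable_conj_mul_of_sq {α : Type*} [MeasurableSpace α] {μ : Measure α} {g h : α → ℂ}
    (hg : Measurable g) (hh : Measurable h) (hg2 : ∫⁻ x, ‖g x‖ₑ ^ 2 ∂μ < ∞)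
    (hh2 : ∫⁻ x, ‖h x‖ₑ ^ 2 ∂μ < ∞) : Integrable (fun x => conj (g x) * h x) μ := by
  exact (memLp_two_of_sq hg hg2).star.integrable_mul (memLp_two_of_sq hh hh2)

theorem inner_eq_integral_hat (g h : Fock I) :
    ⟪g, h⟫_ℂ = ∫ l : List ℝ, conj (hat g l) * hat h l ∂poisson (baseMeasure I) := by
  have hmg : Measurable fun l : List ℝ => hat g l := measurable_multiset_iff.1 (measurable_hat g)
  have hmh : Measurable fun l : List ℝ => hat h l := measurable_multiset_iff.1 (measurable_hat h)
  have hi := integrable_conj_mul_of_sq hmg hmh (lintegral_hat_sq_lt_top g)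
    (lintegral_hat_sq_lt_top h)
  have h1 := lp.hasSum_inner (𝕜 := ℂ) g h
  have h2 := hasSum_integral_measure hi
  refine h1.unique (h2.congr_fun fun n => ?_)
  have hm : Measurable fun l : List ℝ => conj (hat g l) * hat h l :=
    (Complex.continuous_conj.measurable.comp hmg).mul hmh
  rw [integral_smul_measure, tupleMeasure_eq_map_pi,
    integral_map (measurable_ofFn n).aemeasurable hm.aestronglyMeasurable]
  have h3 : ⟪g n, h n⟫_ℂ = ∫ x, conj (wave g n x) * wave h n x ∂configMeasure I n := by
    change ⟪(g n : Lp ℂ 2 (configMeasure I n)), (h n : Lp ℂ 2 (configMeasure I n))⟫_ℂ = _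
    rw [L2.inner_def]
    refine integral_congr_ae (Filter.Eventually.of_forall fun x => ?_)
    simp [wave, mul_comm]
  have h4 : ∫ x : Fin n → ℝ, conj (hat g (List.ofFn x)) * hat h (List.ofFn x) ∂configMeasure I n =
      ∫ x, (n.factorial : ℝ) • (conj (wave g n x) * wave h n x) ∂configMeasure I n := by
    refine integral_congr_ae ?_
    filter_upwards [ae_hat_ofFn g n, ae_hat_ofFn h n] with x hx hy
    have : (Real.sqrt (n.factorial) : ℂ) * (Real.sqrt (n.factorial) : ℂ) = n.factorial := by
      rw [← Complex.ofReal_mul, Real.mul_self_sqrt (by positivity)]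
      simp
    rw [hx, hy, map_mul, Complex.conj_ofReal, Complex.real_smul]
    push_cast
    rw [← this]
    ring
  rw [h3, h4, integral_smul, smul_smul]
  have : ((n.factorial : ℝ≥0∞)⁻¹).toReal * (n.factorial : ℝ) = 1 := by
    have hn : (n.factorial : ℝ) ≠ 0 := by exact_mod_cast Nat.factorial_ne_zero n
    simp [hn]
  rw [this, one_smul]

/-- A symmetric function of configurations with all exponential moments is a vector in
`expDomain I`. -/
theorem exists_hat_eq {H : Multiset ℝ → ℂ} (hH : Measurable H)
    (hc : ∀ c : NNReal, ∫⁻ l : List ℝ, (c : ℝ≥0∞) ^ (l : Multiset ℝ).card * ‖H l‖ₑ ^ 2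
      ∂poisson (baseMeasure I) < ∞) :
    ∃ h : expDomain I, ∀ᵐ l : List ℝ ∂poisson (baseMeasure I), hat (h : Fock I) l = H l := by
  have hm : ∀ c : NNReal, Measurable fun m : Multiset ℝ => (c : ℝ≥0∞) ^ m.card * ‖H m‖ₑ ^ 2 :=
    fun c => ((measurable_of_countable fun n : ℕ => (c : ℝ≥0∞) ^ n).comp
      measurable_multiset_card).mul (hH.enorm.pow_const 2)
  have hHn : ∀ n : ℕ, Measurable fun x : Fin n → ℝ => H (List.ofFn x) := fun n =>
    hH.fun_comp (measurable_coe_multiset.fun_comp (measurable_ofFn n))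
  -- Dividing by √(n!) inverts the normalization in `hat`; symmetry is automatic because H depends
  -- on the multiset only.
  set w : (n : ℕ) → (Fin n → ℝ) → ℂ := fun n x =>
    (Real.sqrt (n.factorial) : ℂ)⁻¹ * H (List.ofFn x) with hw
  have hwm : ∀ n, Measurable (w n) := fun n => (hHn n).const_mul _
  have hs0 : ∀ n : ℕ, (Real.sqrt (n.factorial) : ℂ) ≠ 0 := fun n => by
    have : (0 : ℝ) < n.factorial := by exact_mod_cast n.factorial_pos
    exact_mod_cast (Real.sqrt_pos.2 this).ne'
  have hwn : ∀ n x, (n.factorial : ℝ≥0∞) * ‖w n x‖ₑ ^ 2 = ‖H (List.ofFn x)‖ₑ ^ 2 := fun n x => by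
    rw [← enorm_sqrt_factorial_sq, ← mul_pow, ← enorm_mul, hw]
    simp only
    rw [mul_inv_cancel_left₀ (hs0 n)]
  have hsum : ∀ c : NNReal, ∑' n : ℕ, (c : ℝ≥0∞) ^ n * ∫⁻ x, ‖w n x‖ₑ ^ 2 ∂configMeasure I n < ∞ := by
    intro c
    have := hc c
    rw [lintegral_poisson_pi _ (hm c)] at this
    convert this using 3 with n
    simp only [Multiset.coe_card, List.length_ofFn]
    rw [lintegral_const_mul _ ((hHn n).enorm.pow_const 2)]
    simp_rw [← hwn]
    rw [lintegral_const_mul _ ((hwm n).enorm.pow_const 2), mul_left_comm, ← mul_assoc (_)⁻¹,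
      inv_factorial_mul_factorial, one_mul]
  have hw2 : ∀ n, ∫⁻ x, ‖w n x‖ₑ ^ 2 ∂configMeasure I n < ∞ := fun n => by
    have h1 := (ENNReal.le_tsum n).trans_lt (hsum 1)
    simpa using h1
  have hmem : ∀ n, MemLp (w n) 2 (configMeasure I n) := fun n => memLp_two_of_sq (hwm n) (hw2 n)
  have hsec : ∀ n, (hmem n).toLp (w n) ∈ sector I n := fun n => by
    simp only [sector, Submodule.mem_iInf, LinearMap.mem_eqLocus, LinearMap.id_coe, id_eq]
    intro σ
    refine Lp.ext ?_
    have e1 := Lp.coeFn_compMeasurePreserving ((hmem n).toLp (w n)) (measurePreserving_perm I σ)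
    have e2 := (measurePreserving_perm I σ).quasiMeasurePreserving.ae_eq_comp (hmem n).coeFn_toLp
    have e3 := (hmem n).coeFn_toLp
    refine e1.trans (e2.trans (Filter.EventuallyEq.trans ?_ e3.symm))
    refine Filter.Eventually.of_forall fun x => ?_
    simp only [hw, Function.comp_apply]
    rw [Multiset.coe_eq_coe.2 (Equiv.Perm.ofFn_comp_perm σ x)]
  let v : (n : ℕ) → sector I n := fun n => ⟨(hmem n).toLp (w n), hsec n⟩
  have hv : ∀ n, ‖v n‖ₑ ^ 2 = ∫⁻ x, ‖w n x‖ₑ ^ 2 ∂configMeasure I n := fun n => by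
    have : ‖v n‖ₑ ^ 2 = ∫⁻ x, ‖(hmem n).toLp (w n) x‖ₑ ^ 2 ∂configMeasure I n :=
      enorm_sq_eq_lintegral ((hmem n).toLp (w n))
    rw [this]
    refine lintegral_congr_ae ?_
    filter_upwards [(hmem n).coeFn_toLp] with x hx
    rw [hx]
  have hvs : ∀ c : NNReal, Summable fun n => (c : ℝ) ^ n * ‖v n‖ ^ 2 := fun c => by
    refine (summable_iff_tsum_lt_top c (fun n => ‖v n‖) fun n => norm_nonneg _).2 ?_
    simp only [ofReal_norm, hv]
    exact hsum c
  have hvl : Memℓp v 2 := by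
    refine memℓp_gen ?_
    have := hvs 1
    simpa using this
  let F : Fock I := ⟨v, hvl⟩
  have hF : F ∈ expDomain I := by
    intro c
    have := hvs ⟨|c|, abs_nonneg c⟩
    refine Summable.of_norm_bounded this fun n => ?_
    simp only [norm_mul, norm_pow, Real.norm_eq_abs, abs_norm]
    exact le_rfl
  refine ⟨⟨F, hF⟩, ?_⟩
  have hms : MeasurableSet {l : List ℝ | hat F l = H l} :=
    measurableSet_eq_fun (measurable_multiset_iff.1 (measurable_hat F))
      (measurable_multiset_iff.1 hH)
  refine (ae_poisson_iff hms).2 fun n => ?_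
  filter_upwards [ae_hat_ofFn F n, (hmem n).coeFn_toLp] with x hx hy
  have : wave F n x = w n x := hy
  rw [hx, this]
  simp only [hw]
  rw [mul_inv_cancel_left₀ (hs0 n)]

end Hat

/-! ### Kernels and their operators -/

section Kernels

variable {I : Set ℝ}

/-- The kind of a point of the Dyson series: whether it creates and whether it annihilates a
particle. The kinds of `Q`, `L`, `R`, `T` are `(false, false)`, `(true, false)`, `(false, true)`
and `(true, true)`. -/
abbrev Kind : Type := Bool × Bool

/-- The splitting of the kinds into creating and non-creating ones. -/
def splitCreate : Bool ⊕ Bool ≃ Kind where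
  toFun := Sum.elim (fun b => (true, b)) fun b => (false, b)
  invFun k := bif k.1 then Sum.inl k.2 else Sum.inr k.2
  left_inv s := by cases s <;> rfl
  right_inv := by rintro ⟨_ | _, b⟩ <;> rfl

/-- The splitting of the kinds into non-annihilating and annihilating ones. -/
def splitAnnih : Bool ⊕ Bool ≃ Kind where
  toFun := Sum.elim (fun a => (a, false)) fun a => (a, true)
  invFun k := bif k.2 then Sum.inr k.1 else Sum.inl k.1
  left_inv s := by cases s <;> rfl
  right_inv := by rintro ⟨a, _ | _⟩ <;> rfl

/-- The points that create a particle. -/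
def createPts (ω : Multiset (ℝ × Kind)) : Multiset ℝ :=
  (ω.filter fun p => p.2.1 = true).map Prod.fst

/-- The points that annihilate a particle. -/
def annihPts (ω : Multiset (ℝ × Kind)) : Multiset ℝ :=
  (ω.filter fun p => p.2.2 = true).map Prod.fst

theorem measurable_createPts : Measurable createPts :=
  (measurable_multiset_map measurable_fst).comp
    (measurable_multiset_filter
      (measurableSet_eq_fun (by fun_prop : Measurable fun p : ℝ × Kind => p.2.1) measurable_const))

theorem measurable_annihPts : Measurable annihPts :=
  (measurable_multiset_map measurable_fst).comp
    (measurable_multiset_filter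
      (measurableSet_eq_fun (by fun_prop : Measurable fun p : ℝ × Kind => p.2.2) measurable_const))

theorem createPts_union (τ ρ : Multiset (ℝ × Bool)) :
    createPts (labelledUnion splitCreate τ ρ) = τ.map Prod.fst := by
  simp [createPts, labelledUnion, splitCreate, Multiset.filter_map]

theorem annihPts_union (α τ : Multiset (ℝ × Bool)) :
    annihPts (labelledUnion splitAnnih α τ) = τ.map Prod.fst := by
  simp [annihPts, labelledUnion, splitAnnih, Multiset.filter_map]

theorem prod_map_labelledUnion {A B C X M : Type*} [CommMonoid M] (e : B ⊕ C ≃ A)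
    (β : Multiset (X × B)) (γ : Multiset (X × C)) (q : X × A → M) :
    ((labelledUnion e β γ).map q).prod =
      (β.map fun p => q (p.1, e (Sum.inl p.2))).prod *
        (γ.map fun p => q (p.1, e (Sum.inr p.2))).prod := by
  simp only [labelledUnion, Multiset.map_add, Multiset.prod_add, Multiset.map_map]
  rfl

/-- A bound for the coefficient functions. -/
structure Majorant (I : Set ℝ) (m : ℝ × Kind → ℝ≥0∞) : Prop where
  measurable : Measurable m
  Q_lt : ∫⁻ x, m (x, (false, false)) ∂baseMeasure I < ∞
  L_lt : ∫⁻ x, m (x, (true, false)) ^ 2 ∂baseMeasure I < ∞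
  R_lt : ∫⁻ x, m (x, (false, true)) ^ 2 ∂baseMeasure I < ∞
  T_le : ∃ t : NNReal, ∀ x, m (x, (true, true)) ≤ t

/-- Kernels with a multiplicative bound. -/
structure IsKernel (I : Set ℝ) (κ : Multiset (ℝ × Kind) → ℂ) : Prop where
  measurable : Measurable κ
  bound : ∃ (b : NNReal) (m : ℝ × Kind → ℝ≥0∞), Majorant I m ∧
    ∀ ω, ‖κ ω‖ₑ ≤ b * (ω.map m).prod

/-- Square integrability with all exponential weights. -/
def ExpMoments (I : Set ℝ) (φ : Multiset ℝ → ℝ≥0∞) : Prop :=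
  ∀ c : NNReal, ∫⁻ l : List ℝ, (c : ℝ≥0∞) ^ (l : Multiset ℝ).card * φ l ^ 2
    ∂poisson (baseMeasure I) < ∞

/-- The configurations of points with a binary label. -/
abbrev binaryMeasure (I : Set ℝ) : Measure (List (ℝ × Bool)) :=
  poisson (labelled (baseMeasure I) Bool)

/-- The configurations of points with a kind. -/
abbrev kindMeasure (I : Set ℝ) : Measure (List (ℝ × Kind)) :=
  poisson (labelled (baseMeasure I) Kind)

/-- The action of the absolute value of a kernel on a function of configurations. -/
def absApply (I : Set ℝ) (κ : Multiset (ℝ × Kind) → ℂ) (φ : Multiset ℝ → ℝ≥0∞) :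
    Multiset ℝ → ℝ≥0∞ :=
  multisetColorSum fun c : Multiset (ℝ × Bool) => ∫⁻ ρ : List (ℝ × Bool),
    ‖κ (labelledUnion splitCreate c ρ)‖ₑ * φ (annihPts (labelledUnion splitCreate c ρ))
      ∂binaryMeasure I

/-- The action of a kernel on a function of configurations. -/
def kernelApply (I : Set ℝ) (κ : Multiset (ℝ × Kind) → ℂ) (φ : Multiset ℝ → ℂ) :
    Multiset ℝ → ℂ :=
  multisetColorSum fun c : Multiset (ℝ × Bool) => ∫ ρ : List (ℝ × Bool),
    κ (labelledUnion splitCreate c ρ) * φ (annihPts (labelledUnion splitCreate c ρ))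
      ∂binaryMeasure I

theorem enorm_kernelApply_le (κ : Multiset (ℝ × Kind) → ℂ) (φ : Multiset ℝ → ℂ) (l : List ℝ) :
    ‖kernelApply I κ φ l‖ₑ ≤ absApply I κ (fun m => ‖φ m‖ₑ) l := by
  refine (norm_colorSum_le _ l).trans (colorSum_mono (fun t => ?_) l)
  refine (enorm_integral_le_lintegral_enorm _).trans (lintegral_mono fun ρ => ?_)
  rw [enorm_mul]

theorem measurable_absApply {κ : Multiset (ℝ × Kind) → ℂ} (hκ : Measurable κ)
    {φ : Multiset ℝ → ℝ≥0∞} (hφ : Measurable φ) : Measurable (absApply I κ φ) := by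
  refine measurable_multisetColorSum (measurable_multiset_iff.2 ?_)
  have h : Measurable fun ω => ‖κ ω‖ₑ * φ (annihPts ω) :=
    hκ.enorm.mul (hφ.comp measurable_annihPts)
  exact (h.comp (measurable_labelledUnion splitCreate)).lintegral_prod_right'

theorem measurable_kernelApply {κ : Multiset (ℝ × Kind) → ℂ} (hκ : Measurable κ)
    {φ : Multiset ℝ → ℂ} (hφ : Measurable φ) : Measurable (kernelApply I κ φ) := by
  refine measurable_multisetColorSum (measurable_multiset_iff.2 ?_)
  have h : Measurable fun ω => κ ω * φ (annihPts ω) := hκ.mul (hφ.comp measurable_annihPts)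
  exact (h.comp (measurable_labelledUnion splitCreate)).stronglyMeasurable.integral_prod_right'
    |>.measurable

/-- The Cauchy–Schwarz inequality. -/
theorem sq_lintegral_mul_le {α : Type*} [MeasurableSpace α] {μ : Measure α} {f g : α → ℝ≥0∞}
    (hf : Measurable f) (hg : Measurable g) :
    (∫⁻ x, f x * g x ∂μ) ^ 2 ≤ (∫⁻ x, f x ^ 2 ∂μ) * ∫⁻ x, g x ^ 2 ∂μ := by
  have h := ENNReal.lintegral_mul_le_Lp_mul_Lq μ Real.HolderConjugate.two_two hf.aemeasurable
    hg.aemeasurable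
  simp only [Pi.mul_apply, ENNReal.rpow_ofNat] at h
  calc (∫⁻ x, f x * g x ∂μ) ^ 2
      ≤ ((∫⁻ x, f x ^ 2 ∂μ) ^ (1 / 2 : ℝ) * (∫⁻ x, g x ^ 2 ∂μ) ^ (1 / 2 : ℝ)) ^ 2 := by gcongr
    _ = _ := by
      rw [mul_pow, ← ENNReal.rpow_natCast, ← ENNReal.rpow_natCast, ← ENNReal.rpow_mul,
        ← ENNReal.rpow_mul]
      norm_num

theorem sq_colorSum_le {X C : Type*} [Fintype C] [MeasurableSpace X] [MeasurableSpace C]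
    [MeasurableSingletonClass C] {F : List (X × C) → ℝ≥0∞} (hF : Measurable F) (l : List X) :
    colorSum F l ^ 2 ≤ (Fintype.card C : ℝ≥0∞) ^ l.length * colorSum (fun t => F t ^ 2) l := by
  have h := sq_lintegral_mul_le (μ := colorKernel X C l) (f := fun _ => 1) measurable_const hF
  simp only [one_mul, one_pow] at h
  rwa [lintegral_colorKernel hF, lintegral_colorKernel measurable_const,
    lintegral_colorKernel (hF.pow_const 2), colorSum_one] at h

theorem colorSum_weight {X C : Type*} [Fintype C] (F : List (X × C) → ℝ≥0∞)
    (G : List X → ℝ≥0∞) (l : List X) :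
    G l * colorSum F l = colorSum (fun t => G (t.map Prod.fst) * F t) l := by
  rw [← colorSum_const_mul]
  exact colorSum_congr fun t ht => by rw [ht]

theorem lintegral_binary_fst {φ : Multiset ℝ → ℝ≥0∞} (hφ : Measurable φ) :
    ∫⁻ τ : List (ℝ × Bool), φ ((τ : Multiset (ℝ × Bool)).map Prod.fst) ∂binaryMeasure I =
      ∫⁻ l : List ℝ, 2 ^ (l : Multiset ℝ).card * φ l ∂poisson (baseMeasure I) := by
  rw [lintegral_poisson_colorSum]
  · refine lintegral_congr fun l => ?_
    have h := colorSum_weight (C := Bool) (fun _ => 1) (fun l : List ℝ => φ l) l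
    simp only [mul_one] at h
    simp only [Multiset.map_coe]
    rw [← h, colorSum_one]
    simp [mul_comm]
  · exact hφ.fun_comp ((measurable_multiset_map measurable_fst).fun_comp measurable_coe_multiset)

theorem prod_map_const (c : ℝ≥0∞) {X : Type*} (m : Multiset X) :
    (m.map fun _ => c).prod = c ^ m.card := by
  simp

theorem lintegral_labelled_bool {q : ℝ × Bool → ℝ≥0∞} (hq : Measurable q) :
    ∫⁻ p, q p ∂labelled (baseMeasure I) Bool =
      ∫⁻ x, q (x, true) ∂baseMeasure I + ∫⁻ x, q (x, false) ∂baseMeasure I := by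
  rw [lintegral_labelled _ hq, ← lintegral_add_left (hq.fun_comp measurable_prodMk_right)]
  simp

theorem measurable_of_kind {f : ℝ × Kind → ℝ≥0∞} (h : ∀ k, Measurable fun x => f (x, k)) :
    Measurable f :=
  measurable_from_prod_countable_left h

/-- The action of a kernel preserves square integrability with exponential weights. -/
theorem expMoments_absApply {κ : Multiset (ℝ × Kind) → ℂ} (hκ : IsKernel I κ)
    {φ : Multiset ℝ → ℝ≥0∞} (hφ : Measurable φ) (hφ2 : ExpMoments I φ) :
    ExpMoments I (absApply I κ φ) := by
  obtain ⟨b, m, hm, hb⟩ := hκ.bound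
  obtain ⟨t, ht⟩ := hm.T_le
  intro c
  have hmk : ∀ k : Kind, Measurable fun x => m (x, k) := fun k =>
    hm.measurable.comp measurable_prodMk_right
  -- The bound is factored as m = u v for Cauchy–Schwarz over the non-creating points: R goes to u,
  -- where its square is integrated; L and T go to v; Q is shared as two square roots, so that only
  -- its first power is integrated.
  let u : ℝ × Kind → ℝ≥0∞ := fun p =>
    bif p.2.1 then 1 else bif p.2.2 then m p else m p ^ (1 / 2 : ℝ)
  let v : ℝ × Kind → ℝ≥0∞ := fun p =>
    bif p.2.1 then m p else bif p.2.2 then 1 else m p ^ (1 / 2 : ℝ)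
  have hu : Measurable u := measurable_of_kind (by
    rintro ⟨_ | _, _ | _⟩
    exacts [(hmk _).pow_const _, hmk _, measurable_const, measurable_const])
  have hv : Measurable v := measurable_of_kind (by
    rintro ⟨_ | _, _ | _⟩
    exacts [(hmk _).pow_const _, measurable_const, hmk _, hmk _])
  have hhalf : ∀ a : ℝ≥0∞, a ^ (1 / 2 : ℝ) * a ^ (1 / 2 : ℝ) = a := fun a => by
    rw [← ENNReal.rpow_add_of_nonneg _ _ (by norm_num) (by norm_num)]
    norm_num
  have huv : ∀ p, m p = u p * v p := by
    rintro ⟨x, _ | _, _ | _⟩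
    exacts [(hhalf _).symm, (mul_one _).symm, (one_mul _).symm, (one_mul _).symm]
  -- Each created point contributes c from the exponential weight and 2 from Cauchy–Schwarz for the
  -- sum over its two possible labels.
  let w : ℝ × Kind → ℝ≥0∞ := fun p => (bif p.2.1 then 2 * (c : ℝ≥0∞) else 1) * v p ^ 2
  have hw : Measurable w := measurable_of_kind fun k =>
    ((hv.fun_comp (f := fun x : ℝ => (x, k)) measurable_prodMk_right).pow_const 2).const_mul
      (bif k.1 then 2 * (c : ℝ≥0∞) else 1)
  -- the two factors in the Cauchy–Schwarz inequality
  let E : ℝ≥0∞ := ∫⁻ ρ : List (ℝ × Bool),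
    ((ρ : Multiset (ℝ × Bool)).map fun p => u (p.1, (false, p.2)) ^ 2).prod ∂binaryMeasure I
  have hu' : Measurable fun p : ℝ × Bool => u (p.1, (false, p.2)) ^ 2 :=
    (hu.fun_comp (f := fun p : ℝ × Bool => (p.1, (false, p.2))) (by fun_prop)).pow_const 2
  have hE : E < ∞ := by
    refine lintegral_poisson_prod_lt_top _ hu' ?_
    rw [lintegral_labelled_bool hu']
    refine (ENNReal.add_lt_top.2 ⟨hm.R_lt, ?_⟩).ne
    have : ∀ x, u (x, (false, false)) ^ 2 = m (x, (false, false)) := fun x => by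
      rw [sq]
      exact hhalf _
    simp only [this]
    exact hm.Q_lt
  let K : Multiset (ℝ × Kind) → ℝ≥0∞ := fun ω => (ω.map fun p => v p ^ 2).prod * φ (annihPts ω) ^ 2
  have hK : Measurable K :=
    (measurable_multiset_prod_map (hv.pow_const 2)).mul
      ((hφ.comp measurable_annihPts).pow_const 2)
  have hmu := measurable_labelledUnion (X := ℝ) splitCreate
  have hJ : ∀ τ : List (ℝ × Bool), (∫⁻ ρ : List (ℝ × Bool),
      ‖κ (labelledUnion splitCreate τ ρ)‖ₑ * φ (annihPts (labelledUnion splitCreate τ ρ))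
        ∂binaryMeasure I) ^ 2 ≤
      (b : ℝ≥0∞) ^ 2 * E * ∫⁻ ρ : List (ℝ × Bool), K (labelledUnion splitCreate τ ρ)
        ∂binaryMeasure I := by
    intro τ
    have hmτ : Measurable fun ρ : List (ℝ × Bool) =>
        labelledUnion splitCreate (τ : Multiset (ℝ × Bool)) (ρ : Multiset (ℝ × Bool)) :=
      hmu.comp measurable_prodMk_left
    have m1 : Measurable fun ρ : List (ℝ × Bool) =>
        ((labelledUnion splitCreate (τ : Multiset (ℝ × Bool)) ρ).map u).prod :=
      (measurable_multiset_prod_map hu).comp hmτ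
    have m2 : Measurable fun ρ : List (ℝ × Bool) =>
        ((labelledUnion splitCreate (τ : Multiset (ℝ × Bool)) ρ).map v).prod *
          φ (annihPts (labelledUnion splitCreate (τ : Multiset (ℝ × Bool)) ρ)) :=
      ((measurable_multiset_prod_map hv).comp hmτ).mul ((hφ.comp measurable_annihPts).comp hmτ)
    have m3 : Measurable fun ρ : List (ℝ × Bool) =>
        ((labelledUnion splitCreate (τ : Multiset (ℝ × Bool)) ρ).map u).prod *
          (((labelledUnion splitCreate (τ : Multiset (ℝ × Bool)) ρ).map v).prod *
            φ (annihPts (labelledUnion splitCreate (τ : Multiset (ℝ × Bool)) ρ))) := m1.mul m2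
    have h1 : ∫⁻ ρ : List (ℝ × Bool), ‖κ (labelledUnion splitCreate τ ρ)‖ₑ *
        φ (annihPts (labelledUnion splitCreate τ ρ)) ∂binaryMeasure I ≤
        b * ∫⁻ ρ : List (ℝ × Bool), ((labelledUnion splitCreate τ ρ).map u).prod *
          (((labelledUnion splitCreate τ ρ).map v).prod *
            φ (annihPts (labelledUnion splitCreate τ ρ))) ∂binaryMeasure I := by
      rw [← lintegral_const_mul _ m3]
      refine lintegral_mono fun ρ => ?_
      rw [← mul_assoc, ← mul_assoc]
      gcongr
      refine (hb _).trans (le_of_eq ?_)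
      rw [mul_assoc, ← Multiset.prod_map_mul]
      simp only [huv]
    calc _ ≤ (b * ∫⁻ ρ : List (ℝ × Bool), ((labelledUnion splitCreate τ ρ).map u).prod *
          (((labelledUnion splitCreate τ ρ).map v).prod *
            φ (annihPts (labelledUnion splitCreate τ ρ))) ∂binaryMeasure I) ^ 2 := by gcongr
      _ ≤ (b : ℝ≥0∞) ^ 2 * ((∫⁻ ρ : List (ℝ × Bool),
            ((labelledUnion splitCreate τ ρ).map u).prod ^ 2 ∂binaryMeasure I) *
          ∫⁻ ρ : List (ℝ × Bool), (((labelledUnion splitCreate τ ρ).map v).prod *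
            φ (annihPts (labelledUnion splitCreate τ ρ))) ^ 2 ∂binaryMeasure I) := by
        rw [mul_pow]
        gcongr
        exact sq_lintegral_mul_le m1 m2
      _ = _ := by
        rw [← mul_assoc]
        congr 1
        · congr 1
          refine lintegral_congr fun ρ => ?_
          rw [prod_map_labelledUnion]
          have : ∀ p : ℝ × Bool, u (p.1, splitCreate (Sum.inl p.2)) = 1 := fun p => rfl
          simp only [this, Multiset.map_const', Multiset.prod_replicate, one_pow, one_mul,
            ← Multiset.prod_map_pow]
          rfl
        · refine lintegral_congr fun ρ => ?_
          simp only [K]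
          rw [mul_pow, Multiset.prod_map_pow]
  have hKA : Measurable fun τ : List (ℝ × Bool) =>
      ∫⁻ ρ : List (ℝ × Bool), K (labelledUnion splitCreate τ ρ) ∂binaryMeasure I :=
    (hK.comp hmu).lintegral_prod_right'
  have hJm : Measurable fun τ : List (ℝ × Bool) => ∫⁻ ρ : List (ℝ × Bool),
      ‖κ (labelledUnion splitCreate τ ρ)‖ₑ * φ (annihPts (labelledUnion splitCreate τ ρ))
        ∂binaryMeasure I :=
    ((hκ.measurable.enorm.mul (hφ.comp measurable_annihPts)).comp hmu).lintegral_prod_right'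
  have hpow : ∀ d : ℝ≥0∞, Measurable fun m : Multiset ℝ => d ^ m.card := fun d =>
    (measurable_of_countable fun n : ℕ => d ^ n).comp measurable_multiset_card
  have step1 : ∀ l : List ℝ, (c : ℝ≥0∞) ^ (l : Multiset ℝ).card * absApply I κ φ l ^ 2 ≤
      ((b : ℝ≥0∞) ^ 2 * E) * colorSum (fun τ : List (ℝ × Bool) =>
        (2 * (c : ℝ≥0∞)) ^ τ.length * ∫⁻ ρ : List (ℝ × Bool), K (labelledUnion splitCreate τ ρ)
          ∂binaryMeasure I) l := by
    intro l
    have h2 : absApply I κ φ l ^ 2 ≤ 2 ^ l.length * (((b : ℝ≥0∞) ^ 2 * E) *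
        colorSum (fun τ : List (ℝ × Bool) => ∫⁻ ρ : List (ℝ × Bool),
          K (labelledUnion splitCreate τ ρ) ∂binaryMeasure I) l) := by
      refine (sq_colorSum_le hJm l).trans ?_
      rw [← colorSum_const_mul (_ * E)]
      simp only [Fintype.card_bool, Nat.cast_ofNat]
      exact mul_le_mul' le_rfl (colorSum_mono hJ l)
    have h3 := colorSum_weight (fun τ : List (ℝ × Bool) => ∫⁻ ρ : List (ℝ × Bool),
          K (labelledUnion splitCreate τ ρ) ∂binaryMeasure I)
          (fun l : List ℝ => (2 * (c : ℝ≥0∞)) ^ l.length) l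
    simp only [List.length_map] at h3
    rw [← h3, mul_pow]
    refine (mul_le_mul_right h2 _).trans (le_of_eq ?_)
    rw [Multiset.coe_card]
    ring
  refine (lintegral_mono step1).trans_lt ?_
  have hKw : Measurable fun τ : List (ℝ × Bool) => (2 * (c : ℝ≥0∞)) ^ τ.length *
      ∫⁻ ρ : List (ℝ × Bool), K (labelledUnion splitCreate τ ρ) ∂binaryMeasure I :=
    ((measurable_of_countable fun n : ℕ => (2 * (c : ℝ≥0∞)) ^ n).comp measurable_list_length).mul hKA
  rw [lintegral_const_mul _ (measurable_colorSum hKw), ← lintegral_poisson_colorSum _ hKw]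
  refine ENNReal.mul_lt_top (ENNReal.mul_lt_top (by simp) hE) ?_
  -- reassemble the configuration
  let K' : Multiset (ℝ × Kind) → ℝ≥0∞ := fun ω => (ω.map w).prod * φ (annihPts ω) ^ 2
  have hK' : Measurable K' :=
    (measurable_multiset_prod_map hw).mul ((hφ.comp measurable_annihPts).pow_const 2)
  have step2 : ∫⁻ τ : List (ℝ × Bool), (2 * (c : ℝ≥0∞)) ^ τ.length *
      ∫⁻ ρ : List (ℝ × Bool), K (labelledUnion splitCreate τ ρ) ∂binaryMeasure I
        ∂binaryMeasure I = ∫⁻ ω : List (ℝ × Kind), K' ω ∂kindMeasure I := by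
    rw [lintegral_poisson_labelled _ splitCreate hK']
    refine lintegral_congr fun τ => ?_
    rw [← lintegral_const_mul _ ((hK.fun_comp hmu).fun_comp measurable_prodMk_left)]
    refine lintegral_congr fun ρ => ?_
    simp only [K, K']
    rw [← mul_assoc]
    congr 1
    rw [prod_map_labelledUnion, prod_map_labelledUnion, ← mul_assoc]
    congr 1
    · rw [← Multiset.coe_card, ← prod_map_const, ← Multiset.prod_map_mul]
      rfl
    · congr 2
      funext p
      simp [w, splitCreate]
  -- The same configuration is now split by annihilation. The points outside the argument of φ have
  -- kinds L and Q only, and their total weight is an exponential with finite exponent.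
  rw [step2, lintegral_poisson_labelled _ splitAnnih hK']
  have hw' : Measurable fun p : ℝ × Bool => w (p.1, (p.2, false)) := 
    hw.fun_comp (f := fun p : ℝ × Bool => (p.1, (p.2, false))) (by fun_prop)
  have hfin : ∫⁻ α : List (ℝ × Bool), ((α : Multiset (ℝ × Bool)).map fun p =>
      w (p.1, (p.2, false))).prod ∂binaryMeasure I < ∞ := by
    refine lintegral_poisson_prod_lt_top _ hw' ?_
    rw [lintegral_labelled_bool hw']
    refine (ENNReal.add_lt_top.2 ⟨?_, ?_⟩).ne
    · have : ∀ x, w (x, (true, false)) = 2 * c * m (x, (true, false)) ^ 2 := fun x => rfl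
      simp only [this]
      rw [lintegral_const_mul _ ((hmk _).pow_const 2)]
      exact ENNReal.mul_lt_top (ENNReal.mul_lt_top (by simp) (by simp)) hm.L_lt
    · have : ∀ x, w (x, (false, false)) = m (x, (false, false)) := fun x => by
        simp only [w, v, cond_false, one_mul, sq]
        exact hhalf _
      simp only [this]
      exact hm.Q_lt
  -- A common bound for the weights of the annihilating kinds: 1 for R and at most 2ct² for T.
  let d : NNReal := 1 + 2 * c * t ^ 2
  have hwd : ∀ (x : ℝ) (a : Bool), w (x, (a, true)) ≤ d := by
    rintro x (_ | _)
    · simp [w, v, d]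
    · have : w (x, (true, true)) = 2 * c * m (x, (true, true)) ^ 2 := rfl
      rw [this]
      have : (d : ℝ≥0∞) = 1 + 2 * c * t ^ 2 := by simp [d]
      rw [this]
      refine le_add_left ?_
      gcongr
      exact ht x
  have hbound : ∀ α τ : List (ℝ × Bool), K' (labelledUnion splitAnnih α τ) ≤
      ((α : Multiset (ℝ × Bool)).map fun p => w (p.1, (p.2, false))).prod *
        ((d : ℝ≥0∞) ^ ((τ : Multiset (ℝ × Bool)).map Prod.fst).card *
          φ ((τ : Multiset (ℝ × Bool)).map Prod.fst) ^ 2) := by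
    intro α τ
    simp only [K']
    rw [prod_map_labelledUnion, annihPts_union, mul_assoc]
    refine mul_le_mul' le_rfl (mul_le_mul' ?_ le_rfl)
    rw [Multiset.card_map, ← prod_map_const]
    exact Multiset.prod_map_le_prod_map _ _ fun p _ => hwd _ _
  have hφd : Measurable fun l : Multiset ℝ => (d : ℝ≥0∞) ^ l.card * φ l ^ 2 :=
    (hpow _).mul (hφ.pow_const 2)
  have hφτ : Measurable fun τ : List (ℝ × Bool) =>
      (d : ℝ≥0∞) ^ ((τ : Multiset (ℝ × Bool)).map Prod.fst).card *
        φ ((τ : Multiset (ℝ × Bool)).map Prod.fst) ^ 2 :=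
    hφd.fun_comp ((measurable_multiset_map measurable_fst).fun_comp measurable_coe_multiset)
  refine (lintegral_mono fun α => lintegral_mono fun τ => hbound α τ).trans_lt ?_
  simp_rw [lintegral_const_mul _ hφτ]
  rw [lintegral_mul_const _ (measurable_multiset_iff.1 (measurable_multiset_prod_map hw')),
    lintegral_binary_fst hφd]
  refine ENNReal.mul_lt_top hfin ?_
  -- The base is d from the weight of each annihilating point, times 2 for its choice between R and
  -- T. Every exponential moment of φ is finite, so this loss is harmless.
  have := hφ2 (2 * d)
  simpa [mul_pow, mul_assoc] using this

end Kernels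

/-! ### Sesquilinear forms of kernels and the operators they define -/

section Forms

variable {I : Set ℝ}

/-- Fubini along `splitCreate`: the creating points are the argument of G, and the other points are
integrated out inside `absApply`. -/
theorem lintegral_kind_eq_absApply {κ : Multiset (ℝ × Kind) → ℂ} (hκ : Measurable κ)
    {G φ : Multiset ℝ → ℝ≥0∞} (hG : Measurable G) (hφ : Measurable φ) :
    ∫⁻ ω : List (ℝ × Kind), ‖κ ω‖ₑ * (G (createPts ω) * φ (annihPts ω)) ∂kindMeasure I =
      ∫⁻ l : List ℝ, G l * absApply I κ φ l ∂poisson (baseMeasure I) := by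
  have hF : Measurable fun ω => ‖κ ω‖ₑ * (G (createPts ω) * φ (annihPts ω)) :=
    hκ.enorm.mul ((hG.comp measurable_createPts).mul (hφ.comp measurable_annihPts))
  have hJ : Measurable fun ω => ‖κ ω‖ₑ * φ (annihPts ω) :=
    hκ.enorm.mul (hφ.comp measurable_annihPts)
  have hmu := measurable_labelledUnion (X := ℝ) splitCreate
  rw [lintegral_poisson_labelled _ splitCreate hF,
    lintegral_poisson_colorSum _ (hF.fun_comp hmu).lintegral_prod_right']
  refine lintegral_congr fun l => ?_
  rw [absApply, multisetColorSum_coe, colorSum_weight _ fun l : List ℝ => G l]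
  refine colorSum_congr fun τ _ => ?_
  rw [← lintegral_const_mul _ ((hJ.fun_comp hmu).fun_comp measurable_prodMk_left)]
  refine lintegral_congr fun ρ => ?_
  rw [createPts_union, Multiset.map_coe]
  ring

/-- Cauchy–Schwarz pairs G with `absApply I κ φ`. Only square integrability is asked of G, which
lets g range over the whole Fock space. -/
theorem lintegral_kind_lt_top {κ : Multiset (ℝ × Kind) → ℂ} (hκ : IsKernel I κ)
    {G φ : Multiset ℝ → ℝ≥0∞} (hG : Measurable G) (hφ : Measurable φ)
    (hG2 : ∫⁻ l : List ℝ, G l ^ 2 ∂poisson (baseMeasure I) < ∞) (hφ2 : ExpMoments I φ) :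
    ∫⁻ ω : List (ℝ × Kind), ‖κ ω‖ₑ * (G (createPts ω) * φ (annihPts ω)) ∂kindMeasure I < ∞ := by
  rw [lintegral_kind_eq_absApply hκ.measurable hG hφ]
  have h := sq_lintegral_mul_le (μ := poisson (baseMeasure I)) (measurable_multiset_iff.1 hG)
    (measurable_multiset_iff.1 (measurable_absApply (I := I) hκ.measurable hφ))
  have h1 := expMoments_absApply hκ hφ hφ2 1
  simp only [ENNReal.coe_one, one_pow, one_mul] at h1
  have h2 := h.trans_lt (ENNReal.mul_lt_top hG2 h1)
  by_contra hc
  rw [not_lt, top_le_iff] at hc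
  rw [hc] at h2
  simp at h2

theorem integrable_kind {κ : Multiset (ℝ × Kind) → ℂ} (hκ : IsKernel I κ)
    {G φ : Multiset ℝ → ℂ} (hG : Measurable G) (hφ : Measurable φ)
    (hG2 : ∫⁻ l : List ℝ, ‖G l‖ₑ ^ 2 ∂poisson (baseMeasure I) < ∞)
    (hφ2 : ExpMoments I fun m => ‖φ m‖ₑ) :
    Integrable (fun ω : List (ℝ × Kind) => κ ω * (conj (G (createPts ω)) * φ (annihPts ω)))
      (kindMeasure I) := by
  have hF : Measurable fun ω => κ ω * (conj (G (createPts ω)) * φ (annihPts ω)) :=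
    hκ.measurable.mul ((Complex.continuous_conj.measurable.comp
      (hG.comp measurable_createPts)).mul (hφ.comp measurable_annihPts))
  refine ⟨(measurable_multiset_iff.1 hF).aestronglyMeasurable, ?_⟩
  rw [hasFiniteIntegral_iff_enorm]
  have h := lintegral_kind_lt_top hκ hG.enorm hφ.enorm hG2 hφ2
  simpa only [enorm_mul, RCLike.enorm_conj] using h

theorem integral_kind_eq_kernelApply {κ : Multiset (ℝ × Kind) → ℂ} (hκ : IsKernel I κ)
    {G φ : Multiset ℝ → ℂ} (hG : Measurable G) (hφ : Measurable φ)
    (hG2 : ∫⁻ l : List ℝ, ‖G l‖ₑ ^ 2 ∂poisson (baseMeasure I) < ∞)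
    (hφ2 : ExpMoments I fun m => ‖φ m‖ₑ) :
    ∫ ω : List (ℝ × Kind), κ ω * (conj (G (createPts ω)) * φ (annihPts ω)) ∂kindMeasure I =
      ∫ l : List ℝ, conj (G l) * kernelApply I κ φ l ∂poisson (baseMeasure I) := by
  have hF : Measurable fun ω => κ ω * (conj (G (createPts ω)) * φ (annihPts ω)) :=
    hκ.measurable.mul ((Complex.continuous_conj.measurable.comp
      (hG.comp measurable_createPts)).mul (hφ.comp measurable_annihPts))
  have hmu := measurable_labelledUnion (X := ℝ) splitCreate
  have hi := (integrable_poisson_labelled_iff _ splitCreate hF).1 (integrable_kind hκ hG hφ hG2 hφ2)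
  rw [integral_poisson_labelled _ splitCreate hF, integral_prod _ hi,
    integral_poisson_colorSum _ (hF.fun_comp hmu).stronglyMeasurable.integral_prod_right'.measurable
      hi.integral_prod_left]
  refine integral_congr_ae (Filter.Eventually.of_forall fun l => ?_)
  simp only [kernelApply, multisetColorSum_coe]
  rw [← colorSum_const_mul]
  refine colorSum_congr fun τ hτ => ?_
  rw [← integral_const_mul]
  refine integral_congr_ae (Filter.Eventually.of_forall fun ρ => ?_)
  simp only [createPts_union, Multiset.map_coe, hτ]
  ring

/-- A null set of configurations is still null for the annihilated points. -/
theorem ae_annihPts {p : Multiset ℝ → Prop} (hp : MeasurableSet {m | p m})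
    (h : ∀ᵐ l : List ℝ ∂poisson (baseMeasure I), p l) :
    ∀ᵐ ω : List (ℝ × Kind) ∂kindMeasure I, p (annihPts ω) := by
  have hN : MeasurableSet {m | p m}ᶜ := hp.compl
  have hi : Measurable ({m | p m}ᶜ.indicator fun _ : Multiset ℝ => (1 : ℝ≥0∞)) :=
    measurable_const.indicator hN
  have h0 : ∫⁻ ω : List (ℝ × Kind), ({m | p m}ᶜ.indicator fun _ => (1 : ℝ≥0∞)) (annihPts ω)
      ∂kindMeasure I = 0 := by
    -- For each fixed configuration of the other points, the unlabelled annihilating points have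
    -- density 2^card with respect to `poisson`, so a null set stays null.
    rw [lintegral_poisson_labelled _ splitAnnih (hi.fun_comp measurable_annihPts)]
    simp only [annihPts_union]
    rw [lintegral_binary_fst hi]
    have : ∫⁻ l : List ℝ, 2 ^ (l : Multiset ℝ).card *
        ({m | p m}ᶜ.indicator fun _ => (1 : ℝ≥0∞)) (l : Multiset ℝ) ∂poisson (baseMeasure I) = 0 := by
      rw [← lintegral_zero (μ := poisson (baseMeasure I))]
      refine lintegral_congr_ae ?_
      filter_upwards [h] with l hl
      simp [hl]
    simp only [this, lintegral_zero]
  rw [lintegral_eq_zero_iff (measurable_multiset_iff.1 (hi.fun_comp measurable_annihPts))] at h0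
  filter_upwards [h0] with ω hω
  by_contra hc
  simp [hc] at hω

theorem expMoments_hat (f : expDomain I) : ExpMoments I fun m => ‖hat (f : Fock I) m‖ₑ :=
  lintegral_hat_lt_top f

/-- The sesquilinear form of a kernel. -/
def kernelForm (I : Set ℝ) (κ : Multiset (ℝ × Kind) → ℂ) (g f : Fock I) : ℂ :=
  ∫ ω : List (ℝ × Kind), κ ω * (conj (hat g (createPts ω)) * hat f (annihPts ω)) ∂kindMeasure I

theorem integrable_kernelForm {κ : Multiset (ℝ × Kind) → ℂ} (hκ : IsKernel I κ) (g : Fock I)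
    (f : expDomain I) :
    Integrable (fun ω : List (ℝ × Kind) =>
      κ ω * (conj (hat g (createPts ω)) * hat (f : Fock I) (annihPts ω))) (kindMeasure I) :=
  integrable_kind hκ (measurable_hat g) (measurable_hat _) (lintegral_hat_sq_lt_top g)
    (expMoments_hat f)

theorem expMoments_kernelApply {κ : Multiset (ℝ × Kind) → ℂ} (hκ : IsKernel I κ)
    {φ : Multiset ℝ → ℂ} (hφ : Measurable φ) (hφ2 : ExpMoments I fun m => ‖φ m‖ₑ) :
    ExpMoments I fun m => ‖kernelApply I κ φ m‖ₑ := by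
  intro c
  refine lt_of_le_of_lt (lintegral_mono fun l => ?_) (expMoments_absApply hκ hφ.enorm hφ2 c)
  gcongr
  exact enorm_kernelApply_le κ φ l

/-- The vector obtained from `f` by the action of a kernel. -/
theorem exists_kernel_vector {κ : Multiset (ℝ × Kind) → ℂ} (hκ : IsKernel I κ)
    (f : expDomain I) :
    ∃ h : expDomain I, (∀ᵐ l : List ℝ ∂poisson (baseMeasure I),
        hat (h : Fock I) l = kernelApply I κ (hat (f : Fock I)) l) ∧
      ∀ g : Fock I, ⟪g, (h : Fock I)⟫_ℂ = kernelForm I κ g f := by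
  have hm := measurable_kernelApply (I := I) hκ.measurable (measurable_hat (f : Fock I))
  obtain ⟨h, hh⟩ := exists_hat_eq hm
    (expMoments_kernelApply hκ (measurable_hat (f : Fock I)) (expMoments_hat f))
  refine ⟨h, hh, fun g => ?_⟩
  rw [inner_eq_integral_hat, kernelForm, integral_kind_eq_kernelApply hκ (measurable_hat g)
    (measurable_hat _) (lintegral_hat_sq_lt_top g) (expMoments_hat f)]
  refine integral_congr_ae ?_
  filter_upwards [hh] with l hl
  rw [hl]

theorem ae_hat_of_ae_wave {f₁ f₂ f₃ : Fock I} {a b : ℂ} (h : f₃ = a • f₁ + b • f₂) :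
    ∀ᵐ l : List ℝ ∂poisson (baseMeasure I), hat f₃ l = a * hat f₁ l + b * hat f₂ l := by
  have hm : ∀ f : Fock I, Measurable fun l : List ℝ => hat f l := fun f =>
    measurable_multiset_iff.1 (measurable_hat f)
  refine (ae_poisson_iff (measurableSet_eq_fun (hm _)
    (((hm _).const_mul _).add ((hm _).const_mul _)))).2 fun n => ?_
  have h1 : (f₃ n : Lp ℂ 2 (configMeasure I n)) =
      a • (f₁ n : Lp ℂ 2 (configMeasure I n)) + b • (f₂ n : Lp ℂ 2 (configMeasure I n)) := by
    rw [h]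
    rfl
  filter_upwards [ae_hat_ofFn f₁ n, ae_hat_ofFn f₂ n, ae_hat_ofFn f₃ n,
    Lp.coeFn_add (a • (f₁ n : Lp ℂ 2 (configMeasure I n))) (b • (f₂ n : Lp ℂ 2 (configMeasure I n))),
    Lp.coeFn_smul a (f₁ n : Lp ℂ 2 (configMeasure I n)),
    Lp.coeFn_smul b (f₂ n : Lp ℂ 2 (configMeasure I n))] with x e1 e2 e3 e4 e5 e6
  have e7 : wave f₃ n x = a * wave f₁ n x + b * wave f₂ n x := by
    simp only [wave]
    rw [h1, e4, Pi.add_apply, e5, e6]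
    rfl
  simp only [Pi.add_apply, e1, e2, e3, e7]
  ring

/-- `hat` is linear only almost everywhere, since representatives are chosen; `ae_annihPts` carries
the exceptional set over to labelled configurations. -/
theorem kernelForm_linear {κ : Multiset (ℝ × Kind) → ℂ} (hκ : IsKernel I κ) (g : Fock I)
    (f₁ f₂ : expDomain I) (a b : ℂ) :
    kernelForm I κ g ((a • f₁ + b • f₂ : expDomain I) : Fock I) =
      a * kernelForm I κ g f₁ + b * kernelForm I κ g f₂ := by
  have hm : ∀ f : Fock I, Measurable (hat f) := measurable_hat
  have h1 := ae_annihPts (measurableSet_eq_fun (hm ((a • f₁ + b • f₂ : expDomain I) : Fock I))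
    (((hm (f₁ : Fock I)).const_mul a).add ((hm (f₂ : Fock I)).const_mul b)))
    (ae_hat_of_ae_wave (a := a) (b := b) (f₁ := (f₁ : Fock I)) (f₂ := (f₂ : Fock I)) rfl)
  simp only [kernelForm]
  rw [← integral_const_mul, ← integral_const_mul, ← integral_add
    ((integrable_kernelForm hκ g f₁).const_mul a) ((integrable_kernelForm hκ g f₂).const_mul b)]
  refine integral_congr_ae ?_
  filter_upwards [h1] with ω hω
  simp only [hω, Pi.add_apply]
  ring

/-- The operator of a kernel. -/
theorem exists_kernel_operator {κ : Multiset (ℝ × Kind) → ℂ} (hκ : IsKernel I κ) :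
    ∃ O : expDomain I →ₗ[ℂ] expDomain I, ∀ (g : Fock I) (f : expDomain I),
      ⟪g, (O f : Fock I)⟫_ℂ = kernelForm I κ g f := by
  choose O hO using fun f => exists_kernel_vector hκ f
  have key : ∀ (f₁ f₂ : expDomain I) (a b : ℂ), O (a • f₁ + b • f₂) = a • O f₁ + b • O f₂ := by
    intro f₁ f₂ a b
    refine Subtype.ext (ext_inner_left ℂ fun g => ?_)
    rw [(hO _).2 g, kernelForm_linear hκ]
    push_cast
    rw [inner_add_right, inner_smul_right, inner_smul_right, (hO _).2 g, (hO _).2 g]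
  refine ⟨{ toFun := O, map_add' := fun f₁ f₂ => ?_, map_smul' := fun a f => ?_ },
    fun g f => (hO f).2 g⟩
  · simpa using key f₁ f₂ 1 1
  · simpa using key f 0 a 0

/-- The wave functions of the image of `f` under the operator of a kernel. -/
theorem ae_hat_eq_kernelApply {κ : Multiset (ℝ × Kind) → ℂ} (hκ : IsKernel I κ)
    {f h : expDomain I} (hf : ∀ g : Fock I, ⟪g, (h : Fock I)⟫_ℂ = kernelForm I κ g f) :
    ∀ᵐ l : List ℝ ∂poisson (baseMeasure I),
      hat (h : Fock I) l = kernelApply I κ (hat (f : Fock I)) l := by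
  obtain ⟨h', h1, h2⟩ := exists_kernel_vector hκ f
  have : h = h' := Subtype.ext (ext_inner_left ℂ fun g => by rw [hf, h2])
  rw [this]
  exact h1

end Forms

/-! ### The kernel of admissible tensors -/

section TensorKernel

variable {I : Set ℝ} {ι : Type} [Fintype ι] [DecidableEq ι]

/-- An order of labelled points that refines the order of the points. -/
def pointLe (p q : ℝ × Kind) : Prop :=
  -- The two bits are read as a number from 0 to 3. This breaks ties, making the order
  -- antisymmetric, so that a multiset has one sorted list.
  p.1 < q.1 ∨ p.1 = q.1 ∧ 2 * p.2.1.toNat + p.2.2.toNat ≤ 2 * q.2.1.toNat + q.2.2.toNat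

instance instDecidableRelPointLe : DecidableRel pointLe := fun _ _ => Classical.propDecidable _

instance instIsTransPointLe : IsTrans (ℝ × Kind) pointLe where
  trans p q r h1 h2 := by
    rcases h1 with h1 | ⟨h1, h1'⟩ <;> rcases h2 with h2 | ⟨h2, h2'⟩
    · exact Or.inl (h1.trans h2)
    · exact Or.inl (h2 ▸ h1)
    · exact Or.inl (h1 ▸ h2)
    · exact Or.inr ⟨h1.trans h2, h1'.trans h2'⟩

instance instAntisymmPointLe : Std.Antisymm pointLe where
  antisymm p q h1 h2 := by
    obtain ⟨x, a, b⟩ := p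
    obtain ⟨y, c, d⟩ := q
    rcases h1 with h1 | ⟨h1, h1'⟩ <;> rcases h2 with h2 | ⟨h2, h2'⟩ <;> simp only at *
    · exact absurd h1 h2.not_gt
    · exact absurd h2.symm h1.ne
    · exact absurd h1.symm h2.ne
    · subst h1
      cases a <;> cases b <;> cases c <;> cases d <;> simp_all

instance instTotalPointLe : Std.Total pointLe where
  total p q := by
    rcases lt_trichotomy p.1 q.1 with h | h | h
    · exact Or.inl (Or.inl h)
    · exact (Nat.le_total (2 * p.2.1.toNat + p.2.2.toNat) (2 * q.2.1.toNat + q.2.2.toNat)).imp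
        (fun h' => Or.inr ⟨h, h'⟩) fun h' => Or.inr ⟨h.symm, h'⟩
    · exact Or.inr (Or.inl h)

theorem measurableSet_pointLe : MeasurableSet {p : (ℝ × Kind) × (ℝ × Kind) | pointLe p.1 p.2} := by
  have h1 : MeasurableSet {p : (ℝ × Kind) × (ℝ × Kind) | p.1.1 < p.2.1} :=
    measurableSet_lt (by fun_prop) (by fun_prop)
  have h2 : MeasurableSet {p : (ℝ × Kind) × (ℝ × Kind) | p.1.1 = p.2.1} :=
    measurableSet_eq_fun (by fun_prop) (by fun_prop)
  have hc : Measurable fun k : Kind => 2 * k.1.toNat + k.2.toNat := measurable_of_finite _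
  have h3 : MeasurableSet {p : (ℝ × Kind) × (ℝ × Kind) |
      2 * p.1.2.1.toNat + p.1.2.2.toNat ≤ 2 * p.2.2.1.toNat + p.2.2.2.toNat} :=
    measurableSet_le (hc.comp (measurable_snd.comp measurable_fst))
      (hc.comp (measurable_snd.comp measurable_snd))
  exact h1.union (h2.inter h3)

/-- The coefficient of a point of a given kind. -/
def Tensors.coeff (A : Tensors ι) (p : ℝ × Kind) : Matrix ι ι ℂ :=
  match p.2 with
  | (false, false) => A.Q p.1
  | (true, false) => A.L p.1
  | (false, true) => A.R p.1
  | (true, true) => A.T p.1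

/-- The sum of the absolute values of the entries. -/
def matSize (M : Matrix ι ι ℂ) : ℝ≥0∞ := ∑ i, ∑ j, ‖M i j‖ₑ

theorem matSize_mul (M N : Matrix ι ι ℂ) : matSize (M * N) ≤ matSize M * matSize N := by
  have h : ∀ i k, ‖(M * N) i k‖ₑ ≤ ∑ j, ‖M i j‖ₑ * ‖N j k‖ₑ := fun i k => by
    rw [Matrix.mul_apply]
    refine (enorm_sum_le _ _).trans (le_of_eq ?_)
    simp only [enorm_mul]
  have hN : ∀ j, ∑ k, ‖N j k‖ₑ ≤ matSize N := fun j =>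
    Finset.single_le_sum (f := fun j => ∑ k, ‖N j k‖ₑ) (fun _ _ => zero_le) (Finset.mem_univ j)
  calc matSize (M * N) ≤ ∑ i, ∑ k, ∑ j, ‖M i j‖ₑ * ‖N j k‖ₑ :=
        Finset.sum_le_sum fun i _ => Finset.sum_le_sum fun k _ => h i k
    _ = ∑ i, ∑ j, ‖M i j‖ₑ * ∑ k, ‖N j k‖ₑ := by
        refine Finset.sum_congr rfl fun i _ => ?_
        rw [Finset.sum_comm]
        simp only [Finset.mul_sum]
    _ ≤ ∑ i, ∑ j, ‖M i j‖ₑ * matSize N := by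
        gcongr
        exact hN _
    _ = matSize M * matSize N := by simp only [matSize, Finset.sum_mul]

theorem enorm_trace_le (M : Matrix ι ι ℂ) : ‖M.trace‖ₑ ≤ matSize M := by
  refine (enorm_sum_le _ _).trans (Finset.sum_le_sum fun i _ => ?_)
  exact Finset.single_le_sum (f := fun j => ‖M i j‖ₑ) (fun _ _ => zero_le) (Finset.mem_univ i)

theorem matSize_ne_top (M : Matrix ι ι ℂ) : matSize M ≠ ∞ := by
  simp [matSize, ENNReal.sum_eq_top]

theorem matSize_list_prod {X : Type*} (c : X → Matrix ι ι ℂ) (l : List X) :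
    matSize (l.map c).prod ≤ matSize (1 : Matrix ι ι ℂ) * (l.map fun p => matSize (c p)).prod := by
  induction l with
  | nil => simp
  | cons p l ih =>
    simp only [List.map_cons, List.prod_cons]
    refine (matSize_mul _ _).trans ((mul_le_mul_right ih _).trans (le_of_eq ?_))
    ring

/-- Tensors with measurable entries and an everywhere bounded `T`. -/
structure Tensors.Regular (I : Set ℝ) (A : Tensors ι) : Prop where
  measurable : ∀ k i j, Measurable fun x => A.coeff (x, k) i j
  majorant : Majorant I fun p => matSize (A.coeff p)

/-- The coefficient of a configuration: `Tr (B M(x₁) ⋯ M(x_n))` in the order of the points. -/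
def Tensors.kernel (A : Tensors ι) (ω : Multiset (ℝ × Kind)) : ℂ :=
  (A.B * ((ω.sort pointLe).map A.coeff).prod).trace

theorem Tensors.kernel_of_pairwise (A : Tensors ι) {t : List (ℝ × Kind)}
    (ht : t.Pairwise fun p q => p.1 < q.1) : A.kernel t = (A.B * (t.map A.coeff).prod).trace := by
  unfold Tensors.kernel
  have h : (t : Multiset (ℝ × Kind)).sort pointLe = t :=
    (Multiset.coe_eq_coe.1 (Multiset.sort_eq (t : Multiset (ℝ × Kind)) pointLe)).eq_of_pairwise'
      (r := pointLe) (Multiset.pairwise_sort _ _) (ht.imp fun h => Or.inl h)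
  rw [h]

/-- The entrywise size is submultiplicative. After passing to sizes the factors commute, so the
order of the points disappears from the bound. -/
theorem Tensors.Regular.isKernel {A : Tensors ι} (hA : A.Regular I) : IsKernel I A.kernel where
  measurable := by
    have hc : ∀ i j, Measurable fun p : ℝ × Kind => A.coeff p i j := fun i j =>
      measurable_from_prod_countable_left fun k => hA.measurable k i j
    have h1 : Measurable fun l : List (ℝ × Kind) => fun i j => (l.map A.coeff).prod i j := by
      refine measurable_list_of_step
        (fun q => fun i j => ∑ k, A.coeff q.1 i k * q.2.2 k j) ?_ fun x l => ?_
      · refine measurable_pi_iff.2 fun i => measurable_pi_iff.2 fun j =>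
          Finset.measurable_fun_sum _ fun k _ => ?_
        exact ((hc i k).comp measurable_fst).mul
          ((measurable_pi_apply j).comp ((measurable_pi_apply k).comp
            (measurable_snd.comp measurable_snd)))
      · funext i j
        simp [Matrix.mul_apply]
    have h2 : Measurable fun l : List (ℝ × Kind) => (A.B * (l.map A.coeff).prod).trace := by
      simp only [Matrix.trace, Matrix.diag, Matrix.mul_apply]
      refine Finset.measurable_fun_sum _ fun i _ => Finset.measurable_fun_sum _ fun j _ => ?_
      exact ((measurable_pi_apply i).comp ((measurable_pi_apply j).comp h1)).const_mul _
    exact h2.comp (measurable_multiset_sort measurableSet_pointLe)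
  bound := by
    refine ⟨(matSize A.B * matSize (1 : Matrix ι ι ℂ)).toNNReal, _, hA.majorant, fun ω => ?_⟩
    rw [ENNReal.coe_toNNReal (ENNReal.mul_ne_top (matSize_ne_top _) (matSize_ne_top _))]
    refine (enorm_trace_le _).trans ((matSize_mul _ _).trans ?_)
    rw [mul_assoc]
    refine mul_le_mul_right ((matSize_list_prod _ _).trans (le_of_eq ?_)) _
    congr 1
    rw [← Multiset.prod_coe, ← Multiset.map_coe, Multiset.sort_eq]

/-- The value of `ψ(x_n) ⋯ ψ(x₁) φ` on the vacuum. -/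
def vacuumValue : List ℝ → WaveFn → ℂ
  | [], φ => φ 0 Fin.elim0
  | x :: l, φ => vacuumValue l (annih x φ)

/-- The successive factors √(N+1) of the annihilation fields multiply to √(n!), which is the origin
of the normalization of `hat`. -/
theorem vacuumValue_eq_listWave (l : List ℝ) (φ : WaveFn) : vacuumValue l φ = listWave φ l := by
  induction l generalizing φ with
  | nil =>
    simp only [vacuumValue, listWave, List.length_nil, Nat.factorial_zero, Nat.cast_one,
      Real.sqrt_one, Complex.ofReal_one, one_mul]
    congr 1
    exact Subsingleton.elim _ _
  | cons x l ih =>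
    rw [vacuumValue, ih]
    have hget : (x :: l).get = (Fin.cons x l.get : Fin (l.length + 1) → ℝ) := by
      funext i
      refine Fin.cases ?_ (fun j => ?_) i
      · rfl
      · rfl
    have hs : (Real.sqrt ((l.length + 1).factorial) : ℂ) =
        (Real.sqrt l.length.factorial : ℂ) * (Real.sqrt (l.length + 1) : ℂ) := by
      rw [← Complex.ofReal_mul, ← Real.sqrt_mul (by positivity), Nat.factorial_succ]
      push_cast
      rw [mul_comm]
    simp only [listWave, annih, List.length_cons]
    rw [hs, hget, mul_assoc]

/-- The creating points of a list of labelled points. -/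
def createList (t : List (ℝ × Kind)) : List ℝ :=
  (t.filter fun p => decide (p.2.1 = true)).map Prod.fst

/-- The annihilating points of a list of labelled points. -/
def annihList (t : List (ℝ × Kind)) : List ℝ :=
  (t.filter fun p => decide (p.2.2 = true)).map Prod.fst

theorem createPts_coe (t : List (ℝ × Kind)) : createPts t = createList t := rfl

theorem annihPts_coe (t : List (ℝ × Kind)) : annihPts t = annihList t := rfl

/-- Expanding the product of four-term sums chooses a kind for each point. The outermost generator
multiplies from the left and replaces g and f by their annihilated versions, so the induction runs
over all wave functions. -/
theorem foldr_generator (A : Tensors ι) (l : List ℝ) (g f : WaveFn) :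
    l.foldr (generator A) (vacuumProj ι) g f = colorSum (fun t : List (ℝ × Kind) =>
      (conj (vacuumValue (createList t) g) * vacuumValue (annihList t) f) •
        (t.map A.coeff).prod) l := by
  induction l generalizing g f with
  | nil => rfl
  | cons x l ih =>
    have key : ∀ (k : Kind) (g' f' : WaveFn)
        (_ : ∀ t, vacuumValue (createList ((x, k) :: t)) g = vacuumValue (createList t) g')
        (_ : ∀ t, vacuumValue (annihList ((x, k) :: t)) f = vacuumValue (annihList t) f'),
        colorSum (fun t : List (ℝ × Kind) =>
          (conj (vacuumValue (createList ((x, k) :: t)) g) *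
            vacuumValue (annihList ((x, k) :: t)) f) • (((x, k) :: t).map A.coeff).prod) l =
          A.coeff (x, k) * l.foldr (generator A) (vacuumProj ι) g' f' := by
      intro k g' f' h1 h2
      rw [ih, ← colorSum_const_mul]
      refine colorSum_congr fun t _ => ?_
      rw [h1, h2, List.map_cons, List.prod_cons, Matrix.mul_smul]
    simp only [List.foldr_cons, colorSum, Fintype.sum_prod_type, Fintype.sum_bool]
    rw [key (true, true) (annih x g) (annih x f) (fun _ => rfl) fun _ => rfl,
      key (true, false) (annih x g) f (fun _ => rfl) fun _ => rfl,
      key (false, true) g (annih x f) (fun _ => rfl) fun _ => rfl,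
      key (false, false) g f (fun _ => rfl) fun _ => rfl]
    simp only [generator, lMap, rMap, adMap, Tensors.coeff]
    abel

theorem pairwise_createList {t : List (ℝ × Kind)} (ht : t.Pairwise fun p q => p.1 < q.1) :
    (createList t).Pairwise (· < ·) :=
  List.pairwise_map.2 (ht.filter _)

theorem pairwise_annihList {t : List (ℝ × Kind)} (ht : t.Pairwise fun p q => p.1 < q.1) :
    (annihList t).Pairwise (· < ·) :=
  List.pairwise_map.2 (ht.filter _)

/-- The integrand of the form of a kernel. -/
def formIntegrand (A : Tensors ι) (g f : Fock I) (ω : Multiset (ℝ × Kind)) : ℂ :=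
  A.kernel ω * (conj (hat g (createPts ω)) * hat f (annihPts ω))

theorem measurable_formIntegrand {A : Tensors ι} (hA : A.Regular I) (g f : Fock I) :
    Measurable (formIntegrand A g f) :=
  hA.isKernel.measurable.mul ((Complex.continuous_conj.measurable.comp
    ((measurable_hat g).comp measurable_createPts)).mul
      ((measurable_hat f).comp measurable_annihPts))

/-- On the open simplex the points are already sorted, so the sorting in `hat` and in the kernel
does nothing and the equality holds pointwise. -/
theorem dysonIntegrand_eq_colorSum (A : Tensors ι) (g f : Fock I) {n : ℕ} {x : Fin n → ℝ}
    (hx : StrictMono x) :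
    dysonIntegrand A x (wave g) (wave f) =
      multisetColorSum (formIntegrand A g f) (List.ofFn x) := by
  have hl : (List.ofFn x).Pairwise (· < ·) := List.pairwise_ofFn.2 fun i j hij => hx hij
  rw [dysonIntegrand, foldr_generator, multisetColorSum_coe]
  have h := map_colorSum ((Matrix.traceAddMonoidHom ι ℂ).comp (AddMonoidHom.mulLeft A.B))
    (fun t : List (ℝ × Kind) => (conj (vacuumValue (createList t) (wave g)) *
      vacuumValue (annihList t) (wave f)) • (t.map A.coeff).prod) (List.ofFn x)
  refine h.trans (colorSum_congr fun t ht => ?_)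
  have htp : t.Pairwise fun p q => p.1 < q.1 := by
    rw [← ht] at hl
    exact List.pairwise_map.1 hl
  simp only [AddMonoidHom.comp_apply, AddMonoidHom.coe_mulLeft, Matrix.traceAddMonoidHom_apply,
    formIntegrand]
  rw [A.kernel_of_pairwise htp, createPts_coe, annihPts_coe, hat_of_pairwise g
    (pairwise_createList htp), hat_of_pairwise f (pairwise_annihList htp), vacuumValue_eq_listWave,
    vacuumValue_eq_listWave, Matrix.mul_smul, Matrix.trace_smul, smul_eq_mul, mul_comm]

theorem kernelForm_eq_integral_colorSum {A : Tensors ι} (hA : A.Regular I) (g : Fock I)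
    (f : expDomain I) :
    Integrable (fun l : List ℝ => multisetColorSum (formIntegrand A g (f : Fock I)) l)
      (poisson (baseMeasure I)) ∧
    kernelForm I A.kernel g f = ∫ l : List ℝ, multisetColorSum (formIntegrand A g (f : Fock I)) l
      ∂poisson (baseMeasure I) :=
  have hm := measurable_multiset_iff.1 (measurable_formIntegrand hA g (f : Fock I))
  ⟨integrable_poisson_colorSum _ hm (integrable_kernelForm hA.isKernel g f),
    integral_poisson_colorSum _ hm (integrable_kernelForm hA.isKernel g f)⟩

theorem hasSum_dyson_of_regular {A : Tensors ι} (hA : A.Regular I) (g : Fock I)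
    (f : expDomain I) :
    (∀ n : ℕ, IntegrableOn (fun x : Fin n → ℝ => dysonIntegrand A x (wave g) (wave (f : Fock I)))
      {x | StrictMono x} (configMeasure I n)) ∧
    HasSum (fun n : ℕ => ∫ x : Fin n → ℝ in {x | StrictMono x},
      dysonIntegrand A x (wave g) (wave (f : Fock I)) ∂(configMeasure I n))
      (kernelForm I A.kernel g f) := by
  obtain ⟨h1, h2⟩ := kernelForm_eq_integral_colorSum hA g f
  obtain ⟨h3, h4⟩ := hasSum_integral_simplex I
    (measurable_multisetColorSum (measurable_formIntegrand hA g (f : Fock I))) h1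
  refine ⟨fun n => ?_, ?_⟩
  · refine (h3 n).congr_fun (fun x hx => ?_) (measurableSet_strictMono n)
    exact (dysonIntegrand_eq_colorSum A g f hx).symm
  · rw [h2]
    refine h4.congr_fun fun n => ?_
    refine setIntegral_congr_fun (measurableSet_strictMono n) fun x hx => ?_
    exact dysonIntegrand_eq_colorSum A g f hx

end TensorKernel

/-! ### Composition of kernels -/

section Composition

variable {I : Set ℝ}

instance instMeasurableSingletonClassSum {A B : Type*} [MeasurableSpace A] [MeasurableSpace B]
    [MeasurableSingletonClass A] [MeasurableSingletonClass B] :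
    MeasurableSingletonClass (A ⊕ B) where
  measurableSet_singleton s := by
    cases s with
    | inl a => rw [← Set.image_singleton]; exact (measurableSet_singleton a).inl_image
    | inr b => rw [← Set.image_singleton]; exact (measurableSet_singleton b).inr_image

/-- The kinds of the points of a product: a point of the first factor alone, a common point, or
a point of the second factor alone. -/
abbrev PairKind : Type := Bool ⊕ (Kind ⊕ Bool)

/-- The kind of a point of a product in the first factor. -/
def firstKind : PairKind → Option Kind
  | Sum.inl a => some (a, false)
  | Sum.inr (Sum.inl (a, _)) => some (a, true)
  | Sum.inr (Sum.inr _) => none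

/-- The kind of a point of a product in the second factor. -/
def secondKind : PairKind → Option Kind
  | Sum.inl _ => none
  | Sum.inr (Sum.inl (_, b)) => some (true, b)
  | Sum.inr (Sum.inr b) => some (false, b)

/-- The labelled points that a partial change of labels leaves. -/
def filterKind {A B : Type*} (c : A → Option B) (ζ : Multiset (ℝ × A)) : Multiset (ℝ × B) :=
  ζ.filterMap fun p => (c p.2).map fun k => (p.1, k)

theorem measurable_filterKind {A B : Type*} [MeasurableSpace A] [MeasurableSpace B] [Countable A]
    [MeasurableSingletonClass A] (c : A → Option B) : Measurable (filterKind c) := by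
  have h : Measurable fun l : List (ℝ × A) =>
      l.filterMap fun p => (c p.2).map fun k => (p.1, k) := by
    refine measurable_list_of_step (fun q => ((c q.1.2).elim q.2.2 fun k => (q.1.1, k) :: q.2.2))
      ?_ fun x l => ?_
    · have h1 : Measurable fun q : (ℝ × List (ℝ × A) × List (ℝ × B)) × A =>
          (c q.2).elim q.1.2.2 fun k => (q.1.1, k) :: q.1.2.2 := by
        refine measurable_from_prod_countable_left fun a => ?_
        cases hc : c a with
        | none => simp only [hc, Option.elim_none]; fun_prop
        | some k =>
          simp only [hc, Option.elim_some]
          exact measurable_cons (by fun_prop) (by fun_prop)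
      exact h1.fun_comp (f := fun q : (ℝ × A) × List (ℝ × A) × List (ℝ × B) =>
        ((q.1.1, q.2), q.1.2)) (by fun_prop)
    · cases hc : c x.2 <;> simp [hc]
  exact measurable_multiset_iff.2 (measurable_coe_multiset.comp h)

/-- The configurations of a product. -/
abbrev pairUnion (α : Multiset (ℝ × Bool)) (ζ : Multiset (ℝ × (Kind ⊕ Bool))) :
    Multiset (ℝ × PairKind) := labelledUnion (Equiv.refl PairKind) α ζ

/-- The configurations with a point of the second factor. -/
abbrev innerUnion (τ : Multiset (ℝ × Kind)) (ρ : Multiset (ℝ × Bool)) :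
    Multiset (ℝ × (Kind ⊕ Bool)) := labelledUnion (Equiv.refl (Kind ⊕ Bool)) τ ρ

/-- For the first operator the common points τ are exactly the annihilating ones, and their first
bit decides between R₁ and T₁. -/
theorem filterKind_first (α ρ : Multiset (ℝ × Bool)) (τ : Multiset (ℝ × Kind)) :
    filterKind firstKind (pairUnion α (innerUnion τ ρ)) =
      labelledUnion splitAnnih α (τ.map (relabel Prod.fst)) := by
  simp only [filterKind, labelledUnion, Multiset.map_add, Multiset.filterMap_add,
    Multiset.map_map, Multiset.filterMap_map]
  have h1 : ∀ m : Multiset (ℝ × Bool), m.filterMap ((fun p : ℝ × PairKind =>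
      (firstKind p.2).map fun k => (p.1, k)) ∘ relabel fun b => Equiv.refl _ (Sum.inl b)) =
      m.map (relabel fun b => splitAnnih (Sum.inl b)) := fun m => by
    rw [← Multiset.filterMap_eq_map]; rfl
  have h2 : τ.filterMap ((fun p : ℝ × PairKind => (firstKind p.2).map fun k => (p.1, k)) ∘
      ((relabel fun c => Equiv.refl _ (Sum.inr c)) ∘
        relabel fun b => Equiv.refl (Kind ⊕ Bool) (Sum.inl b))) =
      τ.map ((relabel fun c => splitAnnih (Sum.inr c)) ∘ relabel Prod.fst) := by
    rw [← Multiset.filterMap_eq_map]; rfl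
  have h3 : ∀ m : Multiset (ℝ × Bool), m.filterMap ((fun p : ℝ × PairKind =>
      (firstKind p.2).map fun k => (p.1, k)) ∘ ((relabel fun c => Equiv.refl _ (Sum.inr c)) ∘
        relabel fun c => Equiv.refl (Kind ⊕ Bool) (Sum.inr c))) = 0 := fun m => by
    induction m using Multiset.induction with
    | empty => rfl
    | cons p m ih => rw [Multiset.filterMap_cons_none _ _ rfl, ih]
  rw [h1, h2, h3, add_zero]

/-- For the second operator the same points τ are exactly the creating ones, and their second bit
decides between L₂ and T₂. -/
theorem filterKind_second (α ρ : Multiset (ℝ × Bool)) (τ : Multiset (ℝ × Kind)) :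
    filterKind secondKind (pairUnion α (innerUnion τ ρ)) =
      labelledUnion splitCreate (τ.map (relabel Prod.snd)) ρ := by
  simp only [filterKind, labelledUnion, Multiset.map_add, Multiset.filterMap_add,
    Multiset.map_map, Multiset.filterMap_map]
  have h1 : ∀ m : Multiset (ℝ × Bool), m.filterMap ((fun p : ℝ × PairKind =>
      (secondKind p.2).map fun k => (p.1, k)) ∘ relabel fun b => Equiv.refl _ (Sum.inl b)) =
      0 := fun m => by
    induction m using Multiset.induction with
    | empty => rfl
    | cons p m ih => rw [Multiset.filterMap_cons_none _ _ rfl, ih]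
  have h2 : τ.filterMap ((fun p : ℝ × PairKind => (secondKind p.2).map fun k => (p.1, k)) ∘
      ((relabel fun c => Equiv.refl _ (Sum.inr c)) ∘
        relabel fun b => Equiv.refl (Kind ⊕ Bool) (Sum.inl b))) =
      τ.map ((relabel fun c => splitCreate (Sum.inl c)) ∘ relabel Prod.snd) := by
    rw [← Multiset.filterMap_eq_map]; rfl
  have h3 : ∀ m : Multiset (ℝ × Bool), m.filterMap ((fun p : ℝ × PairKind =>
      (secondKind p.2).map fun k => (p.1, k)) ∘ ((relabel fun c => Equiv.refl _ (Sum.inr c)) ∘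
        relabel fun c => Equiv.refl (Kind ⊕ Bool) (Sum.inr c))) =
      m.map (relabel fun c => splitCreate (Sum.inr c)) := fun m => by
    rw [← Multiset.filterMap_eq_map]; rfl
  rw [h1, h2, h3, zero_add]

theorem labelled_kind_eq_map (μ : Measure ℝ) [SFinite μ] :
    labelled μ Kind = (labelled (labelled μ Bool) Bool).map fun p => (p.1.1, (p.1.2, p.2)) := by
  refine Measure.ext_of_lintegral _ fun F hF => ?_
  have hm : Measurable fun p : (ℝ × Bool) × Bool => (p.1.1, (p.1.2, p.2)) := by fun_prop
  have h2 : Measurable fun p : ℝ × Bool => ∑ c, F (p.1, (p.2, c)) :=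
    Finset.measurable_fun_sum _ fun c _ => hF.fun_comp
      (f := fun p : ℝ × Bool => (p.1, (p.2, c))) (by fun_prop)
  rw [lintegral_map hF hm, lintegral_labelled _ hF, lintegral_labelled _ (hF.fun_comp hm),
    lintegral_labelled _ h2]
  simp only [Fintype.sum_prod_type]

theorem poisson_kind_eq_map (μ : Measure ℝ) [SFinite μ] :
    poisson (labelled μ Kind) = (poisson (labelled (labelled μ Bool) Bool)).map
      (List.map fun p => (p.1.1, (p.1.2, p.2))) := by
  rw [labelled_kind_eq_map, poisson_map _ (by fun_prop)]

section

variable {M : Type*} [NonUnitalNonAssocSemiring M]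

theorem colorSum_pair (W J : Multiset (ℝ × Bool) → M) (τ : List (ℝ × Bool)) :
    colorSum (fun t : List ((ℝ × Bool) × Bool) =>
      W (((t.map fun p => (p.1.1, (p.1.2, p.2)) : List (ℝ × Kind)) :
        Multiset (ℝ × Kind)).map (relabel Prod.fst)) *
      J (((t.map fun p => (p.1.1, (p.1.2, p.2)) : List (ℝ × Kind)) :
        Multiset (ℝ × Kind)).map (relabel Prod.snd))) τ =
      W τ * multisetColorSum J ((τ : Multiset (ℝ × Bool)).map Prod.fst) := by
  rw [Multiset.map_coe, multisetColorSum_coe, colorSum_map, ← colorSum_const_mul]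
  refine colorSum_congr fun t ht => ?_
  rw [← ht]
  simp only [Multiset.map_coe, List.map_map]
  rfl

end

theorem measurable_relabel_coe (i : Kind → Bool) {Z : Type*} [MeasurableSpace Z]
    {W : Multiset (ℝ × Bool) → Z} (hW : Measurable W) :
    Measurable fun τ : List (ℝ × Kind) => W ((τ : Multiset (ℝ × Kind)).map (relabel i)) :=
  hW.fun_comp ((measurable_multiset_map (measurable_relabel i)).fun_comp measurable_coe_multiset)

/-- A common point carries two independent bits, one for each operator. Summing over the second bits
with the points and first bits fixed turns J into its sum over labellings. -/
theorem lintegral_kind_pair {W J : Multiset (ℝ × Bool) → ℝ≥0∞} (hW : Measurable W)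
    (hJ : Measurable J) :
    ∫⁻ τ : List (ℝ × Kind), W ((τ : Multiset (ℝ × Kind)).map (relabel Prod.fst)) *
        J ((τ : Multiset (ℝ × Kind)).map (relabel Prod.snd)) ∂kindMeasure I =
      ∫⁻ τ : List (ℝ × Bool), W τ * multisetColorSum J ((τ : Multiset (ℝ × Bool)).map Prod.fst)
        ∂binaryMeasure I := by
  have hm : Measurable fun τ : List (ℝ × Kind) =>
      W ((τ : Multiset (ℝ × Kind)).map (relabel Prod.fst)) *
        J ((τ : Multiset (ℝ × Kind)).map (relabel Prod.snd)) :=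
    (measurable_relabel_coe Prod.fst hW).mul (measurable_relabel_coe Prod.snd hJ)
  have ha : Measurable (List.map fun p : (ℝ × Bool) × Bool => (p.1.1, (p.1.2, p.2))) :=
    measurable_list_map (by fun_prop)
  rw [kindMeasure, poisson_kind_eq_map, lintegral_map hm ha,
    lintegral_poisson_colorSum _ (hm.fun_comp ha)]
  refine lintegral_congr fun τ => ?_
  exact colorSum_pair W J τ

theorem integral_kind_pair {W J : Multiset (ℝ × Bool) → ℂ} (hW : Measurable W)
    (hJ : Measurable J)
    (hi : Integrable (fun τ : List (ℝ × Kind) =>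
      W ((τ : Multiset (ℝ × Kind)).map (relabel Prod.fst)) *
        J ((τ : Multiset (ℝ × Kind)).map (relabel Prod.snd))) (kindMeasure I)) :
    ∫ τ : List (ℝ × Kind), W ((τ : Multiset (ℝ × Kind)).map (relabel Prod.fst)) *
        J ((τ : Multiset (ℝ × Kind)).map (relabel Prod.snd)) ∂kindMeasure I =
      ∫ τ : List (ℝ × Bool), W τ * multisetColorSum J ((τ : Multiset (ℝ × Bool)).map Prod.fst)
        ∂binaryMeasure I := by
  have hm : Measurable fun τ : List (ℝ × Kind) =>
      W ((τ : Multiset (ℝ × Kind)).map (relabel Prod.fst)) *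
        J ((τ : Multiset (ℝ × Kind)).map (relabel Prod.snd)) :=
    (measurable_relabel_coe Prod.fst hW).mul (measurable_relabel_coe Prod.snd hJ)
  have ha : Measurable (List.map fun p : (ℝ × Bool) × Bool => (p.1.1, (p.1.2, p.2))) :=
    measurable_list_map (by fun_prop)
  rw [kindMeasure, poisson_kind_eq_map] at hi ⊢
  have hi' := (integrable_map_measure hm.aestronglyMeasurable ha.aemeasurable).1 hi
  rw [integral_map ha.aemeasurable hm.aestronglyMeasurable]
  refine (integral_poisson_colorSum _ (hm.fun_comp ha) hi').trans ?_
  refine integral_congr_ae (Filter.Eventually.of_forall fun τ => ?_)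
  exact colorSum_pair W J τ

/-- The configurations of a product. -/
abbrev pairMeasure (I : Set ℝ) : Measure (List (ℝ × PairKind)) :=
  poisson (labelled (baseMeasure I) PairKind)

theorem measurable_pairUnion_left (α : List (ℝ × Bool)) :
    Measurable fun ζ : Multiset (ℝ × (Kind ⊕ Bool)) => pairUnion α ζ :=
  measurable_multiset_iff.2
    ((measurable_labelledUnion (X := ℝ) (Equiv.refl PairKind)).comp measurable_prodMk_left)

theorem measurable_union_left (e : Bool ⊕ Bool ≃ Kind) (α : List (ℝ × Bool)) :
    Measurable fun τ : Multiset (ℝ × Bool) => labelledUnion e α τ :=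
  measurable_multiset_iff.2 ((measurable_labelledUnion (X := ℝ) e).comp measurable_prodMk_left)

variable {κ₁ κ₂ : Multiset (ℝ × Kind) → ℂ}

/-- Tonelli for the composition: with the points of the first operator fixed, integrating out those
of the second alone and summing the second bits of the common points evaluates the intermediate
vector at the points the first operator annihilates. -/
theorem lintegral_pair_eq {u v : Multiset (ℝ × Kind) → ℝ≥0∞} (hu : Measurable u)
    (hv : Measurable v) :
    ∫⁻ ζ : List (ℝ × PairKind), u (filterKind firstKind ζ) * v (filterKind secondKind ζ)
        ∂pairMeasure I =
      ∫⁻ ω : List (ℝ × Kind), u ω * multisetColorSum (fun c : Multiset (ℝ × Bool) =>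
        ∫⁻ ρ : List (ℝ × Bool), v (labelledUnion splitCreate c ρ) ∂binaryMeasure I) (annihPts ω)
        ∂kindMeasure I := by
  have hF : Measurable fun ζ => u (filterKind firstKind ζ) * v (filterKind secondKind ζ) :=
    (hu.comp (measurable_filterKind _)).mul (hv.comp (measurable_filterKind _))
  have hJ : Measurable fun c : Multiset (ℝ × Bool) =>
      ∫⁻ ρ : List (ℝ × Bool), v (labelledUnion splitCreate c ρ) ∂binaryMeasure I :=
    measurable_multiset_iff.2
      (hv.comp (measurable_labelledUnion splitCreate)).lintegral_prod_right'
  have hR : Measurable fun ω => u ω * multisetColorSum (fun c : Multiset (ℝ × Bool) =>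
        ∫⁻ ρ : List (ℝ × Bool), v (labelledUnion splitCreate c ρ) ∂binaryMeasure I)
        (annihPts ω) := hu.mul ((measurable_multisetColorSum hJ).comp measurable_annihPts)
  rw [lintegral_poisson_labelled _ (Equiv.refl PairKind) hF,
    lintegral_poisson_labelled _ splitAnnih hR]
  refine lintegral_congr fun α => ?_
  rw [lintegral_poisson_labelled _ (Equiv.refl (Kind ⊕ Bool))
    (hF.fun_comp (measurable_pairUnion_left α))]
  simp only [filterKind_first, filterKind_second, annihPts_union]
  rw [← lintegral_kind_pair (hu.fun_comp (measurable_union_left splitAnnih α)) hJ]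
  refine lintegral_congr fun τ => ?_
  rw [lintegral_const_mul]
  exact (hv.fun_comp (measurable_labelledUnion splitCreate)).fun_comp
    (f := fun ρ => (τ.map (relabel Prod.snd), ρ)) measurable_prodMk_left

theorem integral_pair_eq {u v : Multiset (ℝ × Kind) → ℂ} (hu : Measurable u)
    (hv : Measurable v)
    (hi : Integrable (fun ζ : List (ℝ × PairKind) =>
      u (filterKind firstKind ζ) * v (filterKind secondKind ζ)) (pairMeasure I))
    (hi' : Integrable (fun ω : List (ℝ × Kind) => u ω *
      multisetColorSum (fun c : Multiset (ℝ × Bool) =>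
        ∫ ρ : List (ℝ × Bool), v (labelledUnion splitCreate c ρ) ∂binaryMeasure I) (annihPts ω))
      (kindMeasure I)) :
    ∫ ζ : List (ℝ × PairKind), u (filterKind firstKind ζ) * v (filterKind secondKind ζ)
        ∂pairMeasure I =
      ∫ ω : List (ℝ × Kind), u ω * multisetColorSum (fun c : Multiset (ℝ × Bool) =>
        ∫ ρ : List (ℝ × Bool), v (labelledUnion splitCreate c ρ) ∂binaryMeasure I) (annihPts ω)
        ∂kindMeasure I := by
  have hF : Measurable fun ζ => u (filterKind firstKind ζ) * v (filterKind secondKind ζ) :=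
    (hu.comp (measurable_filterKind _)).mul (hv.comp (measurable_filterKind _))
  have hJ : Measurable fun c : Multiset (ℝ × Bool) =>
      ∫ ρ : List (ℝ × Bool), v (labelledUnion splitCreate c ρ) ∂binaryMeasure I :=
    measurable_multiset_iff.2 (hv.comp
      (measurable_labelledUnion splitCreate)).stronglyMeasurable.integral_prod_right'.measurable
  have hR : Measurable fun ω => u ω * multisetColorSum (fun c : Multiset (ℝ × Bool) =>
        ∫ ρ : List (ℝ × Bool), v (labelledUnion splitCreate c ρ) ∂binaryMeasure I)
        (annihPts ω) := hu.mul ((measurable_multisetColorSum hJ).comp measurable_annihPts)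
  have hp := (integrable_poisson_labelled_iff _ (Equiv.refl PairKind) hF).1 hi
  have hp' := (integrable_poisson_labelled_iff _ splitAnnih hR).1 hi'
  rw [integral_poisson_labelled _ (Equiv.refl PairKind) hF,
    integral_poisson_labelled _ splitAnnih hR, integral_prod _ hp, integral_prod _ hp']
  refine integral_congr_ae ?_
  -- Fubini gives integrability of the inner section for almost every α only, so the inner identity
  -- is proved under that restriction.
  filter_upwards [hp.prod_right_ae] with α hα
  have hFα := hF.fun_comp (measurable_pairUnion_left α)
  have hq := (integrable_poisson_labelled_iff _ (Equiv.refl (Kind ⊕ Bool)) hFα).1 hα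
  have e := integral_poisson_labelled (baseMeasure I) (Equiv.refl (Kind ⊕ Bool)) hFα
  have hql := hq.integral_prod_left
  refine e.trans ?_
  rw [integral_prod _ hq]
  simp only [filterKind_first, filterKind_second, annihPts_union, integral_const_mul] at hql ⊢
  exact integral_kind_pair (hu.fun_comp (measurable_union_left splitAnnih α)) hJ hql

/-- The form of a product of operators, as one integral over configurations. -/
theorem kernelForm_comp (h₁ : IsKernel I κ₁) (h₂ : IsKernel I κ₂) (g : Fock I)
    {f h : expDomain I}
    (hh : ∀ᵐ l : List ℝ ∂poisson (baseMeasure I),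
      hat (h : Fock I) l = kernelApply I κ₂ (hat (f : Fock I)) l) :
    Integrable (fun ζ : List (ℝ × PairKind) =>
      (κ₁ (filterKind firstKind ζ) * conj (hat g (createPts (filterKind firstKind ζ)))) *
        (κ₂ (filterKind secondKind ζ) * hat (f : Fock I) (annihPts (filterKind secondKind ζ))))
      (pairMeasure I) ∧
    kernelForm I κ₁ g h = ∫ ζ : List (ℝ × PairKind),
      (κ₁ (filterKind firstKind ζ) * conj (hat g (createPts (filterKind firstKind ζ)))) *
        (κ₂ (filterKind secondKind ζ) * hat (f : Fock I) (annihPts (filterKind secondKind ζ)))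
      ∂pairMeasure I := by
  have hg := measurable_hat g
  have hf := measurable_hat (f : Fock I)
  have hu : Measurable fun ω => κ₁ ω * conj (hat g (createPts ω)) :=
    h₁.measurable.mul (Complex.continuous_conj.measurable.comp (hg.comp measurable_createPts))
  have hv : Measurable fun ω => κ₂ ω * hat (f : Fock I) (annihPts ω) :=
    h₂.measurable.mul (hf.comp measurable_annihPts)
  have hi : Integrable (fun ζ : List (ℝ × PairKind) =>
      (κ₁ (filterKind firstKind ζ) * conj (hat g (createPts (filterKind firstKind ζ)))) *
        (κ₂ (filterKind secondKind ζ) * hat (f : Fock I) (annihPts (filterKind secondKind ζ))))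
      (pairMeasure I) := by
    refine ⟨(measurable_multiset_iff.1 ((hu.comp (measurable_filterKind firstKind)).mul
      (hv.comp (measurable_filterKind secondKind)))).aestronglyMeasurable, ?_⟩
    rw [hasFiniteIntegral_iff_enorm]
    simp only [enorm_mul, RCLike.enorm_conj]
    have hu' : Measurable fun ω => ‖κ₁ ω‖ₑ * ‖hat g (createPts ω)‖ₑ :=
      h₁.measurable.enorm.mul (hg.enorm.comp measurable_createPts)
    have hv' : Measurable fun ω => ‖κ₂ ω‖ₑ * ‖hat (f : Fock I) (annihPts ω)‖ₑ :=
      h₂.measurable.enorm.mul (hf.enorm.comp measurable_annihPts)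
    -- Absolute values compose like the operators themselves: `absApply` of the second kernel again
    -- has all exponential moments, so the first kernel can be paired with it.
    rw [lintegral_pair_eq hu' hv']
    have := lintegral_kind_lt_top h₁ hg.enorm (measurable_absApply (I := I) h₂.measurable hf.enorm)
      (lintegral_hat_sq_lt_top g) (expMoments_absApply h₂ hf.enorm (expMoments_hat f))
    simpa only [absApply, mul_assoc] using this
  refine ⟨hi, ?_⟩
  have hm := measurable_kernelApply (I := I) h₂.measurable hf
  have hi' := integrable_kind h₁ hg hm (lintegral_hat_sq_lt_top g)
    (expMoments_kernelApply h₂ hf (expMoments_hat f))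
  simp only [← mul_assoc (κ₁ _)] at hi'
  refine Eq.trans ?_ (integral_pair_eq hu hv hi hi').symm
  -- The identity for the intermediate vector holds almost everywhere on configurations, but it is
  -- needed at the points annihilated by the first operator.
  have ha := ae_annihPts (measurableSet_eq_fun (measurable_hat (h : Fock I)) hm) hh
  refine integral_congr_ae ?_
  filter_upwards [ha] with ω hω
  rw [hω, ← mul_assoc]
  rfl

end Composition

/-! ### Regular representatives of admissible tensors -/

section Regularization

variable {I : Set ℝ} {ι : Type} [Fintype ι] [DecidableEq ι]

theorem matSize_eq_enorm (M : Matrix ι ι ℂ) : matSize M = ‖∑ i, ∑ j, ‖M i j‖‖ₑ := by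
  rw [Real.enorm_eq_ofReal (by positivity), ENNReal.ofReal_sum_of_nonneg fun _ _ => by positivity]
  refine Finset.sum_congr rfl fun i _ => ?_
  rw [ENNReal.ofReal_sum_of_nonneg fun _ _ => by positivity]
  exact Finset.sum_congr rfl fun j _ => (ofReal_norm _).symm

theorem lintegral_matSize_lt_top {M : ℝ → Matrix ι ι ℂ}
    (hM : ∀ i j, MemLp (fun x => M x i j) 1 (baseMeasure I)) :
    ∫⁻ x, matSize (M x) ∂baseMeasure I < ∞ := by
  have h : MemLp (fun x => ∑ i, ∑ j, ‖M x i j‖) 1 (baseMeasure I) :=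
    memLp_finsetSum _ fun i _ => memLp_finsetSum _ fun j _ => (hM i j).norm
  simp only [matSize_eq_enorm]
  exact (memLp_one_iff_integrable.1 h).2

theorem lintegral_matSize_sq_lt_top {M : ℝ → Matrix ι ι ℂ}
    (hM : ∀ i j, MemLp (fun x => M x i j) 2 (baseMeasure I)) :
    ∫⁻ x, matSize (M x) ^ 2 ∂baseMeasure I < ∞ := by
  have h : MemLp (fun x => ∑ i, ∑ j, ‖M x i j‖) 2 (baseMeasure I) :=
    memLp_finsetSum _ fun i _ => memLp_finsetSum _ fun j _ => (hM i j).norm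
  have h2 := lintegral_rpow_enorm_lt_top_of_eLpNorm_lt_top (by simp) (by simp) h.2
  simpa only [matSize_eq_enorm, ENNReal.toReal_ofNat, ENNReal.rpow_ofNat] using h2

/-- The bounded function that agrees with an essentially bounded one almost everywhere. -/
theorem exists_bounded_representative {α : Type*} [MeasurableSpace α] {μ : Measure α} {φ : α → ℂ}
    (hφ : MemLp φ ∞ μ) :
    ∃ χ : α → ℂ, Measurable χ ∧ φ =ᵐ[μ] χ ∧ ∀ x, ‖χ x‖ₑ ≤ eLpNormEssSup φ μ := by
  classical
  have hm := hφ.1.stronglyMeasurable_mk.measurable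
  refine ⟨fun x => if ‖hφ.1.mk φ x‖ₑ ≤ eLpNormEssSup φ μ then hφ.1.mk φ x else 0,
    Measurable.ite (measurableSet_le hm.enorm measurable_const) hm measurable_const, ?_, fun x => ?_⟩
  · filter_upwards [hφ.1.ae_eq_mk, enorm_ae_le_eLpNormEssSup φ μ] with x h1 h2
    rw [← h1, if_pos h2]
  · dsimp only
    split_ifs with h
    · exact h
    · simp

/-- Agreement of tensors almost everywhere. -/
structure Tensors.AEEq (I : Set ℝ) (A A' : Tensors ι) : Prop where
  boundary : A.B = A'.B
  coeff : ∀ᵐ x ∂baseMeasure I, ∀ k, A.coeff (x, k) = A'.coeff (x, k)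

/-- Measurable representatives are taken entry by entry. The entries of T are also cut off at their
essential supremum, since a `Majorant` bounds T at every point. -/
theorem Tensors.Admissible.exists_regular {A : Tensors ι} (hA : A.Admissible I) :
    ∃ A' : Tensors ι, A'.Regular I ∧ A.AEEq I A' := by
  have rep : ∀ {p : ℝ≥0∞} {M : ℝ → Matrix ι ι ℂ},
      (∀ i j, MemLp (fun x => M x i j) p (baseMeasure I)) →
      ∃ M' : ℝ → Matrix ι ι ℂ, (∀ i j, Measurable fun x => M' x i j) ∧
        (∀ i j, MemLp (fun x => M' x i j) p (baseMeasure I)) ∧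
        ∀ᵐ x ∂baseMeasure I, M x = M' x := by
    intro p M hM
    refine ⟨fun x i j => (hM i j).1.mk _ x,
      fun i j => (hM i j).1.stronglyMeasurable_mk.measurable,
      fun i j => (memLp_congr_ae (hM i j).1.ae_eq_mk).1 (hM i j), ?_⟩
    filter_upwards [ae_all_iff.2 fun i => ae_all_iff.2 fun j => (hM i j).1.ae_eq_mk] with x hx
    ext i j
    exact hx i j
  obtain ⟨Q, hQm, hQ, hQe⟩ := rep hA.Q_mem
  obtain ⟨L, hLm, hL, hLe⟩ := rep hA.L_mem
  obtain ⟨R, hRm, hR, hRe⟩ := rep hA.R_mem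
  choose T hTm hTe hT using fun i j => exists_bounded_representative (hA.T_mem i j)
  let A' : Tensors ι := ⟨A.B, Q, L, R, fun x i j => T i j x⟩
  have hm : ∀ k i j, Measurable fun x => A'.coeff (x, k) i j := by
    rintro ⟨_ | _, _ | _⟩ i j
    exacts [hQm i j, hRm i j, hLm i j, hTm i j]
  refine ⟨A', ⟨hm, ?_, lintegral_matSize_lt_top hQ, lintegral_matSize_sq_lt_top hL,
    lintegral_matSize_sq_lt_top hR, ?_⟩, rfl, ?_⟩
  · refine measurable_from_prod_countable_left fun k => ?_
    exact Finset.measurable_fun_sum _ fun i _ => Finset.measurable_fun_sum _ fun j _ =>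
      (hm k i j).enorm
  · have hfin : ∑ i, ∑ j, eLpNormEssSup (fun x => A.T x i j) (baseMeasure I) ≠ ∞ := by
      refine ENNReal.sum_ne_top.2 fun i _ => ENNReal.sum_ne_top.2 fun j _ => ?_
      rw [← eLpNorm_exponent_top]
      exact (hA.T_mem i j).2.ne
    refine ⟨_, fun x => le_of_le_of_eq ?_ (ENNReal.coe_toNNReal hfin).symm⟩
    exact Finset.sum_le_sum fun i _ => Finset.sum_le_sum fun j _ => hT i j x
  · filter_upwards [hQe, hLe, hRe, ae_all_iff.2 fun i => ae_all_iff.2 fun j => hTe i j]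
      with x h1 h2 h3 h4
    rintro ⟨_ | _, _ | _⟩
    · exact h1
    · exact h3
    · exact h2
    · ext i j
      exact h4 i j

theorem foldr_generator_congr {A A' : Tensors ι} {l : List ℝ}
    (h : ∀ x ∈ l, ∀ k, A.coeff (x, k) = A'.coeff (x, k)) :
    l.foldr (generator A) (vacuumProj ι) = l.foldr (generator A') (vacuumProj ι) := by
  induction l with
  | nil => rfl
  | cons x l ih =>
    rw [List.foldr_cons, List.foldr_cons, ih fun y hy => h y (List.mem_cons_of_mem _ hy)]
    have hx := h x List.mem_cons_self
    have h1 : A.Q x = A'.Q x := hx (false, false)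
    have h2 : A.L x = A'.L x := hx (true, false)
    have h3 : A.R x = A'.R x := hx (false, true)
    have h4 : A.T x = A'.T x := hx (true, true)
    unfold generator
    rw [h1, h2, h3, h4]

theorem Tensors.AEEq.dysonIntegrand {A A' : Tensors ι} (h : A.AEEq I A') (n : ℕ) (g f : WaveFn) :
    (fun x : Fin n → ℝ => dysonIntegrand A x g f) =ᵐ[configMeasure I n]
      fun x => dysonIntegrand A' x g f := by
  have h1 : ∀ᵐ x : Fin n → ℝ ∂configMeasure I n, ∀ i k, A.coeff (x i, k) = A'.coeff (x i, k) :=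
    ae_all_iff.2 fun i =>
      (Measure.tendsto_eval_ae_ae (μ := fun _ : Fin n => baseMeasure I) (i := i)).eventually h.coeff
  filter_upwards [h1] with x hx
  unfold CMPO.dysonIntegrand
  rw [h.boundary, foldr_generator_congr (A' := A')]
  intro y hy
  obtain ⟨i, rfl⟩ := (List.mem_ofFn' _ _).1 hy
  exact hx i

/-- The Dyson series depends on the tensors only up to null sets. -/
theorem Tensors.AEEq.hasSum_dyson {A A' : Tensors ι} (h : A.AEEq I A') {g f : WaveFn} {s : ℂ}
    (hs : (∀ n : ℕ, IntegrableOn (fun x : Fin n → ℝ => CMPO.dysonIntegrand A' x g f)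
        {x | StrictMono x} (configMeasure I n)) ∧
      HasSum (fun n : ℕ => ∫ x : Fin n → ℝ in {x | StrictMono x},
        CMPO.dysonIntegrand A' x g f ∂configMeasure I n) s) :
    (∀ n : ℕ, IntegrableOn (fun x : Fin n → ℝ => CMPO.dysonIntegrand A x g f)
        {x | StrictMono x} (configMeasure I n)) ∧
      HasSum (fun n : ℕ => ∫ x : Fin n → ℝ in {x | StrictMono x},
        CMPO.dysonIntegrand A x g f ∂configMeasure I n) s := by
  have he : ∀ n, (fun x : Fin n → ℝ => CMPO.dysonIntegrand A x g f)
      =ᵐ[(configMeasure I n).restrict {x | StrictMono x}]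
      fun x => CMPO.dysonIntegrand A' x g f := fun n => ae_restrict_of_ae (h.dysonIntegrand n g f)
  exact ⟨fun n => (hs.1 n).congr (he n).symm, hs.2.congr_fun fun n => integral_congr_ae (he n)⟩

/-- The operator with admissible tensors is the operator of their kernel. -/
theorem isCMPOWith_iff {A A' : Tensors ι} (hA : A.Admissible I) (hA' : A'.Regular I)
    (h : A.AEEq I A') (O : expDomain I →ₗ[ℂ] expDomain I) :
    IsCMPOWith I A O ↔ ∀ (g : Fock I) (f : expDomain I),
      ⟪g, (O f : Fock I)⟫_ℂ = kernelForm I A'.kernel g f := by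
  have hs := fun g f => h.hasSum_dyson (hasSum_dyson_of_regular hA' g f)
  refine ⟨fun hO g f => (hO.2 g f).2.unique (hs g f).2, fun hO => ⟨hA, fun g f => ?_⟩⟩
  rw [hO]
  exact hs g f

theorem existsUnique_isCMPOWith {A : Tensors ι} (hA : A.Admissible I) :
    ∃! O : expDomain I →ₗ[ℂ] expDomain I, IsCMPOWith I A O := by
  obtain ⟨A', hA', h⟩ := hA.exists_regular
  obtain ⟨O, hO⟩ := exists_kernel_operator hA'.isKernel
  refine ⟨O, (isCMPOWith_iff hA hA' h O).2 hO, fun O' hO' => ?_⟩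
  ext1 f
  refine Subtype.ext (ext_inner_left ℂ fun g => ?_)
  rw [hO, (isCMPOWith_iff hA hA' h O').1 hO']

end Regularization

/-! ### The product rule -/

section Product

variable {I : Set ℝ} {ι κ : Type} [Fintype ι] [DecidableEq ι] [Fintype κ] [DecidableEq κ]

/-- Hölder's inequality: R₁L₂ lies in L² · L² ⊆ L¹, the terms T₁L₂ and R₁T₂ in L^∞ · L² ⊆ L², and
T₁T₂ in L^∞. -/
theorem Tensors.Admissible.prod {A₁ : Tensors ι} {A₂ : Tensors κ} (h₁ : A₁.Admissible I)
    (h₂ : A₂.Admissible I) : (A₁.prod A₂).Admissible I where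
  Q_mem i j := by
    have h : MemLp (fun x => A₁.R x i.1 j.1 * A₂.L x i.2 j.2) 1 (volume.restrict I) :=
      (h₂.L_mem i.2 j.2).mul (p := 2) (q := 2) (h₁.R_mem i.1 j.1)
    exact (((h₁.Q_mem i.1 j.1).mul_const _).add ((h₂.Q_mem i.2 j.2).const_mul _)).add h
  L_mem i j := by
    have h : MemLp (fun x => A₁.T x i.1 j.1 * A₂.L x i.2 j.2) 2 (volume.restrict I) :=
      (h₂.L_mem i.2 j.2).mul (p := ∞) (q := 2) (h₁.T_mem i.1 j.1)
    exact ((h₁.L_mem i.1 j.1).mul_const _).add h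
  R_mem i j := by
    have h : MemLp (fun x => A₁.R x i.1 j.1 * A₂.T x i.2 j.2) 2 (volume.restrict I) :=
      (h₂.T_mem i.2 j.2).mul (p := 2) (q := ∞) (h₁.R_mem i.1 j.1)
    exact ((h₂.R_mem i.2 j.2).const_mul _).add h
  T_mem i j :=
    (h₂.T_mem i.2 j.2).mul (p := ∞) (q := ∞) (h₁.T_mem i.1 j.1)

theorem Tensors.AEEq.prod {A₁ A₁' : Tensors ι} {A₂ A₂' : Tensors κ} (h₁ : A₁.AEEq I A₁')
    (h₂ : A₂.AEEq I A₂') : (A₁.prod A₂).AEEq I (A₁'.prod A₂') where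
  boundary := by rw [Tensors.prod, Tensors.prod, h₁.boundary, h₂.boundary]
  coeff := by
    filter_upwards [h₁.coeff, h₂.coeff] with x hx hy k
    have h1 : A₁.Q x = A₁'.Q x := hx (false, false)
    have h2 : A₁.L x = A₁'.L x := hx (true, false)
    have h3 : A₁.R x = A₁'.R x := hx (false, true)
    have h4 : A₁.T x = A₁'.T x := hx (true, true)
    have k1 : A₂.Q x = A₂'.Q x := hy (false, false)
    have k2 : A₂.L x = A₂'.L x := hy (true, false)
    have k3 : A₂.R x = A₂'.R x := hy (false, true)
    have k4 : A₂.T x = A₂'.T x := hy (true, true)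
    rcases k with ⟨_ | _, _ | _⟩ <;>
      simp only [Tensors.coeff, Tensors.prod, h1, h2, h3, h4, k1, k2, k3, k4]

/-- The labelled points that a partial change of labels leaves, in their order. -/
def filterList {A B : Type*} (c : A → Option B) (t : List (ℝ × A)) : List (ℝ × B) :=
  t.filterMap fun p => (c p.2).map fun k => (p.1, k)

theorem filterKind_coe {A B : Type*} (c : A → Option B) (t : List (ℝ × A)) :
    filterKind c t = filterList c t := rfl

theorem pairwise_filterList {A B : Type*} (c : A → Option B) {t : List (ℝ × A)}
    (ht : t.Pairwise fun p q => p.1 < q.1) :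
    (filterList c t).Pairwise fun p q => p.1 < q.1 := by
  refine List.Pairwise.filterMap _ (fun p q h b hb b' hb' => ?_) ht
  obtain ⟨k, _, rfl⟩ := Option.map_eq_some_iff.1 hb
  obtain ⟨k', _, rfl⟩ := Option.map_eq_some_iff.1 hb'
  exact h

/-- The product generator has eight terms, one for each pair kind, with the identity matrix where a
factor has no point. By the mixed-product rule for Kronecker products, the coefficients of each
operator collect on their own leg in the order of the points. -/
theorem foldr_generator_prod (A₁ : Tensors ι) (A₂ : Tensors κ) (l : List ℝ) (g f : WaveFn) :
    l.foldr (generator (A₁.prod A₂)) (vacuumProj (ι × κ)) g f =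
      colorSum (fun t : List (ℝ × PairKind) =>
        (conj (vacuumValue (createList (filterList firstKind t)) g) *
          vacuumValue (annihList (filterList secondKind t)) f) •
        (((filterList firstKind t).map A₁.coeff).prod ⊗ₖ
          ((filterList secondKind t).map A₂.coeff).prod)) l := by
  induction l generalizing g f with
  | nil => simp [colorSum, filterList, createList, annihList, vacuumValue, vacuumProj]
  | cons x l ih =>
    have key : ∀ (c : PairKind) (g' f' : WaveFn) (M : Matrix ι ι ℂ) (N : Matrix κ κ ℂ)
        (_ : ∀ t, vacuumValue (createList (filterList firstKind ((x, c) :: t))) g =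
          vacuumValue (createList (filterList firstKind t)) g')
        (_ : ∀ t, vacuumValue (annihList (filterList secondKind ((x, c) :: t))) f =
          vacuumValue (annihList (filterList secondKind t)) f')
        (_ : ∀ t, ((filterList firstKind ((x, c) :: t)).map A₁.coeff).prod =
          M * ((filterList firstKind t).map A₁.coeff).prod)
        (_ : ∀ t, ((filterList secondKind ((x, c) :: t)).map A₂.coeff).prod =
          N * ((filterList secondKind t).map A₂.coeff).prod),
        colorSum (fun t : List (ℝ × PairKind) =>
          (conj (vacuumValue (createList (filterList firstKind ((x, c) :: t))) g) *
            vacuumValue (annihList (filterList secondKind ((x, c) :: t))) f) •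
          (((filterList firstKind ((x, c) :: t)).map A₁.coeff).prod ⊗ₖ
            ((filterList secondKind ((x, c) :: t)).map A₂.coeff).prod)) l =
          (M ⊗ₖ N) * l.foldr (generator (A₁.prod A₂)) (vacuumProj (ι × κ)) g' f' := by
      intro c g' f' M N h1 h2 h3 h4
      rw [ih, ← colorSum_const_mul]
      refine colorSum_congr fun t _ => ?_
      rw [h1, h2, h3, h4, Matrix.mul_smul, Matrix.mul_kronecker_mul]
    simp only [List.foldr_cons, colorSum, Fintype.sum_sum_type, Fintype.sum_prod_type,
      Fintype.sum_bool]
    rw [key (Sum.inl true) (annih x g) f (A₁.L x) 1 (fun _ => rfl) (fun _ => rfl)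
        (fun _ => rfl) (fun _ => (one_mul _).symm),
      key (Sum.inl false) g f (A₁.Q x) 1 (fun _ => rfl) (fun _ => rfl)
        (fun _ => rfl) (fun _ => (one_mul _).symm),
      key (Sum.inr (Sum.inl (true, true))) (annih x g) (annih x f) (A₁.T x) (A₂.T x)
        (fun _ => rfl) (fun _ => rfl) (fun _ => rfl) (fun _ => rfl),
      key (Sum.inr (Sum.inl (true, false))) (annih x g) f (A₁.T x) (A₂.L x)
        (fun _ => rfl) (fun _ => rfl) (fun _ => rfl) (fun _ => rfl),
      key (Sum.inr (Sum.inl (false, true))) g (annih x f) (A₁.R x) (A₂.T x)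
        (fun _ => rfl) (fun _ => rfl) (fun _ => rfl) (fun _ => rfl),
      key (Sum.inr (Sum.inl (false, false))) g f (A₁.R x) (A₂.L x)
        (fun _ => rfl) (fun _ => rfl) (fun _ => rfl) (fun _ => rfl),
      key (Sum.inr (Sum.inr true)) g (annih x f) 1 (A₂.R x) (fun _ => rfl) (fun _ => rfl)
        (fun _ => (one_mul _).symm) (fun _ => rfl),
      key (Sum.inr (Sum.inr false)) g f 1 (A₂.Q x) (fun _ => rfl) (fun _ => rfl)
        (fun _ => (one_mul _).symm) (fun _ => rfl)]
    simp only [generator, lMap, rMap, adMap, Tensors.prod, add_mul]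
    abel

/-- The integrand of the form of a product of operators. -/
def productIntegrand (A₁ : Tensors ι) (A₂ : Tensors κ) (g f : Fock I)
    (ζ : Multiset (ℝ × PairKind)) : ℂ :=
  (A₁.kernel (filterKind firstKind ζ) * conj (hat g (createPts (filterKind firstKind ζ)))) *
    (A₂.kernel (filterKind secondKind ζ) * hat f (annihPts (filterKind secondKind ζ)))

theorem measurable_productIntegrand {A₁ : Tensors ι} {A₂ : Tensors κ} (h₁ : A₁.Regular I)
    (h₂ : A₂.Regular I) (g f : Fock I) : Measurable (productIntegrand A₁ A₂ g f) := by
  have hu : Measurable fun ω => A₁.kernel ω * conj (hat g (createPts ω)) :=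
    h₁.isKernel.measurable.mul
      (Complex.continuous_conj.measurable.comp ((measurable_hat g).comp measurable_createPts))
  have hv : Measurable fun ω => A₂.kernel ω * hat f (annihPts ω) :=
    h₂.isKernel.measurable.mul ((measurable_hat f).comp measurable_annihPts)
  exact (hu.comp (measurable_filterKind _)).mul (hv.comp (measurable_filterKind _))

theorem dysonIntegrand_prod (A₁ : Tensors ι) (A₂ : Tensors κ) (g f : Fock I) {n : ℕ}
    {x : Fin n → ℝ} (hx : StrictMono x) :
    dysonIntegrand (A₁.prod A₂) x (wave g) (wave f) =
      multisetColorSum (productIntegrand A₁ A₂ g f) (List.ofFn x) := by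
  have hl : (List.ofFn x).Pairwise (· < ·) := List.pairwise_ofFn.2 fun i j hij => hx hij
  rw [dysonIntegrand, foldr_generator_prod, multisetColorSum_coe]
  refine (map_colorSum ((Matrix.traceAddMonoidHom (ι × κ) ℂ).comp
    (AddMonoidHom.mulLeft (A₁.prod A₂).B)) _ _).trans (colorSum_congr fun t ht => ?_)
  have htp : t.Pairwise fun p q => p.1 < q.1 := by
    rw [← ht] at hl
    exact List.pairwise_map.1 hl
  have hp1 := pairwise_filterList firstKind htp
  have hp2 := pairwise_filterList secondKind htp
  simp only [AddMonoidHom.comp_apply, AddMonoidHom.coe_mulLeft, Matrix.traceAddMonoidHom_apply,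
    productIntegrand, filterKind_coe]
  rw [A₁.kernel_of_pairwise hp1, A₂.kernel_of_pairwise hp2, createPts_coe, annihPts_coe,
    hat_of_pairwise g (pairwise_createList hp1), hat_of_pairwise f (pairwise_annihList hp2),
    vacuumValue_eq_listWave, vacuumValue_eq_listWave, Matrix.mul_smul, Matrix.trace_smul,
    smul_eq_mul]
  simp only [Tensors.prod]
  rw [← Matrix.mul_kronecker_mul, Matrix.trace_kronecker]
  ring

/-- The matrix element of O₁O₂ and the Dyson series of the product tensors are both the integral of
`productIntegrand` over pair configurations: the first by `kernelForm_comp`, the second by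
`dysonIntegrand_prod` on each simplex. -/
theorem IsCMPOWith.comp {A₁ : Tensors ι} {A₂ : Tensors κ}
    {O₁ O₂ : expDomain I →ₗ[ℂ] expDomain I} (h₁ : IsCMPOWith I A₁ O₁) (h₂ : IsCMPOWith I A₂ O₂) :
    IsCMPOWith I (A₁.prod A₂) (O₁ ∘ₗ O₂) := by
  obtain ⟨A₁', hA₁, e₁⟩ := h₁.1.exists_regular
  obtain ⟨A₂', hA₂, e₂⟩ := h₂.1.exists_regular
  have hO₁ := (isCMPOWith_iff h₁.1 hA₁ e₁ O₁).1 h₁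
  have hO₂ := (isCMPOWith_iff h₂.1 hA₂ e₂ O₂).1 h₂
  refine ⟨h₁.1.prod h₂.1, fun g f => (e₁.prod e₂).hasSum_dyson ?_⟩
  have hm := measurable_productIntegrand hA₁ hA₂ g (f : Fock I)
  have hm' := measurable_multiset_iff.1 hm
  obtain ⟨hi, he⟩ := kernelForm_comp hA₁.isKernel hA₂.isKernel g
    (ae_hat_eq_kernelApply hA₂.isKernel fun g => hO₂ g f)
  have hc := integrable_poisson_colorSum _ hm' hi
  obtain ⟨h3, h4⟩ := hasSum_integral_simplex I (measurable_multisetColorSum hm) hc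
  refine ⟨fun n => (h3 n).congr_fun (fun x hx => ?_) (measurableSet_strictMono n), ?_⟩
  · exact (dysonIntegrand_prod A₁' A₂' g f hx).symm
  · rw [LinearMap.comp_apply, hO₁, he.trans (integral_poisson_colorSum _ hm' hi)]
    refine h4.congr_fun fun n => ?_
    refine setIntegral_congr_fun (measurableSet_strictMono n) fun x hx => ?_
    exact dysonIntegrand_prod A₁' A₂' g f hx

/-- Tensors with renamed bond indices. -/
def Tensors.reindex (e : ι ≃ κ) (A : Tensors ι) : Tensors κ where
  B := A.B.submatrix e.symm e.symm
  Q x := (A.Q x).submatrix e.symm e.symm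
  L x := (A.L x).submatrix e.symm e.symm
  R x := (A.R x).submatrix e.symm e.symm
  T x := (A.T x).submatrix e.symm e.symm

theorem foldr_generator_reindex (e : ι ≃ κ) (A : Tensors ι) (l : List ℝ) (g f : WaveFn) :
    l.foldr (generator (A.reindex e)) (vacuumProj κ) g f =
      (l.foldr (generator A) (vacuumProj ι) g f).submatrix e.symm e.symm := by
  induction l generalizing g f with
  | nil => simp [vacuumProj, Matrix.submatrix_smul]
  | cons x l ih =>
    simp only [List.foldr_cons, generator, lMap, rMap, adMap, ih]
    simp only [Tensors.reindex, Matrix.submatrix_mul_equiv, Matrix.submatrix_add, Pi.add_apply]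

theorem dysonIntegrand_reindex (e : ι ≃ κ) (A : Tensors ι) {n : ℕ} (x : Fin n → ℝ) (g f : WaveFn) :
    dysonIntegrand (A.reindex e) x g f = dysonIntegrand A x g f := by
  unfold dysonIntegrand
  rw [foldr_generator_reindex, Tensors.reindex, Matrix.submatrix_mul_equiv]
  exact Fintype.sum_equiv e.symm _ _ fun _ => rfl

theorem IsCMPOWith.reindex (e : ι ≃ κ) {A : Tensors ι} {O : expDomain I →ₗ[ℂ] expDomain I}
    (h : IsCMPOWith I A O) : IsCMPOWith I (A.reindex e) O := by
  refine ⟨⟨fun i j => h.1.Q_mem _ _, fun i j => h.1.L_mem _ _, fun i j => h.1.R_mem _ _,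
    fun i j => h.1.T_mem _ _⟩, fun g f => ?_⟩
  simp only [dysonIntegrand_reindex]
  exact h.2 g f

end Product

end CMPO

end

theorem mainTheorem1 (I : Set ℝ) (hI : I.OrdConnected) :
    -- admissible tensors define an operator, and only one
    (∀ (D : ℕ) (A : CMPO.Tensors (Fin D)), A.Admissible I →
      ∃! O : CMPO.expDomain I →ₗ[ℂ] CMPO.expDomain I, CMPO.IsCMPOWith I A O) ∧
    -- the product rule
    (∀ (D₁ D₂ : ℕ) (A₁ : CMPO.Tensors (Fin D₁)) (A₂ : CMPO.Tensors (Fin D₂))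
      (O₁ O₂ : CMPO.expDomain I →ₗ[ℂ] CMPO.expDomain I),
      CMPO.IsCMPOWith I A₁ O₁ → CMPO.IsCMPOWith I A₂ O₂ →
        CMPO.IsCMPOWith I (A₁.prod A₂) (O₁ ∘ₗ O₂) ∧
        ∃ D ≤ D₁ * D₂, CMPO.IsCMPO I D (O₁ ∘ₗ O₂)) := by
  refine ⟨fun D A hA => CMPO.existsUnique_isCMPOWith hA, fun D₁ D₂ A₁ A₂ O₁ O₂ h₁ h₂ => ?_⟩
  -- The product tensors are indexed by pairs; renaming the bond indices changes neither the trace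
  -- nor the Dyson integrands, so the bond dimension D₁D₂ itself is attained.
  exact ⟨h₁.comp h₂, D₁ * D₂, le_rfl, _, (h₁.comp h₂).reindex finProdFinEquiv⟩
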